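/- Fix constants $a_1,b_1,a_2,b_2>0$. For each $p$ let $r=r(p)$ be a positive integer and let $y=(y_{ij})_{1\le i\le p,\,1\le j\le r}$ be a real data set (depending on $p$), with $\bar y_i=r^{-1}\sum_{j}y_{ij}$ and $\bar y=(rp)^{-1}\sum_{i,j}y_{ij}$. Consider the Bayesian random effects model $y_{ij}=\mu+\theta_i+e_{ij}$ with independent $\theta_i\sim N(0,\lambda_\theta^{-1})$, $e_{ij}\sim N(0,\lambda_e^{-1})$, and independent priors $\pi(\mu)\propto 1$, $\lambda_\theta\sim\mathrm{Gamma}(a_1,b_1)$, $\lambda_e\sim\mathrm{Gamma}(a_2,b_2)$ (shape, rate). Put $\eta=(\eta_0,\eta_1,\dots,\eta_p)=(\sqrt p\,\mu,\theta_1,\dots,\theta_p)$ and let $\Pi$ be the marginal posterior distribution of $\eta$ on $\mathbb R^{p+1}$, that is, the probability measure with density proportional to $$\int_0^\infty\!\!\int_0^\infty \lambda_e^{rp/2}e^{-\frac{\lambda_e}{2}\sum_{i,j}(y_{ij}-\eta_0/\sqrt p-\eta_i)^2}\,\lambda_\theta^{p/2}e^{-\frac{\lambda_\theta}{2}\sum_{i=1}^p\eta_i^2}\,\lambda_\theta^{a_1-1}e^{-b_1\lambda_\theta}\,\lambda_e^{a_2-1}e^{-b_2\lambda_e}\,d\lambda_\theta\,d\lambda_e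 .$$ Let $K$ be the transition kernel of the $\eta$-marginal Gibbs chain: from the state $\eta$, draw independently $\lambda_\theta\sim\mathrm{Gamma}\big(\tfrac p2+a_1,\,b_1+\tfrac12\sum_{i=1}^p\eta_i^2\big)$ and $\lambda_e\sim\mathrm{Gamma}\big(\tfrac{rp}2+a_2,\,b_2+\tfrac12\sum_{i,j}(y_{ij}-\eta_0/\sqrt p-\eta_i)^2\big)$; then draw $\tilde\eta_0\sim N\big(\sqrt p\,\bar y,\ \tfrac{\lambda_\theta+r\lambda_e}{r\lambda_e\lambda_\theta}\big)$; then draw independently, for $i=1,\dots,p$, $\tilde\eta_i\sim N\big(\tfrac{r\lambda_e(\bar y_i-\tilde\eta_0/\sqrt p)}{\lambda_\theta+r\lambda_e},\ \tfrac1{\lambda_\theta+r\lambda_e}\big)$. The new state is $\tilde\eta$. Write $K^m_\eta$ for the law of the chain after $m$ steps from $\eta$, and $W_\psi$ for the Wasserstein distance induced by the Euclidean distance $\psi$ on $\mathbb R^{p+1}$ (the infimum of $\int\psi\,d\upsilon$ over all couplings $\upsilon$). For a distance $D$ between probability measures, let the convergence rate $\rho_*^D\in[0,1]$ of the chain be the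 infimum in $[0,1]$ of all $\rho$ for which there is a function $M:\mathbb R^{p+1}\to[0,\infty)$ with $D(K^m_\eta,\Pi)\le M(\eta)\rho^m$ for all $m\ge0$ and all $\eta$. Assume: (E1) for some constant $\delta>0$, $r^2/p^{3+\delta}\to\infty$ as $p\to\infty$; (E2) there are positive constants $\ell_1,\ell_2$ such that, for all large $p$, $\frac1p\sum_{i=1}^p(\bar y_i-\bar y)^2<\ell_1$ and $\frac1{rp}\sum_{i=1}^p\sum_{j=1}^r(y_{ij}-\bar y_i)^2<\ell_2$. Then there exist a constant $L_0>0$, independent of $p$, and numbers $\rho=\rho(p)$ such that, for all sufficiently large $p$, $0\le\rho<1$ and $$W_\psi(K^m_\eta,\Pi)\le 4\Big[\sum_{i=1}^p(\eta_i+\bar y-\bar y_i)^2+(\eta_0-\sqrt p\,\bar y)^2+L_0\,p\Big]\rho^m\qquad\text{for all }\eta\in\mathbb R^{p+1},\ m\ge0,$$ and moreover $\limsup_{p\to\infty}\rho=0$. Consequently the convergence rate of the chain with respect to $W_\psi$ and its convergence rate with respect to the total variation distance both tend to $0$ as $p\to\infty$. -/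

import Mathlib

open MeasureTheory ProbabilityTheory Filter Topology
open scoped ENNReal NNReal

/-! ### Distances between probability measures and rates of convergence -/

/-- The Wasserstein distance induced by the metric of `X`: the infimum, over all couplings `υ` of
`μ` and `ν`, of the integral of the distance. It takes values in `[0, ∞]`. -/
noncomputable def wassersteinDist {X : Type*} [PseudoEMetricSpace X] [MeasurableSpace X]
    (μ ν : Measure X) : ℝ≥0∞ :=
  ⨅ (υ : Measure (X × X)) (_ : IsProbabilityMeasure υ ∧ υ.map Prod.fst = μ ∧ υ.map Prod.snd = ν),
    ∫⁻ z, edist z.1 z.2 ∂υ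

/-- The total variation distance: the supremum of the discrepancy over measurable sets. -/
noncomputable def totalVariationDist {X : Type*} [MeasurableSpace X] (μ ν : Measure X) : ℝ≥0∞ :=
  ⨆ (A : Set X) (_ : MeasurableSet A), ENNReal.ofReal |μ.real A - ν.real A|

/-- The geometric convergence rate, with respect to `D`, of the Markov chain with transition
kernel `K` to the probability measure `P`: the infimum, taken in the interval `[0, 1]`, of all `ρ`
such that `D (K ^ m x) P ≤ M x * ρ ^ m` for all `m` and `x`, for some function `M : X → [0, ∞)`.
(The clause `ρ = 1` says that the infimum of the empty set, in `[0, 1]`, is `1`.) -/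
noncomputable def convergenceRate {X : Type*} [MeasurableSpace X]
    (D : Measure X → Measure X → ℝ≥0∞) (K : Kernel X X) (P : Measure X) : ℝ :=
  sInf {ρ : ℝ | 0 ≤ ρ ∧ ρ ≤ 1 ∧
    (ρ = 1 ∨ ∃ M : X → ℝ≥0, ∀ (x : X) (m : ℕ), D ((K ^ m) x) P ≤ M x * ENNReal.ofReal ρ ^ m)}

/-! ### The Bayesian one-way random effects model -/

namespace RandomEffects

/-- The state space `ℝ^(p+1)` of `η = (η₀, η₁, …, η_p)`, with its Euclidean norm. -/
abbrev State (p : ℕ) : Type := EuclideanSpace ℝ (Fin (p + 1))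

section Data

variable {p r : ℕ} (y : Fin p → Fin r → ℝ)

/-- The group mean `ȳ_i`. -/
noncomputable def groupMean (i : Fin p) : ℝ := (∑ j, y i j) / r

/-- The overall mean `ȳ`. -/
noncomputable def grandMean : ℝ := (∑ i, ∑ j, y i j) / (r * p)

/-- `∑ᵢ ηᵢ²`, the sum over `i = 1, …, p`. -/
noncomputable def effectSq (η : State p) : ℝ := ∑ i : Fin p, η i.succ ^ 2

/-- The residual sum of squares `∑ᵢ ∑ⱼ (y_ij - η₀ / √p - η_i)²`. -/
noncomputable def residualSq (η : State p) : ℝ :=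
  ∑ i : Fin p, ∑ j : Fin r, (y i j - η 0 / √(p : ℝ) - η i.succ) ^ 2

/-- The unnormalised posterior density of `(η, λ_θ, λ_e)` given the data `y`, for `λ_θ, λ_e > 0`,
under the prior `π(μ) ∝ 1`, `λ_θ ∼ Gamma(a₁, b₁)`, `λ_e ∼ Gamma(a₂, b₂)`. -/
noncomputable def posteriorDensity (a₁ b₁ a₂ b₂ : ℝ) (η : State p) (lθ le : ℝ) : ℝ :=
  le ^ ((r : ℝ) * p / 2) * Real.exp (-(le / 2) * residualSq y η) *
    (lθ ^ ((p : ℝ) / 2) * Real.exp (-(lθ / 2) * effectSq η)) *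
    (lθ ^ (a₁ - 1) * Real.exp (-b₁ * lθ)) * (le ^ (a₂ - 1) * Real.exp (-b₂ * le))

/-- The measure on `ℝ^(p+1)` with the unnormalised density
`η ↦ ∫₀^∞ ∫₀^∞ π*(η, λ_θ, λ_e | y) dλ_θ dλ_e`. -/
noncomputable def unnormalizedPosterior (a₁ b₁ a₂ b₂ : ℝ) : Measure (State p) :=
  volume.withDensity fun η =>
    ∫⁻ le in Set.Ioi (0 : ℝ), ∫⁻ lθ in Set.Ioi (0 : ℝ),
      ENNReal.ofReal (posteriorDensity y a₁ b₁ a₂ b₂ η lθ le)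

/-- The marginal posterior distribution `Π` of `η`. -/
noncomputable def posterior (a₁ b₁ a₂ b₂ : ℝ) : Measure (State p) :=
  (unnormalizedPosterior y a₁ b₁ a₂ b₂ Set.univ)⁻¹ • unnormalizedPosterior y a₁ b₁ a₂ b₂

lemma measurable_effectSq : Measurable (effectSq (p := p)) := by
  unfold effectSq; fun_prop

lemma measurable_residualSq : Measurable (residualSq y) := by
  unfold residualSq; fun_prop

lemma effectSq_nonneg (η : State p) : 0 ≤ effectSq η :=
  Finset.sum_nonneg fun _ _ => sq_nonneg _

lemma residualSq_nonneg (η : State p) : 0 ≤ residualSq y η :=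
  Finset.sum_nonneg fun _ _ => Finset.sum_nonneg fun _ _ => sq_nonneg _

lemma measurable_gammaMeasure (a : ℝ) : Measurable fun b : ℝ => gammaMeasure a b := by
  refine Measure.measurable_of_measurable_coe _ fun s hs => ?_
  have h : Measurable (Function.uncurry fun b x : ℝ => gammaPDF a b x) := by
    unfold gammaPDF gammaPDFReal Function.uncurry
    refine (Measurable.ite (measurableSet_le measurable_const measurable_snd) ?_
      measurable_const).ennreal_ofReal
    fun_prop
  simp only [gammaMeasure, withDensity_apply _ hs]
  exact h.lintegral_prod_right'

/-- Step 1: given `η`, draw `λ_θ` from `Gamma(p/2 + a₁, b₁ + ∑ᵢ ηᵢ²/2)`. -/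
noncomputable def drawTheta (p : ℕ) (a₁ b₁ : ℝ) : Kernel (State p) ℝ where
  toFun η := gammaMeasure ((p : ℝ) / 2 + a₁) (b₁ + effectSq η / 2)
  measurable' := (measurable_gammaMeasure _).comp ((measurable_effectSq.div_const 2).const_add b₁)

/-- Step 2: given `η`, draw `λ_e` from
`Gamma(rp/2 + a₂, b₂ + ∑ᵢ ∑ⱼ (y_ij - η₀/√p - η_i)²/2)`. -/
noncomputable def drawError (a₂ b₂ : ℝ) : Kernel (State p) ℝ where
  toFun η := gammaMeasure ((r : ℝ) * p / 2 + a₂) (b₂ + residualSq y η / 2)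
  measurable' :=
    (measurable_gammaMeasure _).comp (((measurable_residualSq y).div_const 2).const_add b₂)

/-- Step 3: given `(λ_θ, λ_e)`, draw the new `η₀` from
`N(√p ȳ, (λ_θ + r λ_e) / (r λ_e λ_θ))`. -/
noncomputable def drawIntercept : Kernel (ℝ × ℝ) ℝ where
  toFun l := gaussianReal (√(p : ℝ) * grandMean y)
    ((l.1 + r * l.2) / (r * l.2 * l.1)).toNNReal
  measurable' := by
    have h : Measurable fun l : ℝ × ℝ => ((√(p : ℝ) * grandMean y,
        ((l.1 + r * l.2) / (r * l.2 * l.1)).toNNReal) : ℝ × ℝ≥0) := by fun_prop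
    exact measurable_gaussianReal.comp h

/-- Step 4: given `(λ_θ, λ_e)` and the new `η₀`, draw the new `η₁, …, η_p` independently, `η_i` from
`N(r λ_e (ȳ_i - η₀/√p) / (λ_θ + r λ_e), 1 / (λ_θ + r λ_e))`. -/
noncomputable def drawEffects : Kernel ((ℝ × ℝ) × ℝ) (Fin p → ℝ) where
  toFun q := Measure.pi fun i =>
    gaussianReal (r * q.1.2 * (groupMean y i - q.2 / √(p : ℝ)) / (q.1.1 + r * q.1.2))
      (1 / (q.1.1 + r * q.1.2)).toNNReal
  measurable' := by
    refine Measurable.measure_of_isPiSystem_of_isProbabilityMeasure generateFrom_pi.symm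
      isPiSystem_pi ?_
    rintro _ ⟨s, hs, rfl⟩
    simp only [Measure.pi_pi]
    refine Finset.measurable_prod _ fun i _ => ?_
    have h : Measurable fun q : (ℝ × ℝ) × ℝ =>
        ((r * q.1.2 * (groupMean y i - q.2 / √(p : ℝ)) / (q.1.1 + r * q.1.2),
          (1 / (q.1.1 + r * q.1.2)).toNNReal) : ℝ × ℝ≥0) := by fun_prop
    have hsi : MeasurableSet (s i) := hs i (Set.mem_univ i)
    exact (Measure.measurable_coe hsi).comp (measurable_gaussianReal.comp h)

/-- The vector `(η₀, η₁, …, η_p)` with the given first entry and the given other entries. -/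
noncomputable def assemble (q : ℝ × (Fin p → ℝ)) : State p :=
  WithLp.toLp 2 (Fin.cons q.1 q.2 : Fin (p + 1) → ℝ)

lemma measurable_assemble : Measurable (assemble (p := p)) := by
  refine (WithLp.measurable_toLp 2 (Fin (p + 1) → ℝ)).comp (measurable_pi_lambda _ fun i => ?_)
  refine Fin.cases ?_ (fun j => ?_) i
  · simpa using measurable_fst
  · have h : Measurable fun q : ℝ × (Fin p → ℝ) => q.2 j := by fun_prop
    simpa using h

/-- The transition kernel `K` of the `η`-marginal Gibbs chain: `λ_θ` and `λ_e` are drawn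
independently given `η`, and the new state is then drawn given `(λ_θ, λ_e)`. -/
noncomputable def gibbsKernel (a₁ b₁ a₂ b₂ : ℝ) : Kernel (State p) (State p) :=
  ((drawIntercept y ⊗ₖ drawEffects y).map assemble) ∘ₖ
    (drawTheta p a₁ b₁ ×ₖ drawError y a₂ b₂)

instance : IsMarkovKernel (drawIntercept y) :=
  ⟨fun l => by
    change IsProbabilityMeasure (gaussianReal _ _)
    infer_instance⟩

instance : IsMarkovKernel (drawEffects y) :=
  ⟨fun q => by
    change IsProbabilityMeasure (Measure.pi _)
    infer_instance⟩

/-- The kernel of the chain is a Markov kernel (in particular none of the operations in its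
definition is applied outside its proper domain). -/
lemma isMarkovKernel_gibbsKernel {a₁ b₁ a₂ b₂ : ℝ} (ha₁ : 0 < a₁) (hb₁ : 0 < b₁) (ha₂ : 0 < a₂)
    (hb₂ : 0 < b₂) : IsMarkovKernel (gibbsKernel y a₁ b₁ a₂ b₂) := by
  have h₁ : IsMarkovKernel (drawTheta p a₁ b₁) := ⟨fun η =>
    isProbabilityMeasure_gammaMeasure (by positivity)
      (by have := effectSq_nonneg η; positivity)⟩
  have h₂ : IsMarkovKernel (drawError y a₂ b₂) := ⟨fun η =>
    isProbabilityMeasure_gammaMeasure (by positivity)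
      (by have := residualSq_nonneg y η; positivity)⟩
  have h₃ := Kernel.IsMarkovKernel.map (drawIntercept y ⊗ₖ drawEffects y)
    (measurable_assemble (p := p))
  unfold gibbsKernel
  infer_instance

end Data

end RandomEffects

/-! The chain is coupled with itself by feeding the same noise to two states: two gamma variables
`j₁`, `j₂` with rate 1, a standard normal `n₀` for the intercept and standard normals `n` for the
effects. Put `s = λ_θ^(-1/2)` and `t = (r λ_e)^(-1/2)`. In these scales (`randomMap_eq`) the new
intercept has standard deviation `√(s² + t²)`, the effects shrink by the factor `s²/(s² + t²)`, and
their own noise is multiplied by `st/√(s² + t²)`. Both scales are Lipschitz functions of the state,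
so the distance after one step is governed by elementary inequalities on homogeneous functions of
`(s, t)`.

Let `V` be the squared distance to the centre of the data (`energy`), `z = 1 + (V(η) + V(η'))/p` and
`κ = 1/p + p/r + p³/r²` (`smallness`). Three second moment bounds hold with one constant `C`
independent of `p`. Globally, the mean of the new squared distance is at most `C p dist²`
(`dist_moment_global`). Since `t` is small relative to `s` when `V` is moderate, it is also at most
`C z² κ dist²` (`dist_moment_local`), which is a contraction unless `z` is large. Finally the root
mean square of the new `z` is at most `3 √C (1 + z/p)` (`pairWeight_moment`), because the energy
loses a factor of order `p` in each step, up to an additive term of order `p`.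

No single bound contracts the distance everywhere, but the cost `min (dist * z) (p * z)` contracts
(`cost_contraction`). By Cauchy–Schwarz, the local bound serves pairs with `z ≤ p`, the global one
pairs with `z ≥ p`, and the energy bound alone serves pairs at distance at least `p`. The factor is
a constant times `√κ + 1/√p`, which tends to `0` because (E1) forces `p³/r² → 0`, hence `p/r → 0`.
The cost dominates the distance, so running the coupling with one copy started from the posterior
(`wassersteinDist_pow_le`) gives the Wasserstein bound; the initial cost is integrable because the
drift of `V` bounds its posterior mean.

This needs the posterior to be a proper invariant distribution. Invariance follows from factoring
the joint density of `(η, λ_θ, λ_e)` in two ways; properness follows by integrating out `η` and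
dominating what remains by products of gamma densities. For total variation, the kernel is Lipschitz
from the Euclidean distance to total variation, because gamma laws of equal shape minorize each
other, so one extra step turns the Wasserstein rate into a total variation rate. -/

/-! ### Couplings by random maps, Wasserstein and total variation bounds, drift -/

section MarkovChain

variable {X Ω : Type*} [MeasurableSpace X] [MeasurableSpace Ω]

/-- The kernel moving a pair of points by the same random map. -/
noncomputable def coupledKernel (P : Measure Ω) [SFinite P] {F : X → Ω → X}
    (hF : Measurable (Function.uncurry F)) : Kernel (X × X) (X × X) where
  toFun z := P.map fun ω => (F z.1 ω, F z.2 ω)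
  measurable' := by
    have h : Measurable fun q : (X × X) × Ω => (F q.1.1 q.2, F q.1.2 q.2) :=
      (hF.comp (by fun_prop : Measurable fun q : (X × X) × Ω => (q.1.1, q.2))).prodMk
        (hF.comp (by fun_prop : Measurable fun q : (X × X) × Ω => (q.1.2, q.2)))
    refine Measure.measurable_of_measurable_coe _ fun s hs => ?_
    have e : ∀ z : X × X, (P.map fun ω => (F z.1 ω, F z.2 ω)) s
        = P (Prod.mk z ⁻¹' ((fun q : (X × X) × Ω => (F q.1.1 q.2, F q.1.2 q.2)) ⁻¹' s)) := by
      intro z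
      exact Measure.map_apply (h.comp measurable_prodMk_left) hs
    simp only [e]
    exact measurable_measure_prodMk_left (h hs)

lemma lintegral_coupledKernel (P : Measure Ω) [SFinite P] {F : X → Ω → X}
    (hF : Measurable (Function.uncurry F)) {g : X × X → ℝ≥0∞} (hg : Measurable g) (z : X × X) :
    ∫⁻ w, g w ∂coupledKernel P hF z = ∫⁻ ω, g (F z.1 ω, F z.2 ω) ∂P := by
  have h : ∀ x, Measurable (F x) := fun x => hF.comp measurable_prodMk_left
  exact lintegral_map hg ((h z.1).prodMk (h z.2))

instance (P : Measure Ω) [IsProbabilityMeasure P] {F : X → Ω → X}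
    (hF : Measurable (Function.uncurry F)) : IsMarkovKernel (coupledKernel P hF) :=
  ⟨fun z => by
    have h : ∀ x, Measurable (F x) := fun x => hF.comp measurable_prodMk_left
    exact Measure.isProbabilityMeasure_map ((h z.1).prodMk (h z.2)).aemeasurable⟩

lemma lintegral_kernel_pow_succ (K : Kernel X X) (m : ℕ) (x : X) {g : X → ℝ≥0∞}
    (hg : Measurable g) :
    ∫⁻ w, g w ∂(K ^ (m + 1)) x = ∫⁻ w, ∫⁻ v, g v ∂(K ^ m) w ∂K x := by
  rw [pow_succ]
  exact Kernel.lintegral_comp (K ^ m) K x hg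

lemma lintegral_kernel_pow_succ' (K : Kernel X X) (m : ℕ) (x : X) {g : X → ℝ≥0∞}
    (hg : Measurable g) :
    ∫⁻ w, g w ∂(K ^ (m + 1)) x = ∫⁻ w, ∫⁻ v, g v ∂K w ∂(K ^ m) x := by
  rw [pow_succ']
  exact Kernel.lintegral_comp K (K ^ m) x hg

lemma lintegral_kernel_pow_zero (K : Kernel X X) (x : X) {g : X → ℝ≥0∞}
    (hg : Measurable g) : ∫⁻ w, g w ∂(K ^ 0) x = g x := by
  have h : K ^ 0 = Kernel.id := pow_zero K
  rw [h, Kernel.id_apply, lintegral_dirac' x hg]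

lemma isMarkovKernel_pow (K : Kernel X X) [IsMarkovKernel K] (m : ℕ) :
    IsMarkovKernel (K ^ m) := by
  induction m with
  | zero => rw [pow_zero]; exact inferInstanceAs (IsMarkovKernel (Kernel.id : Kernel X X))
  | succ m ih => rw [pow_succ]; exact inferInstanceAs (IsMarkovKernel ((K ^ m) ∘ₖ K))

/-- Each coordinate of the coupled chain evolves autonomously, and its one-step law is that of `F
x`, namely `K x`. This and its companion for the second coordinate identify the marginals of the
coupling. -/
lemma lintegral_coupledKernel_pow_fst (P : Measure Ω) [SFinite P] {F : X → Ω → X}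
    (hF : Measurable (Function.uncurry F)) {K : Kernel X X} (hK : ∀ x, K x = P.map (F x))
    (m : ℕ) {g : X → ℝ≥0∞} (hg : Measurable g) (z : X × X) :
    ∫⁻ w, g w.1 ∂(coupledKernel P hF ^ m) z = ∫⁻ w, g w ∂(K ^ m) z.1 := by
  induction m generalizing z with
  | zero =>
    rw [lintegral_kernel_pow_zero _ _ hg,
      lintegral_kernel_pow_zero _ _ (g := fun w : X × X => g w.1) (by fun_prop)]
  | succ m ih =>
    rw [lintegral_kernel_pow_succ _ _ _ hg,
      lintegral_kernel_pow_succ _ _ _ (g := fun w : X × X => g w.1) (by fun_prop)]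
    simp only [ih]
    have h : Measurable fun x => ∫⁻ v, g v ∂(K ^ m) x := hg.lintegral_kernel
    rw [lintegral_coupledKernel P hF (g := fun w : X × X => ∫⁻ v, g v ∂(K ^ m) w.1)
      (h.comp measurable_fst), hK]
    exact (lintegral_map h (hF.comp measurable_prodMk_left)).symm

lemma lintegral_coupledKernel_pow_snd (P : Measure Ω) [SFinite P] {F : X → Ω → X}
    (hF : Measurable (Function.uncurry F)) {K : Kernel X X} (hK : ∀ x, K x = P.map (F x))
    (m : ℕ) {g : X → ℝ≥0∞} (hg : Measurable g) (z : X × X) :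
    ∫⁻ w, g w.2 ∂(coupledKernel P hF ^ m) z = ∫⁻ w, g w ∂(K ^ m) z.2 := by
  induction m generalizing z with
  | zero =>
    rw [lintegral_kernel_pow_zero _ _ hg,
      lintegral_kernel_pow_zero _ _ (g := fun w : X × X => g w.2) (by fun_prop)]
  | succ m ih =>
    rw [lintegral_kernel_pow_succ _ _ _ hg,
      lintegral_kernel_pow_succ _ _ _ (g := fun w : X × X => g w.2) (by fun_prop)]
    simp only [ih]
    have h : Measurable fun x => ∫⁻ v, g v ∂(K ^ m) x := hg.lintegral_kernel
    rw [lintegral_coupledKernel P hF (g := fun w : X × X => ∫⁻ v, g v ∂(K ^ m) w.2)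
      (h.comp measurable_snd), hK]
    exact (lintegral_map h (hF.comp measurable_prodMk_left)).symm

lemma lintegral_coupledKernel_pow_le (P : Measure Ω) [SFinite P] {F : X → Ω → X}
    (hF : Measurable (Function.uncurry F)) {d : X × X → ℝ≥0∞} (hd : Measurable d) {ρ : ℝ≥0∞}
    (hρ : ∀ x x', ∫⁻ ω, d (F x ω, F x' ω) ∂P ≤ ρ * d (x, x')) (m : ℕ) (z : X × X) :
    ∫⁻ w, d w ∂(coupledKernel P hF ^ m) z ≤ ρ ^ m * d z := by
  induction m generalizing z with
  | zero => rw [lintegral_kernel_pow_zero _ _ hd, pow_zero, one_mul]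
  | succ m ih =>
    rw [lintegral_kernel_pow_succ _ _ _ hd]
    calc ∫⁻ w, ∫⁻ v, d v ∂(coupledKernel P hF ^ m) w ∂coupledKernel P hF z
        ≤ ∫⁻ w, ρ ^ m * d w ∂coupledKernel P hF z := lintegral_mono ih
      _ = ρ ^ m * ∫⁻ w, d w ∂coupledKernel P hF z := lintegral_const_mul _ hd
      _ ≤ ρ ^ m * (ρ * d z) := by
          gcongr
          rw [lintegral_coupledKernel P hF hd]
          exact hρ z.1 z.2
      _ = ρ ^ (m + 1) * d z := by rw [pow_succ, mul_assoc]

lemma invariant_pow {K : Kernel X X} {Q : Measure X} (hQ : K.Invariant Q) (m : ℕ) :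
    (K ^ m).Invariant Q := by
  induction m with
  | zero =>
    rw [pow_zero]
    change Q.bind Kernel.id = Q
    exact Measure.id_comp
  | succ m ih => rw [pow_succ]; exact Kernel.Invariant.comp ih hQ

/-- A random-map coupling which contracts a cost function dominating the distance bounds the
Wasserstein distance to the invariant distribution. -/
theorem wassersteinDist_pow_le {X : Type*} [PseudoEMetricSpace X] [MeasurableSpace X]
    (P : Measure Ω) [IsProbabilityMeasure P] {F : X → Ω → X}
    (hF : Measurable (Function.uncurry F)) {K : Kernel X X} (hK : ∀ x, K x = P.map (F x))
    {Q : Measure X} [IsProbabilityMeasure Q] (hQ : K.Invariant Q)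
    {d : X × X → ℝ≥0∞} (hd : Measurable d) (hdist : ∀ x x', edist x x' ≤ d (x, x')) {ρ : ℝ≥0∞}
    (hρ : ∀ x x', ∫⁻ ω, d (F x ω, F x' ω) ∂P ≤ ρ * d (x, x')) (x : X) (m : ℕ) :
    wassersteinDist ((K ^ m) x) Q ≤ ρ ^ m * ∫⁻ x', d (x, x') ∂Q := by
  have hmk : Measurable fun x' : X => (x, x') := measurable_prodMk_left
  have := isMarkovKernel_pow (coupledKernel P hF) m
  have hp : IsProbabilityMeasure (Q.map fun x' => (x, x')) :=
    Measure.isProbabilityMeasure_map hmk.aemeasurable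
  -- Start one copy at `x` and the other from `Q`, and run the coupled chain `m` steps. The second
  -- copy still has law `Q` by invariance.
  set υ : Measure (X × X) := (Q.map fun x' => (x, x')).bind ⇑(coupledKernel P hF ^ m) with hυ
  have hint : ∀ g : X × X → ℝ≥0∞, Measurable g →
      ∫⁻ z, g z ∂υ = ∫⁻ x', ∫⁻ w, g w ∂(coupledKernel P hF ^ m) (x, x') ∂Q := by
    intro g hg
    rw [hυ, Measure.lintegral_bind (Kernel.aemeasurable _) hg.aemeasurable,
      lintegral_map hg.lintegral_kernel hmk]
  have hprob : IsProbabilityMeasure υ := by rw [hυ]; infer_instance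
  have h1 : υ.map Prod.fst = (K ^ m) x := by
    refine Measure.ext_of_lintegral _ fun g hg => ?_
    rw [lintegral_map hg measurable_fst, hint (fun z => g z.1) (hg.comp measurable_fst)]
    simp only [lintegral_coupledKernel_pow_fst P hF hK m hg, lintegral_const, measure_univ,
      mul_one]
  have h2 : υ.map Prod.snd = Q := by
    refine Measure.ext_of_lintegral _ fun g hg => ?_
    rw [lintegral_map hg measurable_snd, hint (fun z => g z.2) (hg.comp measurable_snd)]
    simp only [lintegral_coupledKernel_pow_snd P hF hK m hg]
    conv_rhs => rw [← (invariant_pow hQ m).def]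
    rw [Measure.lintegral_bind (Kernel.aemeasurable _) hg.aemeasurable]
  calc wassersteinDist ((K ^ m) x) Q ≤ ∫⁻ z, edist z.1 z.2 ∂υ :=
        iInf₂_le υ ⟨hprob, h1, h2⟩
    _ ≤ ∫⁻ z, d z ∂υ := lintegral_mono fun z => hdist z.1 z.2
    _ = ∫⁻ x', ∫⁻ w, d w ∂(coupledKernel P hF ^ m) (x, x') ∂Q := hint d hd
    _ ≤ ∫⁻ x', ρ ^ m * d (x, x') ∂Q :=
        lintegral_mono fun x' => lintegral_coupledKernel_pow_le P hF hd hρ m (x, x')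
    _ = ρ ^ m * ∫⁻ x', d (x, x') ∂Q := lintegral_const_mul _ (hd.comp hmk)

/-- A Markov kernel which is Lipschitz from a metric to total variation turns Wasserstein bounds
into total variation bounds. -/
theorem totalVariationDist_bind_le {X : Type*} [PseudoEMetricSpace X] [MeasurableSpace X]
    {K : Kernel X X} [IsMarkovKernel K] {c : ℝ≥0} (hc : c ≠ 0)
    (hLip : ∀ (x x' : X) (A : Set X), MeasurableSet A →
      ENNReal.ofReal |(K x).real A - (K x').real A| ≤ c * edist x x') (μ ν : Measure X) :
    totalVariationDist (μ.bind K) (ν.bind K) ≤ c * wassersteinDist μ ν := by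
  refine iSup₂_le fun A hA => ?_
  have hc' : (c : ℝ≥0∞) ≠ 0 := by exact_mod_cast hc
  rw [wassersteinDist]
  -- This is where `c ≠ 0` matters: an infimum over an empty family is `∞`, and `0 * ∞ = 0`.
  simp_rw [ENNReal.mul_iInf_of_ne hc' ENNReal.coe_ne_top]
  refine le_iInf₂ fun υ h => ?_
  obtain ⟨hυ, rfl, rfl⟩ := h
  have hm : Measurable fun x => (K x).real A := (K.measurable_coe hA).ennreal_toReal
  have hreal : ∀ f : X × X → X, Measurable f →
      ((υ.map f).bind K).real A = ∫ z, (K (f z)).real A ∂υ := by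
    intro f hf
    rw [measureReal_def, Measure.bind_apply hA (Kernel.aemeasurable _),
      lintegral_map (K.measurable_coe hA) hf, ← integral_toReal]
    · rfl
    · exact ((K.measurable_coe hA).comp hf).aemeasurable
    · exact ae_of_all _ fun z => measure_lt_top _ _
  have hint : ∀ f : X × X → X, Measurable f → Integrable (fun z => (K (f z)).real A) υ := by
    intro f hf
    refine Integrable.of_bound (hm.comp hf).aestronglyMeasurable 1 (ae_of_all _ fun z => ?_)
    rw [Real.norm_of_nonneg measureReal_nonneg]
    exact measureReal_le_one
  rw [hreal _ measurable_fst, hreal _ measurable_snd,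
    ← integral_sub (hint _ measurable_fst) (hint _ measurable_snd),
    ← Real.norm_eq_abs]
  calc ENNReal.ofReal ‖∫ z, ((K z.1).real A - (K z.2).real A) ∂υ‖
      ≤ ∫⁻ z, ENNReal.ofReal |(K z.1).real A - (K z.2).real A| ∂υ := by
        rw [ofReal_norm]
        refine (enorm_integral_le_lintegral_enorm _).trans_eq (lintegral_congr fun z => ?_)
        rw [← ofReal_norm, Real.norm_eq_abs]
    _ ≤ ∫⁻ z, c * edist z.1 z.2 ∂υ := lintegral_mono fun z => hLip z.1 z.2 A hA
    _ = c * ∫⁻ z, edist z.1 z.2 ∂υ := lintegral_const_mul' _ _ ENNReal.coe_ne_top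

lemma convergenceRate_nonneg (D : Measure X → Measure X → ℝ≥0∞) (K : Kernel X X)
    (Q : Measure X) : 0 ≤ convergenceRate D K Q :=
  Real.sInf_nonneg fun _ h => h.1

lemma convergenceRate_le {D : Measure X → Measure X → ℝ≥0∞} {K : Kernel X X} {Q : Measure X}
    {ρ : ℝ} (h0 : 0 ≤ ρ) (h1 : ρ ≤ 1) (M : X → ℝ≥0)
    (hM : ∀ (x : X) (m : ℕ), D ((K ^ m) x) Q ≤ M x * ENNReal.ofReal ρ ^ m) :
    convergenceRate D K Q ≤ ρ :=
  csInf_le ⟨0, fun _ h => h.1⟩ ⟨h0, h1, Or.inr ⟨M, hM⟩⟩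

lemma totalVariationDist_le_one (μ ν : Measure X) [IsProbabilityMeasure μ]
    [IsProbabilityMeasure ν] : totalVariationDist μ ν ≤ 1 := by
  refine iSup₂_le fun A _ => ?_
  rw [← ENNReal.ofReal_one]
  refine ENNReal.ofReal_le_ofReal (abs_le.2 ⟨?_, ?_⟩)
  · linarith [measureReal_nonneg (μ := μ) (s := A), measureReal_le_one (μ := ν) (s := A)]
  · linarith [measureReal_nonneg (μ := ν) (s := A), measureReal_le_one (μ := μ) (s := A)]

/-- A geometric drift condition bounds the integral under any invariant distribution. -/
theorem lintegral_invariant_le_of_drift {K : Kernel X X} [IsMarkovKernel K] {Q : Measure X}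
    [IsProbabilityMeasure Q] (hQ : K.Invariant Q) {V : X → ℝ≥0∞} (hV : Measurable V)
    (hfin : ∀ x, V x ≠ ∞) {l L L' : ℝ≥0∞} (hl : l < 1) (hL : l * L' + L ≤ L')
    (hdrift : ∀ x, ∫⁻ w, V w ∂K x ≤ l * V x + L) : ∫⁻ x, V x ∂Q ≤ L' := by
  have hiter : ∀ m x, ∫⁻ w, V w ∂(K ^ m) x ≤ l ^ m * V x + L' := by
    intro m
    induction m with
    | zero => intro x; rw [lintegral_kernel_pow_zero _ _ hV]; simp
    | succ m ih =>
      intro x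
      have := isMarkovKernel_pow K m
      rw [lintegral_kernel_pow_succ' _ _ _ hV]
      calc ∫⁻ w, ∫⁻ v, V v ∂K w ∂(K ^ m) x ≤ ∫⁻ w, l * V w + L ∂(K ^ m) x :=
            lintegral_mono hdrift
        _ = l * ∫⁻ w, V w ∂(K ^ m) x + L := by
            rw [lintegral_add_right _ measurable_const, lintegral_const_mul _ hV]
            simp
        _ ≤ l * (l ^ m * V x + L') + L := by gcongr; exact ih x
        _ = l ^ (m + 1) * V x + (l * L' + L) := by ring
        _ ≤ l ^ (m + 1) * V x + L' := by gcongr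
  -- `V` is not known to be integrable under `Q`, so the drift inequality cannot be integrated
  -- directly. The truncation at `n` is bounded: invariance replaces `Q` by `Q K^m`, and dominated
  -- convergence as `m → ∞` removes the dependence on the starting point.
  have htrunc : ∀ n : ℕ, ∫⁻ x, min (V x) n ∂Q ≤ L' := by
    intro n
    have hVn : Measurable fun x => min (V x) (n : ℝ≥0∞) := hV.min measurable_const
    have hle : ∀ m : ℕ, ∫⁻ x, min (V x) n ∂Q ≤ ∫⁻ x, min (l ^ m * V x + L') n ∂Q := by
      intro m
      have := isMarkovKernel_pow K m
      conv_lhs => rw [← (invariant_pow hQ m).def]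
      rw [Measure.lintegral_bind (Kernel.aemeasurable _) hVn.aemeasurable]
      refine lintegral_mono fun x => le_min ?_ ?_
      · exact (lintegral_mono fun w => min_le_left _ _).trans (hiter m x)
      · refine (lintegral_mono fun w => min_le_right _ _).trans ?_
        simp
    have hlim : Tendsto (fun m : ℕ => ∫⁻ x, min (l ^ m * V x + L') n ∂Q) atTop
        (𝓝 (∫⁻ _, min L' n ∂Q)) := by
      refine tendsto_lintegral_of_dominated_convergence (fun _ => (n : ℝ≥0∞))
        (fun m => by fun_prop) (fun m => ae_of_all _ fun x => min_le_right _ _) (by simp)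
        (ae_of_all _ fun x => ?_)
      have h0 : Tendsto (fun m : ℕ => l ^ m * V x) atTop (𝓝 0) := by
        have := ENNReal.Tendsto.mul_const (b := V x)
          (ENNReal.tendsto_pow_atTop_nhds_zero_of_lt_one hl) (Or.inr (hfin x))
        simpa using this
      have h1 : Tendsto (fun m : ℕ => l ^ m * V x + L') atTop (𝓝 L') := by
        simpa using h0.add_const L'
      exact h1.min tendsto_const_nhds
    refine (ge_of_tendsto' hlim hle).trans ?_
    simp
  have hsup : ∀ x, V x = ⨆ n : ℕ, min (V x) n := by
    intro x
    refine le_antisymm ?_ (iSup_le fun n => min_le_left _ _)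
    obtain ⟨n, hn⟩ := ENNReal.exists_nat_gt (hfin x)
    exact le_iSup_of_le n (le_min le_rfl hn.le)
  rw [lintegral_congr hsup, lintegral_iSup (fun n => hV.min measurable_const)]
  · exact iSup_le htrunc
  · intro n k hnk x
    exact min_le_min le_rfl (by exact_mod_cast hnk)

end MarkovChain

/-! ### Lipschitz estimates for homogeneous functions of the two scales -/

section ScaleInequalities

/-- Reverse triangle inequality for the Euclidean norm of the plane, the norm of the difference
being bounded by its `ℓ¹` norm. -/
lemma abs_sqrt_add_sq_sub_le (s t s' t' : ℝ) :
    |√(s ^ 2 + t ^ 2) - √(s' ^ 2 + t' ^ 2)| ≤ |s - s'| + |t - t'| := by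
  have key : ∀ a b c d : ℝ, √(a ^ 2 + b ^ 2) ≤ √(c ^ 2 + d ^ 2) + (|a - c| + |b - d|) := by
    intro a b c d
    have hc : |c| ≤ √(c ^ 2 + d ^ 2) := Real.abs_le_sqrt (by nlinarith [sq_nonneg d])
    have hd : |d| ≤ √(c ^ 2 + d ^ 2) := Real.abs_le_sqrt (by nlinarith [sq_nonneg c])
    have hsq := Real.sq_sqrt (by positivity : 0 ≤ c ^ 2 + d ^ 2)
    refine Real.sqrt_le_iff.2 ⟨by positivity, ?_⟩
    have e1 : (a - c) * c ≤ |a - c| * √(c ^ 2 + d ^ 2) :=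
      (le_abs_self _).trans (by rw [abs_mul]; gcongr)
    have e2 : (b - d) * d ≤ |b - d| * √(c ^ 2 + d ^ 2) :=
      (le_abs_self _).trans (by rw [abs_mul]; gcongr)
    have e3 := sq_abs (a - c)
    have e4 := sq_abs (b - d)
    have e5 : 0 ≤ |a - c| * |b - d| := by positivity
    nlinarith
  rw [abs_sub_le_iff]
  constructor
  · linarith [key s t s' t']
  · have := key s' t' s t
    rw [abs_sub_comm s' s, abs_sub_comm t' t] at this
    linarith

variable {s t s' t' : ℝ}

/-- `s/√(s² + t²)` is homogeneous of degree zero, so its Lipschitz constant is inverse to the scale.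
The identity `(s/h - s'/h') h = (s - s') + (s'/h')(h' - h)` shows that the size of one of the two
points suffices. -/
lemma abs_div_sqrt_sub_le (hs : 0 < s) (ht : 0 < t) (hs' : 0 < s') (ht' : 0 < t') :
    |s / √(s ^ 2 + t ^ 2) - s' / √(s' ^ 2 + t' ^ 2)| * √(s ^ 2 + t ^ 2)
      ≤ 2 * |s - s'| + |t - t'| := by
  have hle : s' ≤ √(s' ^ 2 + t' ^ 2) := Real.le_sqrt_of_sq_le (by nlinarith)
  have h0 : 0 < √(s ^ 2 + t ^ 2) := by positivity
  have h0' : 0 < √(s' ^ 2 + t' ^ 2) := by positivity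
  have hd := abs_sqrt_add_sq_sub_le s t s' t'
  set h := √(s ^ 2 + t ^ 2)
  set h' := √(s' ^ 2 + t' ^ 2)
  have e : (s / h - s' / h') * h = (s - s') + (s' / h') * (h' - h) := by field_simp; ring
  have h1 : s' / h' ≤ 1 := (div_le_one h0').2 hle
  rw [← abs_of_pos h0, ← abs_mul, abs_of_pos h0, e]
  calc |(s - s') + (s' / h') * (h' - h)| ≤ |s - s'| + (s' / h') * |h' - h| := by
        refine (abs_add_le _ _).trans ?_
        rw [abs_mul, abs_of_pos (by positivity : 0 < s' / h')]
    _ ≤ |s - s'| + 1 * |h' - h| := by gcongr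
    _ ≤ _ := by rw [abs_sub_comm h' h]; linarith

lemma sq_sqrt_add_sq_sub_le (s t s' t' : ℝ) :
    (√(s ^ 2 + t ^ 2) - √(s' ^ 2 + t' ^ 2)) ^ 2 ≤ 2 * ((s - s') ^ 2 + (t - t') ^ 2) := by
  rw [← sq_abs, ← sq_abs (s - s'), ← sq_abs (t - t')]
  have h := abs_sqrt_add_sq_sub_le s t s' t'
  have h0 := abs_nonneg (√(s ^ 2 + t ^ 2) - √(s' ^ 2 + t' ^ 2))
  nlinarith [sq_nonneg (|s - s'| - |t - t'|)]

/-- Homogeneity of degree one makes the Lipschitz bound uniform in the scale: the growing factor `s`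
is absorbed by the degree-zero estimate for `s/√(s² + t²)`. -/
lemma sq_weighted_sub_le (hs : 0 < s) (ht : 0 < t) (hs' : 0 < s') (ht' : 0 < t') :
    (s ^ 2 / √(s ^ 2 + t ^ 2) - s' ^ 2 / √(s' ^ 2 + t' ^ 2)) ^ 2
      ≤ 18 * ((s - s') ^ 2 + (t - t') ^ 2) := by
  have hle : s ≤ √(s ^ 2 + t ^ 2) := Real.le_sqrt_of_sq_le (by nlinarith)
  have hle' : s' ≤ √(s' ^ 2 + t' ^ 2) := Real.le_sqrt_of_sq_le (by nlinarith)
  have h0 : 0 < √(s ^ 2 + t ^ 2) := by positivity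
  have h0' : 0 < √(s' ^ 2 + t' ^ 2) := by positivity
  have hd := abs_div_sqrt_sub_le hs ht hs' ht'
  set h := √(s ^ 2 + t ^ 2)
  set h' := √(s' ^ 2 + t' ^ 2)
  have e : s ^ 2 / h - s' ^ 2 / h' = s * (s / h - s' / h') + (s - s') * (s' / h') := by
    field_simp; ring
  have h1 : s' / h' ≤ 1 := (div_le_one h0').2 hle'
  have h2 : |s ^ 2 / h - s' ^ 2 / h'| ≤ 3 * |s - s'| + |t - t'| := by
    rw [e]
    calc |s * (s / h - s' / h') + (s - s') * (s' / h')|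
        ≤ s * |s / h - s' / h'| + |s - s'| * (s' / h') := by
          refine (abs_add_le _ _).trans ?_
          rw [abs_mul, abs_mul, abs_of_pos hs, abs_of_pos (by positivity : 0 < s' / h')]
      _ ≤ h * |s / h - s' / h'| + |s - s'| * 1 := by gcongr
      _ ≤ _ := by linarith
  have h3 := abs_nonneg (s ^ 2 / h - s' ^ 2 / h')
  rw [← sq_abs, ← sq_abs (s - s'), ← sq_abs (t - t')]
  nlinarith [sq_nonneg (|s - s'| - 3 * |t - t'|), abs_nonneg (s - s'), abs_nonneg (t - t'),
    sq_nonneg (|t - t'|)]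

/-- The factor `t/√(s² + t²)` is the point: when `t` is much smaller than `s`, the function is
nearly `t` and hardly sees a change of `s`. -/
lemma abs_mul_div_sqrt_sub_le (hs : 0 < s) (ht : 0 < t) (hs' : 0 < s') :
    |s * t / √(s ^ 2 + t ^ 2) - s' * t / √(s' ^ 2 + t ^ 2)|
      ≤ 2 * |s - s'| * (t / √(s ^ 2 + t ^ 2)) := by
  have h0 : 0 < √(s ^ 2 + t ^ 2) := by positivity
  have hd := abs_div_sqrt_sub_le hs ht hs' ht
  rw [sub_self, abs_zero, add_zero] at hd
  set h := √(s ^ 2 + t ^ 2)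
  set h' := √(s' ^ 2 + t ^ 2)
  have e : s * t / h - s' * t / h' = t * (s / h - s' / h') := by ring
  rw [e, abs_mul, abs_of_pos ht]
  have h2 := (le_div_iff₀ h0).2 hd
  calc t * |s / h - s' / h'| ≤ t * (2 * |s - s'| / h) := by gcongr
    _ = _ := by ring

/-- Change `s` first and `t` afterwards; only the change of `s` carries the gain `k`. The choice `k
= 1` serves the global bound, and `k = t/m` with `m ≤ s` the local one. -/
lemma sq_geometric_sub_le (hs : 0 < s) (ht : 0 < t) (hs' : 0 < s') (ht' : 0 < t') {k : ℝ}
    (hk : t / √(s ^ 2 + t ^ 2) ≤ k) :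
    (s * t / √(s ^ 2 + t ^ 2) - s' * t' / √(s' ^ 2 + t' ^ 2)) ^ 2
      ≤ 8 * (k ^ 2 * (s - s') ^ 2 + (t - t') ^ 2) := by
  have h1 := abs_mul_div_sqrt_sub_le hs ht hs'
  have h2 := abs_mul_div_sqrt_sub_le (s := t) (t := s') (s' := t') ht hs' ht'
  have h3 : s' / √(t ^ 2 + s' ^ 2) ≤ 1 :=
    (div_le_one (by positivity)).2 (Real.le_sqrt_of_sq_le (by nlinarith))
  have h4 : |s * t / √(s ^ 2 + t ^ 2) - s' * t / √(s' ^ 2 + t ^ 2)| ≤ 2 * (k * |s - s'|) := by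
    refine h1.trans ?_
    rw [mul_assoc, mul_comm |s - s'|]
    gcongr
  have h5 : |s' * t / √(s' ^ 2 + t ^ 2) - s' * t' / √(s' ^ 2 + t' ^ 2)| ≤ 2 * |t - t'| := by
    have : 2 * |t - t'| * (s' / √(t ^ 2 + s' ^ 2)) ≤ 2 * |t - t'| * 1 := by gcongr
    rw [mul_comm s' t, mul_comm s' t', add_comm (s' ^ 2), add_comm (s' ^ 2)]
    linarith
  have h6 := abs_sub_le (s * t / √(s ^ 2 + t ^ 2)) (s' * t / √(s' ^ 2 + t ^ 2))
    (s' * t' / √(s' ^ 2 + t' ^ 2))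
  have h7 := abs_nonneg (s * t / √(s ^ 2 + t ^ 2) - s' * t' / √(s' ^ 2 + t' ^ 2))
  rw [← sq_abs, ← sq_abs (s - s'), ← sq_abs (t - t'), ← mul_pow]
  have h8 : |s * t / √(s ^ 2 + t ^ 2) - s' * t' / √(s' ^ 2 + t' ^ 2)|
      ≤ 2 * (k * |s - s'|) + 2 * |t - t'| := by linarith
  nlinarith [sq_nonneg (k * |s - s'| - |t - t'|)]

/-- The shrinkage factor is the square of `s/√(s² + t²)`. Factor the difference of squares: the sum
is at most `2`, and the difference is of order one over the scale, which is at least `m`. -/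
lemma sq_shrinkage_sub_le {m : ℝ} (hm : 0 < m) (hs : m ≤ s) (ht : 0 < t) (hs' : 0 < s')
    (ht' : 0 < t') :
    (s ^ 2 / (s ^ 2 + t ^ 2) - s' ^ 2 / (s' ^ 2 + t' ^ 2)) ^ 2
      ≤ 32 * ((s - s') ^ 2 + (t - t') ^ 2) / m ^ 2 := by
  have hs0 : 0 < s := hm.trans_le hs
  have hle : s ≤ √(s ^ 2 + t ^ 2) := Real.le_sqrt_of_sq_le (by nlinarith)
  have hle' : s' ≤ √(s' ^ 2 + t' ^ 2) := Real.le_sqrt_of_sq_le (by nlinarith)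
  have h0 : 0 < √(s ^ 2 + t ^ 2) := by positivity
  have h0' : 0 < √(s' ^ 2 + t' ^ 2) := by positivity
  have hd := abs_div_sqrt_sub_le hs0 ht hs' ht'
  have hsq := Real.sq_sqrt (by positivity : 0 ≤ s ^ 2 + t ^ 2)
  have hsq' := Real.sq_sqrt (by positivity : 0 ≤ s' ^ 2 + t' ^ 2)
  set h := √(s ^ 2 + t ^ 2)
  set h' := √(s' ^ 2 + t' ^ 2)
  have h1 : s / h ≤ 1 := (div_le_one h0).2 hle
  have h1' : s' / h' ≤ 1 := (div_le_one h0').2 hle'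
  have e : s ^ 2 / (s ^ 2 + t ^ 2) - s' ^ 2 / (s' ^ 2 + t' ^ 2)
      = (s / h - s' / h') * (s / h + s' / h') := by
    rw [← hsq, ← hsq']; field_simp; ring
  have h2 : |s / h - s' / h'| ≤ (2 * |s - s'| + |t - t'|) / m := by
    rw [le_div_iff₀ hm]
    refine le_trans ?_ hd
    gcongr
    exact hs.trans hle
  have h3 : (s / h - s' / h') ^ 2 ≤ ((2 * |s - s'| + |t - t'|) / m) ^ 2 := by
    rw [← sq_abs]; gcongr
  have h4 : (s / h + s' / h') ^ 2 ≤ 4 := by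
    have : 0 ≤ s / h + s' / h' := by positivity
    nlinarith
  have h5 : (2 * |s - s'| + |t - t'|) ^ 2 ≤ 8 * ((s - s') ^ 2 + (t - t') ^ 2) := by
    rw [← sq_abs (s - s'), ← sq_abs (t - t')]
    nlinarith [sq_nonneg (2 * |s - s'| - |t - t'|), sq_nonneg (|t - t'|)]
  rw [e, mul_pow]
  calc (s / h - s' / h') ^ 2 * (s / h + s' / h') ^ 2
      ≤ ((2 * |s - s'| + |t - t'|) / m) ^ 2 * 4 := by gcongr
    _ = 4 * (2 * |s - s'| + |t - t'|) ^ 2 / m ^ 2 := by ring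
    _ ≤ 4 * (8 * ((s - s') ^ 2 + (t - t') ^ 2)) / m ^ 2 := by gcongr
    _ = _ := by ring

/-- A refinement for small `t`: one minus the shrinkage factor is `t²/(s² + t²)`, whose derivatives
in `s` and `t` are of order `t²/s³` and `t/s²`. The powers of `t + t'` are what makes the chain
contract locally. -/
lemma sq_shrinkage_sub_le_of_scale {m : ℝ} (hm : 0 < m) (hs : m ≤ s) (ht : 0 < t) (hs' : m ≤ s')
    (ht' : 0 < t') :
    (s ^ 2 / (s ^ 2 + t ^ 2) - s' ^ 2 / (s' ^ 2 + t' ^ 2)) ^ 2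
      ≤ 2 * (s - s') ^ 2 * (t + t') ^ 4 / m ^ 6 + 2 * (t - t') ^ 2 * (t + t') ^ 2 / m ^ 4 := by
  have hs0 : 0 < s := hm.trans_le hs
  have hs0' : 0 < s' := hm.trans_le hs'
  have e : s ^ 2 / (s ^ 2 + t ^ 2) - s' ^ 2 / (s' ^ 2 + t' ^ 2)
      = ((s - s') * t' + s' * (t' - t)) * (s * t' + s' * t)
        / ((s ^ 2 + t ^ 2) * (s' ^ 2 + t' ^ 2)) := by
    field_simp; ring
  have h1 : |s ^ 2 / (s ^ 2 + t ^ 2) - s' ^ 2 / (s' ^ 2 + t' ^ 2)|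
      ≤ |s - s'| * (t + t') ^ 2 / m ^ 3 + |t - t'| * (t + t') / m ^ 2 := by
    rw [e, abs_div, abs_mul, abs_of_pos (by positivity : 0 < s * t' + s' * t),
      abs_of_pos (by positivity : 0 < (s ^ 2 + t ^ 2) * (s' ^ 2 + t' ^ 2))]
    have a1 : |(s - s') * t' + s' * (t' - t)| ≤ |s - s'| * t' + s' * |t - t'| := by
      refine (abs_add_le _ _).trans ?_
      rw [abs_mul, abs_mul, abs_of_pos ht', abs_of_pos hs0', abs_sub_comm t' t]
    calc |(s - s') * t' + s' * (t' - t)| * (s * t' + s' * t)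
          / ((s ^ 2 + t ^ 2) * (s' ^ 2 + t' ^ 2))
        ≤ (|s - s'| * t' + s' * |t - t'|) * (s * t' + s' * t) / (s ^ 2 * s' ^ 2) := by
          gcongr <;> nlinarith
      _ = |s - s'| * (t' * (t' / (s * s' ^ 2) + t / (s ^ 2 * s')))
          + |t - t'| * (t' / (s * s') + t / s ^ 2) := by field_simp
      _ ≤ |s - s'| * ((t + t') * (t' / (m * m ^ 2) + t / (m ^ 2 * m)))
          + |t - t'| * (t' / (m * m) + t / m ^ 2) := by
          gcongr; linarith
      _ = _ := by field_simp; ring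
  have h2 : ∀ x y : ℝ, (x + y) ^ 2 ≤ 2 * x ^ 2 + 2 * y ^ 2 := fun x y => by
    nlinarith [sq_nonneg (x - y)]
  rw [← sq_abs]
  refine (pow_le_pow_left₀ (abs_nonneg _) h1 2).trans ((h2 _ _).trans_eq ?_)
  rw [div_pow, div_pow, mul_pow, mul_pow, sq_abs, sq_abs]
  ring

end ScaleInequalities

/-! ### Calculus of upper bounds for means -/

section MeanBounds

variable {Ω Ω' : Type*} [MeasurableSpace Ω] [MeasurableSpace Ω'] {μ : Measure Ω}
  {ν : Measure Ω'} {f g : Ω → ℝ} {a b : ℝ}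

/-- The mean of the nonnegative function `f` is at most `a`. -/
def MeanLE (μ : Measure Ω) (f : Ω → ℝ) (a : ℝ) : Prop :=
  ∫⁻ ω, ENNReal.ofReal (f ω) ∂μ ≤ ENNReal.ofReal a

lemma MeanLE.mono_ae (h : MeanLE μ g a) (hfg : ∀ᵐ ω ∂μ, f ω ≤ g ω) (hab : a ≤ b) :
    MeanLE μ f b :=
  (lintegral_mono_ae (hfg.mono fun _ hω => ENNReal.ofReal_le_ofReal hω)).trans
    (h.trans (ENNReal.ofReal_le_ofReal hab))

lemma MeanLE.mono (h : MeanLE μ g a) (hfg : ∀ ω, f ω ≤ g ω) (hab : a ≤ b) : MeanLE μ f b :=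
  h.mono_ae (ae_of_all _ hfg) hab

lemma MeanLE.add (hf : MeanLE μ f a) (hg : MeanLE μ g b) (ha : 0 ≤ a) (hb : 0 ≤ b)
    (hfm : Measurable f) : MeanLE μ (fun ω => f ω + g ω) (a + b) := by
  unfold MeanLE
  calc ∫⁻ ω, ENNReal.ofReal (f ω + g ω) ∂μ
      ≤ ∫⁻ ω, ENNReal.ofReal (f ω) + ENNReal.ofReal (g ω) ∂μ :=
        lintegral_mono fun _ => ENNReal.ofReal_add_le
    _ = ∫⁻ ω, ENNReal.ofReal (f ω) ∂μ + ∫⁻ ω, ENNReal.ofReal (g ω) ∂μ :=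
        lintegral_add_left hfm.ennreal_ofReal _
    _ ≤ ENNReal.ofReal a + ENNReal.ofReal b := add_le_add hf hg
    _ = ENNReal.ofReal (a + b) := (ENNReal.ofReal_add ha hb).symm

lemma MeanLE.const_mul (hf : MeanLE μ f a) {k : ℝ} (hk : 0 ≤ k) :
    MeanLE μ (fun ω => k * f ω) (k * a) := by
  unfold MeanLE
  simp only [ENNReal.ofReal_mul hk]
  rw [lintegral_const_mul' _ _ ENNReal.ofReal_ne_top]
  exact mul_le_mul_right hf _

lemma MeanLE.const [IsProbabilityMeasure μ] (a : ℝ) : MeanLE μ (fun _ => a) a := by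
  simp [MeanLE]

lemma MeanLE.sum {ι : Type*} (s : Finset ι) {F : ι → Ω → ℝ} (h : ∀ i ∈ s, MeanLE μ (F i) a)
    (ha : 0 ≤ a) (hF : ∀ i ∈ s, Measurable (F i)) :
    MeanLE μ (fun ω => ∑ i ∈ s, F i ω) (s.card * a) := by
  classical
  induction s using Finset.induction_on with
  | empty => simp [MeanLE]
  | insert i s hi ih =>
    simp only [Finset.sum_insert hi, Finset.card_insert_of_notMem hi]
    have h1 := (h i (Finset.mem_insert_self i s)).add
      (ih (fun j hj => h j (Finset.mem_insert_of_mem hj))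
        fun j hj => hF j (Finset.mem_insert_of_mem hj)) ha (by positivity)
      (hF i (Finset.mem_insert_self i s))
    refine h1.mono (fun _ => le_rfl) ?_
    push_cast
    linarith

/-- Independence. `ENNReal.ofReal` splits a product once one factor is nonnegative; almost
everywhere is enough, which suits functions such as `x⁻¹` under a gamma law. -/
lemma MeanLE.prod_mul [SFinite ν] {g : Ω' → ℝ} (hf : MeanLE μ f a) (hg : MeanLE ν g b)
    (hfm : Measurable f) (hgm : Measurable g) (hf0 : ∀ᵐ x ∂μ, 0 ≤ f x) (ha : 0 ≤ a) :
    MeanLE (μ.prod ν) (fun z => f z.1 * g z.2) (a * b) := by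
  have h : ∀ᵐ z ∂μ.prod ν, ENNReal.ofReal (f z.1 * g z.2)
      = ENNReal.ofReal (f z.1) * ENNReal.ofReal (g z.2) := by
    filter_upwards [Measure.quasiMeasurePreserving_fst.ae hf0] with z hz
    exact ENNReal.ofReal_mul hz
  unfold MeanLE
  rw [lintegral_congr_ae h, lintegral_prod_mul hfm.ennreal_ofReal.aemeasurable hgm.ennreal_ofReal.aemeasurable,
    ENNReal.ofReal_mul ha]
  exact mul_le_mul' hf hg

/-- Cauchy–Schwarz. Second moment bounds are kept in the form `a ^ 2` so that they combine without
square roots. -/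
lemma MeanLE.cauchy (hf : MeanLE μ (fun ω => f ω ^ 2) (a ^ 2))
    (hg : MeanLE μ (fun ω => g ω ^ 2) (b ^ 2)) (hfm : Measurable f) (hgm : Measurable g)
    (hf0 : ∀ x, 0 ≤ f x) (hg0 : ∀ x, 0 ≤ g x) (ha : 0 ≤ a) (hb : 0 ≤ b) :
    MeanLE μ (fun ω => f ω * g ω) (a * b) := by
  have h := ENNReal.lintegral_mul_le_Lp_mul_Lq μ (p := 2) (q := 2)
    Real.HolderConjugate.two_two hfm.ennreal_ofReal.aemeasurable hgm.ennreal_ofReal.aemeasurable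
  have e : ∀ (F : Ω → ℝ) (k : ℝ), (∀ x, 0 ≤ F x) → 0 ≤ k → MeanLE μ (fun ω => F ω ^ 2) (k ^ 2) →
      (∫⁻ ω, ENNReal.ofReal (F ω) ^ (2 : ℝ) ∂μ) ^ (1 / (2 : ℝ)) ≤ ENNReal.ofReal k := by
    intro F k hF hk hm
    rw [one_div, ENNReal.rpow_inv_le_iff (by norm_num)]
    simp only [ENNReal.rpow_ofNat, ← ENNReal.ofReal_pow (hF _)]
    rw [← ENNReal.ofReal_pow hk]
    exact hm
  unfold MeanLE
  simp only [ENNReal.ofReal_mul (hf0 _)]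
  rw [ENNReal.ofReal_mul ha]
  exact h.trans (mul_le_mul' (e f a hf0 ha hf) (e g b hg0 hb hg))

end MeanBounds

/-! ### Moments of gamma and normal variables -/

section Moments

/-- Multiplying the density of shape `a` by `x ^ n` gives a multiple of the density of shape `a +
n`. Negative `n` is allowed and yields the inverse moments. -/
lemma lintegral_zpow_gammaMeasure {a : ℝ} (n : ℤ) (ha : 0 < a) (han : 0 < a + n) :
    ∫⁻ x, ENNReal.ofReal (x ^ n) ∂gammaMeasure a 1
      = ENNReal.ofReal (Real.Gamma (a + n) / Real.Gamma a) := by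
  rw [gammaMeasure, lintegral_withDensity_eq_lintegral_mul _
    (by unfold gammaPDF; fun_prop) (by fun_prop)]
  have h : ∀ᵐ x : ℝ, (gammaPDF a 1 * fun x => ENNReal.ofReal (x ^ n)) x
      = ENNReal.ofReal (Real.Gamma (a + n) / Real.Gamma a) * gammaPDF (a + n) 1 x := by
    filter_upwards [Measure.ae_ne volume (0 : ℝ)] with x hx0
    rcases lt_or_gt_of_ne hx0 with hx | hx
    · simp [gammaPDF_of_neg hx]
    · have hg := Real.Gamma_pos_of_pos ha
      have hg' := Real.Gamma_pos_of_pos han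
      rw [Pi.mul_apply, gammaPDF_of_nonneg hx.le, gammaPDF_of_nonneg hx.le,
        ← ENNReal.ofReal_mul (by positivity), ← ENNReal.ofReal_mul (by positivity)]
      congr 1
      rw [show a + n - 1 = (a - 1) + n by ring, Real.rpow_add hx, Real.rpow_intCast]
      simp only [Real.one_rpow]
      field_simp
  rw [lintegral_congr_ae h, lintegral_const_mul' _ _ ENNReal.ofReal_ne_top,
    lintegral_gammaPDF_eq_one han one_pos, mul_one]

lemma meanLE_gammaMeasure_sq {a : ℝ} (ha : 0 < a) :
    MeanLE (gammaMeasure a 1) (fun x => x ^ 2) ((a + 1) ^ 2) := by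
  have h := lintegral_zpow_gammaMeasure 2 ha (by push_cast; linarith)
  unfold MeanLE
  refine (le_of_eq (by simpa using h)).trans (ENNReal.ofReal_le_ofReal ?_)
  have hg := Real.Gamma_pos_of_pos ha
  rw [show a + 2 = (a + 1) + 1 by ring, Real.Gamma_add_one (by linarith),
    Real.Gamma_add_one ha.ne', div_le_iff₀ hg]
  nlinarith

lemma meanLE_gammaMeasure_self {a : ℝ} (ha : 0 < a) :
    MeanLE (gammaMeasure a 1) (fun x => x) a := by
  have h := lintegral_zpow_gammaMeasure 1 ha (by push_cast; linarith)
  have hg := Real.Gamma_pos_of_pos ha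
  unfold MeanLE
  refine (le_of_eq (by simpa using h)).trans (ENNReal.ofReal_le_ofReal ?_)
  rw [Real.Gamma_add_one ha.ne', div_le_iff₀ hg]

lemma meanLE_gammaMeasure_inv {a k : ℝ} (hk : 0 < k) (hak : k ≤ a - 1) :
    MeanLE (gammaMeasure a 1) (fun x => x⁻¹) k⁻¹ := by
  have ha : 0 < a - 1 := by linarith
  have h := lintegral_zpow_gammaMeasure (a := a) (-1) (by linarith) (by push_cast; linarith)
  have hg := Real.Gamma_pos_of_pos ha
  unfold MeanLE
  refine (le_of_eq (by simpa using h)).trans (ENNReal.ofReal_le_ofReal ?_)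
  have e : Real.Gamma a = (a - 1) * Real.Gamma (a - 1) := by
    rw [← Real.Gamma_add_one ha.ne']; ring_nf
  rw [e, ← sub_eq_add_neg, div_le_iff₀ (by positivity), ← mul_assoc]
  have : 1 ≤ k⁻¹ * (a - 1) := by
    rw [inv_mul_eq_div, le_div_iff₀ hk]; linarith
  nlinarith

/-- The exact value is `1/((a - 1)(a - 2))`, and both factors are at least `k`. -/
lemma meanLE_gammaMeasure_inv_sq {a k : ℝ} (hk : 0 < k) (hak : k ≤ a - 2) :
    MeanLE (gammaMeasure a 1) (fun x => (x⁻¹) ^ 2) (k⁻¹ ^ 2) := by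
  have ha : 0 < a - 2 := by linarith
  have h := lintegral_zpow_gammaMeasure (a := a) (-2) (by linarith) (by push_cast; linarith)
  have hg := Real.Gamma_pos_of_pos ha
  have e0 : ∀ x : ℝ, x ^ (-2 : ℤ) = (x⁻¹) ^ 2 := fun x => by
    rw [zpow_neg, inv_pow]; rfl
  simp only [e0] at h
  unfold MeanLE
  refine h.le.trans (ENNReal.ofReal_le_ofReal ?_)
  have e : Real.Gamma a = (a - 1) * ((a - 2) * Real.Gamma (a - 2)) := by
    rw [← Real.Gamma_add_one ha.ne', show a - 2 + 1 = a - 1 by ring,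
      ← Real.Gamma_add_one (by linarith)]
    ring_nf
  push_cast
  rw [e, ← sub_eq_add_neg, ← mul_assoc, div_le_iff₀ (by have : 0 < a - 1 := by linarith
                                                        positivity), ← mul_assoc]
  have : 1 ≤ k⁻¹ ^ 2 * ((a - 1) * (a - 2)) := by
    have e1 : 1 = k⁻¹ ^ 2 * (k * k) := by field_simp
    rw [e1]
    gcongr <;> linarith
  nlinarith

lemma gammaMeasure_ae_pos (a b : ℝ) : ∀ᵐ x ∂gammaMeasure a b, 0 < x := by
  rw [ae_iff, gammaMeasure, withDensity_apply _ (by measurability)]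
  have : {x : ℝ | ¬ 0 < x} = Set.Iic 0 := by ext; simp
  rw [this, setLIntegral_congr Iio_ae_eq_Iic.symm, lintegral_gammaPDF_of_nonpos le_rfl]

/-- A crude constant suffices: `x⁴/24 ≤ e^|x| ≤ e^x + e^(-x)`, and each exponential has mean
`e^(1/2) ≤ 2`, so the fourth moment is at most `96`. -/
lemma meanLE_gaussianReal_pow_four : MeanLE (gaussianReal 0 1) (fun x => x ^ 4) 100 := by
  have hexp : ∀ t : ℝ, t ^ 2 = 1 →
      MeanLE (gaussianReal 0 1) (fun x => Real.exp (t * x)) 2 := by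
    intro t ht
    have h := congrFun (mgf_fun_id_gaussianReal (μ := 0) (v := 1)) t
    unfold MeanLE
    rw [← ofReal_integral_eq_lintegral_ofReal (integrable_exp_mul_gaussianReal t)
      (ae_of_all _ fun x => (Real.exp_pos _).le)]
    refine ENNReal.ofReal_le_ofReal ?_
    rw [mgf] at h
    rw [h]
    simp only [zero_mul, NNReal.coe_one, one_mul, zero_add, ht]
    have h1 : Real.exp (1 / 2) ^ 2 = Real.exp 1 := by
      rw [← Real.exp_nat_mul]; norm_num
    nlinarith [Real.exp_one_lt_d9, Real.exp_pos (1 / 2)]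
  have h := ((hexp 1 (by norm_num)).add (hexp (-1) (by norm_num)) (by norm_num) (by norm_num)
    (by fun_prop)).const_mul (k := 24) (by norm_num)
  refine h.mono (fun x => ?_) (by norm_num)
  have h1 := Real.pow_div_factorial_le_exp |x| (abs_nonneg x) 4
  rw [show ((Nat.factorial 4 : ℕ) : ℝ) = 24 by norm_num [Nat.factorial], div_le_iff₀ (by norm_num)]
    at h1
  have h2 : |x| ^ 4 = x ^ 4 := by rw [show 4 = 2 * 2 by norm_num, pow_mul, sq_abs, ← pow_mul]
  have h3 : Real.exp |x| ≤ Real.exp (1 * x) + Real.exp (-1 * x) := by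
    rcases abs_cases x with ⟨h, _⟩ | ⟨h, _⟩ <;> rw [h]
    · rw [one_mul]; linarith [Real.exp_pos (-1 * x)]
    · rw [neg_one_mul]; linarith [Real.exp_pos (1 * x)]
  linarith

lemma meanLE_gaussianReal_sq : MeanLE (gaussianReal 0 1) (fun x => x ^ 2) 101 := by
  have h := (MeanLE.const (μ := gaussianReal 0 1) 1).add meanLE_gaussianReal_pow_four
    (by norm_num) (by norm_num) measurable_const
  exact h.mono (fun x => by nlinarith [sq_nonneg (x ^ 2 - 1)]) (by norm_num)

lemma MeanLE.pi_eval {p : ℕ} {f : ℝ → ℝ} {a : ℝ} (h : MeanLE (gaussianReal 0 1) f a)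
    (hf : Measurable f) (i : Fin p) :
    MeanLE (Measure.pi fun _ : Fin p => gaussianReal 0 1) (fun x => f (x i)) a := by
  have hp := measurePreserving_eval (fun _ : Fin p => gaussianReal 0 1) i
  unfold MeanLE
  have := hp.lintegral_comp (f := fun x => ENNReal.ofReal (f x)) hf.ennreal_ofReal
  exact this.trans_le h

lemma meanLE_pi_sum_sq (p : ℕ) :
    MeanLE (Measure.pi fun _ : Fin p => gaussianReal 0 1) (fun x => ∑ i, x i ^ 2) (101 * p) := by
  have h := MeanLE.sum (μ := Measure.pi fun _ : Fin p => gaussianReal 0 1) Finset.univ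
    (F := fun i x => x i ^ 2) (a := 101)
    (fun i _ => meanLE_gaussianReal_sq.pi_eval (by fun_prop) i) (by norm_num)
    (fun i _ => by fun_prop)
  refine h.mono (fun _ => le_rfl) ?_
  simp [mul_comm]

lemma meanLE_pi_sum_sq_sq (p : ℕ) :
    MeanLE (Measure.pi fun _ : Fin p => gaussianReal 0 1) (fun x => (∑ i, x i ^ 2) ^ 2)
      (100 * p ^ 2) := by
  have h := (MeanLE.sum (μ := Measure.pi fun _ : Fin p => gaussianReal 0 1) Finset.univ
    (F := fun i x => x i ^ 4) (a := 100)
    (fun i _ => meanLE_gaussianReal_pow_four.pi_eval (by fun_prop) i) (by norm_num)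
    (fun i _ => by fun_prop)).const_mul (k := p) (by positivity)
  refine h.mono (fun x => ?_) ?_
  · have := sq_sum_le_card_mul_sum_sq (s := Finset.univ) (f := fun i => x i ^ 2)
    simp only [Finset.card_univ, Fintype.card_fin, ← pow_mul] at this
    exact this
  · simp only [Finset.card_univ, Fintype.card_fin]
    exact le_of_eq (by ring)

end Moments

/-! ### Gamma and normal laws as images of standard ones -/

section Representations

/-- The rate is an inverse scale. As the shapes in the chain do not depend on the state, one gamma
variable of rate 1 can drive all states at once. -/
lemma gammaMeasure_eq_map (a : ℝ) {b : ℝ} (hb : 0 < b) :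
    gammaMeasure a b = (gammaMeasure a 1).map fun x => x / b := by
  refine Measure.ext_of_lintegral _ fun f hf => ?_
  have hm : Measurable fun x : ℝ => x / b := by fun_prop
  have hpdf : ∀ c, Measurable (gammaPDF a c) := fun c => by unfold gammaPDF; fun_prop
  have hfm : Measurable fun x : ℝ => f (x / b) := hf.comp hm
  rw [lintegral_map hf hm, gammaMeasure, gammaMeasure,
    lintegral_withDensity_eq_lintegral_mul _ (hpdf _) hf,
    lintegral_withDensity_eq_lintegral_mul _ (hpdf _) hfm]
  conv_rhs => rw [← Real.smul_map_volume_mul_left hb.ne']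
  rw [lintegral_smul_measure, lintegral_map ((hpdf _).mul hfm) (by fun_prop),
    smul_eq_mul, ← lintegral_const_mul _ (by
      exact ((hpdf _).mul hfm).comp (measurable_const_mul b))]
  refine lintegral_congr fun x => ?_
  simp only [Pi.mul_apply, abs_of_pos hb]
  rw [← mul_assoc, mul_div_cancel_left₀ x hb.ne']
  congr 1
  rw [gammaPDF, gammaPDF, ← ENNReal.ofReal_mul hb.le]
  congr 1
  unfold gammaPDFReal
  have : (0 ≤ b * x) ↔ 0 ≤ x := by rw [mul_nonneg_iff_of_pos_left hb]
  simp only [this]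
  split_ifs with hx
  · rw [Real.mul_rpow hb.le hx, Real.rpow_sub_one hb.ne', Real.one_rpow, one_mul]
    field_simp
  · simp

/-- No sign condition on `v` is needed: for `v ≤ 0` both `v.toNNReal` and `√v` are `0`, and both
sides are the point mass at `m`. -/
lemma gaussianReal_eq_map (m v : ℝ) :
    gaussianReal m v.toNNReal = (gaussianReal 0 1).map fun x => m + √v * x := by
  have h1 : (fun x => m + √v * x) = (fun x : ℝ => m + x) ∘ fun x => √v * x := rfl
  rw [h1, ← Measure.map_map (by fun_prop) (by fun_prop), gaussianReal_map_const_mul,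
    gaussianReal_map_const_add]
  congr 1
  · simp
  · ext
    simp only [mul_one, NNReal.coe_mk, Real.coe_toNNReal']
    rcases le_total 0 v with hv | hv
    · simp [Real.sq_sqrt hv, hv]
    · simp [Real.sqrt_eq_zero_of_nonpos hv, hv]

lemma pi_gaussianReal_eq_map {p : ℕ} (m : Fin p → ℝ) (v : ℝ) :
    Measure.pi (fun i => gaussianReal (m i) v.toNNReal)
      = (Measure.pi fun _ : Fin p => gaussianReal 0 1).map fun x i => m i + √v * x i := by
  rw [Measure.pi_map_pi (f := fun i x => m i + √v * x) (fun i => by fun_prop)]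
  simp only [gaussianReal_eq_map]

end Representations

/-! ### One step of the chain as a random map -/

namespace RandomEffects

variable {p r : ℕ} (y : Fin p → Fin r → ℝ)

/-- The random inputs of a step of the chain: two gamma variables, and the standard normal
variables for the intercept and for the effects. -/
abbrev Noise (p : ℕ) : Type := ℝ × ℝ × ℝ × (Fin p → ℝ)

/-- The law of the random inputs of a step. -/
noncomputable def noiseLaw (p r : ℕ) (a₁ a₂ : ℝ) : Measure (Noise p) :=
  (gammaMeasure ((p : ℝ) / 2 + a₁) 1).prod ((gammaMeasure ((r : ℝ) * p / 2 + a₂) 1).prod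
    ((gaussianReal 0 1).prod (Measure.pi fun _ : Fin p => gaussianReal 0 1)))

/-- The new intercept, given the precisions and a standard normal variable. -/
noncomputable def newIntercept (lθ le n : ℝ) : ℝ :=
  √(p : ℝ) * grandMean y + √((lθ + r * le) / (r * le * lθ)) * n

/-- The new effects, given the precisions, the intercept and standard normal variables. -/
noncomputable def newEffects (lθ le x : ℝ) (n : Fin p → ℝ) (i : Fin p) : ℝ :=
  r * le * (groupMean y i - x / √(p : ℝ)) / (lθ + r * le) + √(1 / (lθ + r * le)) * n i

/-- The new state as a function of the old state and of the random inputs. -/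
noncomputable def randomMap (b₁ b₂ : ℝ) (η : State p) (ω : Noise p) : State p :=
  let lθ := ω.1 / (b₁ + effectSq η / 2)
  let le := ω.2.1 / (b₂ + residualSq y η / 2)
  let x := newIntercept y lθ le ω.2.2.1
  assemble (x, newEffects y lθ le x ω.2.2.2)

lemma measurable_newState :
    Measurable fun z : Noise p => (assemble (newIntercept y z.1 z.2.1 z.2.2.1,
      newEffects y z.1 z.2.1 (newIntercept y z.1 z.2.1 z.2.2.1) z.2.2.2) : State p) := by
  have h : Measurable fun z : Noise p => newIntercept y z.1 z.2.1 z.2.2.1 := by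
    unfold newIntercept; fun_prop
  refine measurable_assemble.comp (h.prodMk (measurable_pi_lambda _ fun i => ?_))
  unfold newEffects
  fun_prop

lemma measurable_randomMap (b₁ b₂ : ℝ) :
    Measurable (Function.uncurry (randomMap y b₁ b₂)) := by
  have h1 : Measurable fun z : State p × Noise p => effectSq z.1 :=
    measurable_effectSq.comp measurable_fst
  have h2 : Measurable fun z : State p × Noise p => residualSq y z.1 :=
    (measurable_residualSq y).comp measurable_fst
  have h3 : Measurable fun z : State p × Noise p =>
      ((z.2.1 / (b₁ + effectSq z.1 / 2), z.2.2.1 / (b₂ + residualSq y z.1 / 2), z.2.2.2) :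
        Noise p) := by fun_prop
  exact (measurable_newState y).comp h3

lemma isProbabilityMeasure_noiseLaw {a₁ a₂ : ℝ} (ha₁ : 0 < a₁) (ha₂ : 0 < a₂) :
    IsProbabilityMeasure (noiseLaw p r a₁ a₂) := by
  have h1 : IsProbabilityMeasure (gammaMeasure ((p : ℝ) / 2 + a₁) 1) :=
    isProbabilityMeasure_gammaMeasure (by positivity) one_pos
  have h2 : IsProbabilityMeasure (gammaMeasure ((r : ℝ) * p / 2 + a₂) 1) :=
    isProbabilityMeasure_gammaMeasure (by positivity) one_pos
  unfold noiseLaw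
  infer_instance

/-- The kernel which draws the new state given the precisions. -/
noncomputable def drawState : Kernel (ℝ × ℝ) (State p) :=
  (drawIntercept y ⊗ₖ drawEffects y).map assemble

lemma lintegral_drawState {f : State p → ℝ≥0∞} (hf : Measurable f) (l : ℝ × ℝ) :
    ∫⁻ w, f w ∂drawState y l = ∫⁻ n₀, ∫⁻ n, f (assemble (newIntercept y l.1 l.2 n₀,
      newEffects y l.1 l.2 (newIntercept y l.1 l.2 n₀) n))
        ∂(Measure.pi fun _ : Fin p => gaussianReal 0 1) ∂gaussianReal 0 1 := by
  have hfa : Measurable fun z : ℝ × (Fin p → ℝ) => f (assemble z) := hf.comp measurable_assemble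
  rw [drawState, Kernel.map_apply _ measurable_assemble, lintegral_map hf measurable_assemble,
    Kernel.lintegral_compProd _ _ _ hfa]
  have hI : drawIntercept y l = (gaussianReal 0 1).map (newIntercept y l.1 l.2) :=
    gaussianReal_eq_map _ _
  have hE : ∀ x, drawEffects y (l, x)
      = (Measure.pi fun _ : Fin p => gaussianReal 0 1).map (newEffects y l.1 l.2 x) :=
    fun x => pi_gaussianReal_eq_map _ _
  have hm : Measurable (newIntercept y l.1 l.2) := by unfold newIntercept; fun_prop
  have hmE : ∀ x, Measurable (newEffects y l.1 l.2 x) := fun x =>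
    measurable_pi_lambda _ fun i => by unfold newEffects; fun_prop
  rw [hI, lintegral_map _ hm]
  · refine lintegral_congr fun n₀ => ?_
    rw [hE]
    exact lintegral_map (hfa.comp measurable_prodMk_left) (hmE _)
  · have := Measurable.lintegral_kernel_prod_right (κ := drawEffects y)
      (f := fun (q : (ℝ × ℝ) × ℝ) e => f (assemble (q.2, e))) (by
        exact hfa.comp (by fun_prop : Measurable fun z : ((ℝ × ℝ) × ℝ) × (Fin p → ℝ) =>
          (z.1.2, z.2)))
    exact this.comp measurable_prodMk_left

lemma gibbsKernel_eq_map {a₁ b₁ a₂ b₂ : ℝ} (ha₁ : 0 < a₁) (hb₁ : 0 < b₁) (ha₂ : 0 < a₂)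
    (hb₂ : 0 < b₂) (η : State p) :
    gibbsKernel y a₁ b₁ a₂ b₂ η = (noiseLaw p r a₁ a₂).map (randomMap y b₁ b₂ η) := by
  have hu : 0 < b₁ + effectSq η / 2 := by have := effectSq_nonneg η; positivity
  have hv : 0 < b₂ + residualSq y η / 2 := by have := residualSq_nonneg y η; positivity
  have h₁ : IsMarkovKernel (drawTheta p a₁ b₁) := ⟨fun η =>
    isProbabilityMeasure_gammaMeasure (by positivity)
      (by have := effectSq_nonneg η; positivity)⟩
  have h₂ : IsMarkovKernel (drawError y a₂ b₂) := ⟨fun η =>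
    isProbabilityMeasure_gammaMeasure (by positivity)
      (by have := residualSq_nonneg y η; positivity)⟩
  have h1 : IsProbabilityMeasure (gammaMeasure ((p : ℝ) / 2 + a₁) 1) :=
    isProbabilityMeasure_gammaMeasure (by positivity) one_pos
  have h2 : IsProbabilityMeasure (gammaMeasure ((r : ℝ) * p / 2 + a₂) 1) :=
    isProbabilityMeasure_gammaMeasure (by positivity) one_pos
  refine Measure.ext_of_lintegral _ fun f hf => ?_
  have hF : Measurable (randomMap y b₁ b₂ η) :=
    (measurable_randomMap y b₁ b₂).comp measurable_prodMk_left
  have hfF : Measurable fun z => f (randomMap y b₁ b₂ η z) := hf.comp hF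
  have hG : Measurable fun l => ∫⁻ w, f w ∂drawState y l := hf.lintegral_kernel
  have hJ : ((drawTheta p a₁ b₁) η).prod ((drawError y a₂ b₂) η)
      = ((gammaMeasure ((p : ℝ) / 2 + a₁) 1).map fun x => x / (b₁ + effectSq η / 2)).prod
        ((gammaMeasure ((r : ℝ) * p / 2 + a₂) 1).map fun x => x / (b₂ + residualSq y η / 2)) := by
    rw [← gammaMeasure_eq_map _ hu, ← gammaMeasure_eq_map _ hv]
    rfl
  rw [lintegral_map hf hF, noiseLaw, lintegral_prod _ hfF.aemeasurable]
  change ∫⁻ w, f w ∂(drawState y ∘ₖ (drawTheta p a₁ b₁ ×ₖ drawError y a₂ b₂)) η = _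
  rw [Kernel.lintegral_comp _ _ _ hf, Kernel.prod_apply, hJ,
    lintegral_prod _ hG.aemeasurable,
    lintegral_map (by fun_prop) (by fun_prop)]
  refine lintegral_congr fun j₁ => ?_
  have hF1 : Measurable fun z => f (randomMap y b₁ b₂ η (j₁, z)) :=
    hfF.comp measurable_prodMk_left
  rw [lintegral_prod _ hF1.aemeasurable,
    lintegral_map (f := fun x => ∫⁻ w, f w ∂drawState y (j₁ / (b₁ + effectSq η / 2), x))
      (hG.comp measurable_prodMk_left) (by fun_prop)]
  refine lintegral_congr fun j₂ => ?_
  have hF2 : Measurable fun z => f (randomMap y b₁ b₂ η (j₁, j₂, z)) :=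
    hF1.comp measurable_prodMk_left
  rw [lintegral_prod _ hF2.aemeasurable, lintegral_drawState y hf]
  rfl

end RandomEffects

/-! ### Energy of a state and dependence of the scales on the state -/

/-- `√(b + |x|²/2)` is the Euclidean norm of the vector `(√b, x/√2)`, hence Lipschitz in `x`,
uniformly in `b`. -/
lemma sq_sqrt_add_sum_sub_le {ι : Type*} [Fintype ι] {b : ℝ} (hb : 0 ≤ b) (x x' : ι → ℝ) :
    (√(b + (∑ i, x i ^ 2) / 2) - √(b + (∑ i, x' i ^ 2) / 2)) ^ 2 ≤ ∑ i, (x i - x' i) ^ 2 := by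
  have hX : 0 ≤ ∑ i, x i ^ 2 := Finset.sum_nonneg fun _ _ => sq_nonneg _
  have hX' : 0 ≤ ∑ i, x' i ^ 2 := Finset.sum_nonneg fun _ _ => sq_nonneg _
  have hcs := Finset.sum_mul_sq_le_sq_mul_sq Finset.univ x x'
  have hexp : ∑ i, (x i - x' i) ^ 2 = ∑ i, x i ^ 2 - 2 * ∑ i, x i * x' i + ∑ i, x' i ^ 2 := by
    rw [Finset.mul_sum, ← Finset.sum_sub_distrib, ← Finset.sum_add_distrib]
    exact Finset.sum_congr rfl fun i _ => by ring
  have hpos : 0 ≤ ∑ i, (x i - x' i) ^ 2 := Finset.sum_nonneg fun _ _ => sq_nonneg _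
  set X := ∑ i, x i ^ 2
  set X' := ∑ i, x' i ^ 2
  set Z := ∑ i, x i * x' i
  have h1 := Real.sq_sqrt (by positivity : 0 ≤ b + X / 2)
  have h2 := Real.sq_sqrt (by positivity : 0 ≤ b + X' / 2)
  have h3 : b + Z / 2 ≤ √(b + X / 2) * √(b + X' / 2) := by
    rw [← Real.sqrt_mul (by positivity)]
    refine Real.le_sqrt_of_sq_le ?_
    nlinarith [mul_nonneg hb (by linarith : 0 ≤ X - 2 * Z + X')]
  nlinarith

namespace RandomEffects

section Deterministic

variable {p r : ℕ} (y : Fin p → Fin r → ℝ)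

/-- The squared distance of the state to the centre `(√p ȳ, ȳ₁ - ȳ, …, ȳ_p - ȳ)`. -/
noncomputable def energy (η : State p) : ℝ :=
  ∑ i : Fin p, (η i.succ + grandMean y - groupMean y i) ^ 2 + (η 0 - √(p : ℝ) * grandMean y) ^ 2

/-- The between-group sum of squares. -/
noncomputable def betweenSq : ℝ := ∑ i, (groupMean y i - grandMean y) ^ 2

/-- The within-group sum of squares. -/
noncomputable def withinSq : ℝ := ∑ i, ∑ j, (y i j - groupMean y i) ^ 2

lemma energy_nonneg (η : State p) : 0 ≤ energy y η :=
  add_nonneg (Finset.sum_nonneg fun _ _ => sq_nonneg _) (sq_nonneg _)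

lemma betweenSq_nonneg : 0 ≤ betweenSq y := Finset.sum_nonneg fun _ _ => sq_nonneg _

lemma withinSq_nonneg : 0 ≤ withinSq y :=
  Finset.sum_nonneg fun _ _ => Finset.sum_nonneg fun _ _ => sq_nonneg _

lemma measurable_energy : Measurable (energy y) := by
  unfold energy; fun_prop

lemma state_dist_sq (η η' : State p) :
    dist η η' ^ 2 = (η 0 - η' 0) ^ 2 + ∑ i : Fin p, (η i.succ - η' i.succ) ^ 2 := by
  rw [EuclideanSpace.dist_eq, Real.sq_sqrt (Finset.sum_nonneg fun _ _ => sq_nonneg _),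
    Fin.sum_univ_succ]
  simp only [Real.dist_eq, sq_abs]

/-- The centre `(√p ȳ, ȳ₁ - ȳ, …, ȳ_p - ȳ)`. -/
noncomputable def center : State p :=
  assemble (√(p : ℝ) * grandMean y, fun i => groupMean y i - grandMean y)

@[simp] lemma assemble_zero (q : ℝ × (Fin p → ℝ)) : assemble q 0 = q.1 := rfl

@[simp] lemma assemble_succ (q : ℝ × (Fin p → ℝ)) (i : Fin p) : assemble q i.succ = q.2 i := rfl

lemma energy_eq_dist_sq (η : State p) : energy y η = dist η (center y) ^ 2 := by
  rw [state_dist_sq, energy, add_comm]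
  simp only [center, assemble_zero, assemble_succ]
  congr 1
  exact Finset.sum_congr rfl fun i _ => by ring

lemma dist_sq_le_energy (η η' : State p) : dist η η' ^ 2 ≤ 2 * (energy y η + energy y η') := by
  rw [energy_eq_dist_sq, energy_eq_dist_sq]
  have h := dist_triangle_right η η' (center y)
  have h0 := dist_nonneg (x := η) (y := η')
  nlinarith [sq_nonneg (dist η (center y) - dist η' (center y))]

lemma effectSq_le (η : State p) : effectSq η ≤ 2 * energy y η + 2 * betweenSq y := by
  unfold effectSq energy betweenSq
  have h : ∑ i : Fin p, η i.succ ^ 2 ≤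
      2 * ∑ i : Fin p, (η i.succ + grandMean y - groupMean y i) ^ 2 +
      2 * ∑ i, (groupMean y i - grandMean y) ^ 2 := by
    rw [Finset.mul_sum, Finset.mul_sum, ← Finset.sum_add_distrib]
    refine Finset.sum_le_sum fun i _ => ?_
    nlinarith [sq_nonneg (η i.succ + 2 * grandMean y - 2 * groupMean y i)]
  nlinarith [sq_nonneg (η 0 - √(p : ℝ) * grandMean y)]

/-- Pythagoras in each group: the deviations from the group mean sum to zero, so the cross term
vanishes. -/
lemma residualSq_eq (hr : 0 < r) (η : State p) :
    residualSq y η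
      = withinSq y + r * ∑ i : Fin p, (groupMean y i - η 0 / √(p : ℝ) - η i.succ) ^ 2 := by
  have hr' : (r : ℝ) ≠ 0 := by positivity
  unfold residualSq withinSq
  rw [Finset.mul_sum, ← Finset.sum_add_distrib]
  refine Finset.sum_congr rfl fun i _ => ?_
  have h0 : ∑ j, (y i j - groupMean y i) = 0 := by
    rw [Finset.sum_sub_distrib, Finset.sum_const, Finset.card_univ, Fintype.card_fin,
      groupMean, nsmul_eq_mul, mul_div_cancel₀ _ hr', sub_self]
  set k := groupMean y i - η 0 / √(p : ℝ) - η i.succ with hk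
  have e : ∀ j, (y i j - η 0 / √(p : ℝ) - η i.succ) ^ 2
      = (y i j - groupMean y i) ^ 2 + 2 * k * (y i j - groupMean y i) + k ^ 2 := fun j => by
    rw [hk]; ring
  simp only [e, Finset.sum_add_distrib, ← Finset.mul_sum, h0, Finset.sum_const, Finset.card_univ,
    Fintype.card_fin, nsmul_eq_mul, mul_zero, add_zero]

/-- Each of the `p` groups receives `(η₀ - √p ȳ)²/p` from the intercept, and together they give back
the intercept part of the energy. This is the effect of working with `√p μ` in place of `μ`. -/
lemma residualSq_le (hp : 0 < p) (hr : 0 < r) (η : State p) :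
    residualSq y η ≤ withinSq y + 2 * r * energy y η := by
  have hp' : (0 : ℝ) < p := by positivity
  rw [residualSq_eq y hr, mul_comm 2 (r : ℝ), mul_assoc]
  have h : ∑ i : Fin p, (groupMean y i - η 0 / √(p : ℝ) - η i.succ) ^ 2 ≤ 2 * energy y η := by
    have h1 : ∀ i : Fin p, (groupMean y i - η 0 / √(p : ℝ) - η i.succ) ^ 2
        ≤ 2 * (η i.succ + grandMean y - groupMean y i) ^ 2
          + 2 * ((η 0 - √(p : ℝ) * grandMean y) ^ 2 / p) := by
      intro i
      have e : (η 0 - √(p : ℝ) * grandMean y) ^ 2 / p = (η 0 / √(p : ℝ) - grandMean y) ^ 2 := by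
        have h2 : √(p : ℝ) ≠ 0 := by positivity
        rw [eq_comm, div_sub' h2, div_pow, Real.sq_sqrt hp'.le]
      rw [e]
      nlinarith [sq_nonneg ((η i.succ + grandMean y - groupMean y i)
        - (η 0 / √(p : ℝ) - grandMean y))]
    refine (Finset.sum_le_sum fun i _ => h1 i).trans_eq ?_
    rw [Finset.sum_add_distrib, ← Finset.mul_sum, Finset.sum_const, Finset.card_univ,
      Fintype.card_fin, nsmul_eq_mul, energy]
    field_simp
  gcongr

/-- The standard deviation `λ_θ^(-1/2)` as a function of the state and the gamma variable. -/
noncomputable def thetaScale (b₁ : ℝ) (η : State p) (j : ℝ) : ℝ := √((b₁ + effectSq η / 2) / j)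

/-- The standard deviation `(r λ_e)^(-1/2)` as a function of the state and the gamma variable. -/
noncomputable def errorScale (b₂ : ℝ) (η : State p) (j : ℝ) : ℝ :=
  √((b₂ + residualSq y η / 2) / (r * j))

lemma sq_sqrt_effect_sub_le {b₁ : ℝ} (hb₁ : 0 < b₁) (η η' : State p) :
    (√(b₁ + effectSq η / 2) - √(b₁ + effectSq η' / 2)) ^ 2 ≤ dist η η' ^ 2 := by
  refine (sq_sqrt_add_sum_sub_le hb₁.le (fun i : Fin p => η i.succ) fun i => η' i.succ).trans ?_
  rw [state_dist_sq]
  linarith [sq_nonneg (η 0 - η' 0)]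

lemma sq_sqrt_residual_sub_le (hp : 0 < p) {b₂ : ℝ} (hb₂ : 0 < b₂) (η η' : State p) :
    (√(b₂ + residualSq y η / 2) - √(b₂ + residualSq y η' / 2)) ^ 2
      ≤ 2 * r * dist η η' ^ 2 := by
  have hp' : (0 : ℝ) < p := by positivity
  have h := sq_sqrt_add_sum_sub_le hb₂.le
    (fun q : Fin p × Fin r => y q.1 q.2 - η 0 / √(p : ℝ) - η q.1.succ)
    (fun q : Fin p × Fin r => y q.1 q.2 - η' 0 / √(p : ℝ) - η' q.1.succ)
  simp only [Fintype.sum_prod_type] at h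
  refine h.trans ?_
  rw [state_dist_sq]
  have e : ∀ i : Fin p, ∀ j : Fin r, (y i j - η 0 / √(p : ℝ) - η i.succ
      - (y i j - η' 0 / √(p : ℝ) - η' i.succ)) ^ 2
      ≤ 2 * ((η 0 - η' 0) ^ 2 / p) + 2 * (η i.succ - η' i.succ) ^ 2 := by
    intro i j
    have e1 : (η 0 - η' 0) ^ 2 / p = ((η 0 - η' 0) / √(p : ℝ)) ^ 2 := by
      rw [div_pow, Real.sq_sqrt hp'.le]
    have e2 : y i j - η 0 / √(p : ℝ) - η i.succ - (y i j - η' 0 / √(p : ℝ) - η' i.succ)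
        = -((η 0 - η' 0) / √(p : ℝ)) - (η i.succ - η' i.succ) := by ring
    rw [e1, e2]
    nlinarith [sq_nonneg ((η 0 - η' 0) / √(p : ℝ) - (η i.succ - η' i.succ))]
  refine (Finset.sum_le_sum fun i _ => Finset.sum_le_sum fun j _ => e i j).trans_eq ?_
  simp only [Finset.sum_const, Finset.card_univ, Fintype.card_fin, nsmul_eq_mul,
    ← Finset.mul_sum, Finset.sum_add_distrib]
  field_simp

variable {b₁ b₂ j₁ j₂ : ℝ}

lemma sq_thetaScale_sub_le (hb₁ : 0 < b₁) (hj₁ : 0 < j₁) (η η' : State p) :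
    (thetaScale b₁ η j₁ - thetaScale b₁ η' j₁) ^ 2 ≤ dist η η' ^ 2 / j₁ := by
  have h1 := effectSq_nonneg η
  have h2 := effectSq_nonneg η'
  unfold thetaScale
  rw [Real.sqrt_div (by positivity), Real.sqrt_div (by positivity), ← sub_div, div_pow,
    Real.sq_sqrt hj₁.le]
  exact div_le_div_of_nonneg_right (sq_sqrt_effect_sub_le hb₁ η η') hj₁.le

/-- The residual vector repeats each effect `r` times, which costs a factor `r`; the `r` in the
denominator of `errorScale` cancels it. -/
lemma sq_errorScale_sub_le (hp : 0 < p) (hr : 0 < r) (hb₂ : 0 < b₂) (hj₂ : 0 < j₂)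
    (η η' : State p) :
    (errorScale y b₂ η j₂ - errorScale y b₂ η' j₂) ^ 2 ≤ 2 * dist η η' ^ 2 / j₂ := by
  have h1 := residualSq_nonneg y η
  have h2 := residualSq_nonneg y η'
  have hr' : (0 : ℝ) < r := by positivity
  unfold errorScale
  rw [Real.sqrt_div (by positivity), Real.sqrt_div (by positivity), ← sub_div, div_pow,
    Real.sq_sqrt (by positivity)]
  have h := sq_sqrt_residual_sub_le y hp hb₂ η η'
  calc _ ≤ 2 * r * dist η η' ^ 2 / (r * j₂) := by gcongr
    _ = _ := by field_simp

lemma thetaScale_pos (hb₁ : 0 < b₁) (hj₁ : 0 < j₁) (η : State p) : 0 < thetaScale b₁ η j₁ := by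
  have h1 := effectSq_nonneg η
  unfold thetaScale; positivity

lemma errorScale_pos (hr : 0 < r) (hb₂ : 0 < b₂) (hj₂ : 0 < j₂) (η : State p) :
    0 < errorScale y b₂ η j₂ := by
  have h1 := residualSq_nonneg y η
  have hr' : (0 : ℝ) < r := by positivity
  unfold errorScale; positivity

lemma le_thetaScale (hj₁ : 0 < j₁) (η : State p) : √(b₁ / j₁) ≤ thetaScale b₁ η j₁ := by
  have h1 := effectSq_nonneg η
  unfold thetaScale
  gcongr
  linarith

lemma sq_thetaScale_le {l₁ : ℝ} (hp : 0 < p) (hB : betweenSq y ≤ l₁ * p) (hb₁ : 0 < b₁)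
    (hj₁ : 0 < j₁) (hl₁ : 0 < l₁) (η : State p) :
    thetaScale b₁ η j₁ ^ 2 ≤ (1 + b₁ + l₁) * (p + energy y η) / j₁ := by
  have h1 := effectSq_nonneg η
  have h2 := energy_nonneg y η
  have hp' : (1 : ℝ) ≤ p := by exact_mod_cast hp
  unfold thetaScale
  rw [Real.sq_sqrt (by positivity)]
  gcongr
  nlinarith [effectSq_le y η]

lemma sq_errorScale_le {l₂ : ℝ} (hp : 0 < p) (hr : 0 < r) (hW : withinSq y ≤ l₂ * (r * p))
    (hb₂ : 0 < b₂) (hj₂ : 0 < j₂) (hl₂ : 0 < l₂) (η : State p) :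
    errorScale y b₂ η j₂ ^ 2 ≤ (1 + b₂ + l₂) * (p + energy y η) / j₂ := by
  have h1 := residualSq_nonneg y η
  have h2 := energy_nonneg y η
  have hp' : (1 : ℝ) ≤ p := by exact_mod_cast hp
  have hr' : (1 : ℝ) ≤ r := by exact_mod_cast hr
  unfold errorScale
  rw [Real.sq_sqrt (by positivity), div_le_div_iff₀ (by positivity) hj₂]
  have h3 := residualSq_le y hp hr η
  have h4 : b₂ + residualSq y η / 2 ≤ (1 + b₂ + l₂) * (p + energy y η) * r := by
    have e : b₂ * 1 ≤ b₂ * (r * p) := by gcongr; nlinarith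
    have e' : 0 ≤ (b₂ + l₂) * energy y η * r := by positivity
    have e'' : 0 ≤ r * (p : ℝ) := by positivity
    have e3 : 0 ≤ l₂ * (r * (p : ℝ)) := by positivity
    nlinarith
  calc (b₂ + residualSq y η / 2) * j₂ ≤ ((1 + b₂ + l₂) * (p + energy y η) * r) * j₂ := by gcongr
    _ = _ := by ring

/-- Substitute `λ_θ = 1/s²` and `r λ_e = 1/t²`. The state then enters only through `(s, t)`, and
every coefficient is homogeneous of degree zero or one. -/
lemma randomMap_eq (hp : 0 < p) (hr : 0 < r) (hb₁ : 0 < b₁) (hb₂ : 0 < b₂) (hj₁ : 0 < j₁)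
    (hj₂ : 0 < j₂) (η : State p) (n₀ : ℝ) (n : Fin p → ℝ) {s t : ℝ}
    (hs : s = thetaScale b₁ η j₁) (ht : t = errorScale y b₂ η j₂) :
    randomMap y b₁ b₂ η (j₁, j₂, n₀, n) = assemble (√(p : ℝ) * grandMean y + √(s ^ 2 + t ^ 2) * n₀,
      fun i => s ^ 2 / (s ^ 2 + t ^ 2) * (groupMean y i - grandMean y)
        - s ^ 2 / √(s ^ 2 + t ^ 2) * (n₀ / √(p : ℝ)) + s * t / √(s ^ 2 + t ^ 2) * n i) := by
  have h1 := effectSq_nonneg η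
  have h2 := residualSq_nonneg y η
  have hr' : (0 : ℝ) < r := by positivity
  have hp' : (0 : ℝ) < p := by positivity
  have hs0 : 0 < s := hs ▸ thetaScale_pos hb₁ hj₁ η
  have ht0 : 0 < t := ht ▸ errorScale_pos y hr hb₂ hj₂ η
  have hlθ : j₁ / (b₁ + effectSq η / 2) = 1 / s ^ 2 := by
    rw [hs, thetaScale, Real.sq_sqrt (by positivity), one_div_div]
  have hle : j₂ / (b₂ + residualSq y η / 2) = 1 / (r * t ^ 2) := by
    rw [ht, errorScale, Real.sq_sqrt (by positivity)]
    field_simp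
  have hH : 0 < s ^ 2 + t ^ 2 := by positivity
  have hh : 0 < √(s ^ 2 + t ^ 2) := by positivity
  have hsq := Real.sq_sqrt hH.le
  have e1 : (1 / s ^ 2 + r * (1 / (r * t ^ 2))) / (r * (1 / (r * t ^ 2)) * (1 / s ^ 2))
      = s ^ 2 + t ^ 2 := by field_simp; ring
  have e2 : 1 / (1 / s ^ 2 + r * (1 / (r * t ^ 2))) = (s * t) ^ 2 / (s ^ 2 + t ^ 2) := by
    field_simp; ring
  have hx : newIntercept y (1 / s ^ 2) (1 / (r * t ^ 2)) n₀
      = √(p : ℝ) * grandMean y + √(s ^ 2 + t ^ 2) * n₀ := by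
    rw [newIntercept, e1]
  have hE : newEffects y (1 / s ^ 2) (1 / (r * t ^ 2))
      (newIntercept y (1 / s ^ 2) (1 / (r * t ^ 2)) n₀) n
      = fun i => s ^ 2 / (s ^ 2 + t ^ 2) * (groupMean y i - grandMean y)
        - s ^ 2 / √(s ^ 2 + t ^ 2) * (n₀ / √(p : ℝ)) + s * t / √(s ^ 2 + t ^ 2) * n i := by
    funext i
    rw [newEffects, e2, hx, Real.sqrt_div (by positivity), Real.sqrt_sq (by positivity)]
    congr 1
    have hsp : √(p : ℝ) ≠ 0 := by positivity
    have e3 : s ^ 2 / √(s ^ 2 + t ^ 2) = s ^ 2 * √(s ^ 2 + t ^ 2) / (s ^ 2 + t ^ 2) := by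
      rw [← hsq, Real.sqrt_sq hh.le]; field_simp
    rw [e3]
    generalize √(s ^ 2 + t ^ 2) = h at *
    field_simp
    ring
  simp only [randomMap]
  rw [hlθ, hle, hE, hx]

end Deterministic

end RandomEffects

/-! ### Bounds for one step with the noise fixed -/

namespace RandomEffects

section Pointwise

variable {p r : ℕ} (y : Fin p → Fin r → ℝ) {b₁ b₂ j₁ j₂ : ℝ}

lemma sq_sub_add_le (a b c : ℝ) : (a - b + c) ^ 2 ≤ 3 * (a ^ 2 + b ^ 2 + c ^ 2) := by
  nlinarith [sq_nonneg (a + b), sq_nonneg (a - c), sq_nonneg (b + c)]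

lemma sum_sq_combination_le (hp : 0 < p) (a b c n₀ : ℝ) (n : Fin p → ℝ) :
    ∑ i, (a * (groupMean y i - grandMean y) - b * (n₀ / √(p : ℝ)) + c * n i) ^ 2
      ≤ 3 * (a ^ 2 * betweenSq y + b ^ 2 * n₀ ^ 2 + c ^ 2 * ∑ i, n i ^ 2) := by
  have hp' : (0 : ℝ) < p := by positivity
  refine (Finset.sum_le_sum fun i _ => sq_sub_add_le _ _ _).trans_eq ?_
  rw [← Finset.mul_sum]
  simp only [mul_pow, Finset.sum_add_distrib, ← Finset.mul_sum, div_pow, Real.sq_sqrt hp'.le,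
    Finset.sum_const, Finset.card_univ, Fintype.card_fin, nsmul_eq_mul, betweenSq]
  field_simp

/-- Both copies use the same noise, so only coefficients differ. The constant is `56 = 2 + 3 * 18`:
the intercept contributes `2` and its effect on the other coordinates `3 * 18`. -/
lemma dist_randomMap_sq_le (hp : 0 < p) (hr : 0 < r) (hb₁ : 0 < b₁) (hb₂ : 0 < b₂)
    (hj₁ : 0 < j₁) (hj₂ : 0 < j₂) (η η' : State p) (n₀ : ℝ) (n : Fin p → ℝ) {s t s' t' : ℝ}
    (hs : s = thetaScale b₁ η j₁) (ht : t = errorScale y b₂ η j₂)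
    (hs' : s' = thetaScale b₁ η' j₁) (ht' : t' = errorScale y b₂ η' j₂) :
    dist (randomMap y b₁ b₂ η (j₁, j₂, n₀, n)) (randomMap y b₁ b₂ η' (j₁, j₂, n₀, n)) ^ 2
      ≤ 56 * ((s - s') ^ 2 + (t - t') ^ 2) * n₀ ^ 2
        + 3 * ((s ^ 2 / (s ^ 2 + t ^ 2) - s' ^ 2 / (s' ^ 2 + t' ^ 2)) ^ 2 * betweenSq y
          + (s * t / √(s ^ 2 + t ^ 2) - s' * t' / √(s' ^ 2 + t' ^ 2)) ^ 2 * ∑ i, n i ^ 2) := by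
  have hs0 : 0 < s := hs ▸ thetaScale_pos hb₁ hj₁ η
  have ht0 : 0 < t := ht ▸ errorScale_pos y hr hb₂ hj₂ η
  have hs0' : 0 < s' := hs' ▸ thetaScale_pos hb₁ hj₁ η'
  have ht0' : 0 < t' := ht' ▸ errorScale_pos y hr hb₂ hj₂ η'
  rw [randomMap_eq y hp hr hb₁ hb₂ hj₁ hj₂ η n₀ n hs ht,
    randomMap_eq y hp hr hb₁ hb₂ hj₁ hj₂ η' n₀ n hs' ht', state_dist_sq]
  simp only [assemble_zero, assemble_succ]
  have h1 := sum_sq_combination_le y hp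
    (s ^ 2 / (s ^ 2 + t ^ 2) - s' ^ 2 / (s' ^ 2 + t' ^ 2))
    (s ^ 2 / √(s ^ 2 + t ^ 2) - s' ^ 2 / √(s' ^ 2 + t' ^ 2))
    (s * t / √(s ^ 2 + t ^ 2) - s' * t' / √(s' ^ 2 + t' ^ 2)) n₀ n
  have h2 : (s ^ 2 / √(s ^ 2 + t ^ 2) - s' ^ 2 / √(s' ^ 2 + t' ^ 2)) ^ 2 * n₀ ^ 2
      ≤ 18 * ((s - s') ^ 2 + (t - t') ^ 2) * n₀ ^ 2 := by
    gcongr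
    exact sq_weighted_sub_le hs0 ht0 hs0' ht0'
  have h3 : (√(s ^ 2 + t ^ 2) - √(s' ^ 2 + t' ^ 2)) ^ 2 * n₀ ^ 2
      ≤ 2 * ((s - s') ^ 2 + (t - t') ^ 2) * n₀ ^ 2 := by
    gcongr
    exact sq_sqrt_add_sq_sub_le s t s' t'
  have e1 : (√(p : ℝ) * grandMean y + √(s ^ 2 + t ^ 2) * n₀
      - (√(p : ℝ) * grandMean y + √(s' ^ 2 + t' ^ 2) * n₀)) ^ 2
      = (√(s ^ 2 + t ^ 2) - √(s' ^ 2 + t' ^ 2)) ^ 2 * n₀ ^ 2 := by ring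
  have e2 : ∀ a a' b b' c c' : ℝ, ∀ i, (a * (groupMean y i - grandMean y) - b * (n₀ / √(p : ℝ))
      + c * n i - (a' * (groupMean y i - grandMean y) - b' * (n₀ / √(p : ℝ)) + c' * n i)) ^ 2
      = ((a - a') * (groupMean y i - grandMean y) - (b - b') * (n₀ / √(p : ℝ))
        + (c - c') * n i) ^ 2 := fun a a' b b' c c' i => by ring
  simp only [e1, e2]
  linarith

variable {A U W : ℝ}

/-- Valid with a constant independent of the pair. The prior rate `b₁ > 0` keeps `s` above
`√(b₁/j₁)`, which controls the shrinkage factor. -/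
lemma dist_randomMap_sq_le_global (hp : 0 < p) (hr : 0 < r) (hb₁ : 0 < b₁) (hb₂ : 0 < b₂)
    (hj₁ : 0 < j₁) (hj₂ : 0 < j₂) (η η' : State p) (n₀ : ℝ) (n : Fin p → ℝ)
    (hA : betweenSq y ≤ A) :
    dist (randomMap y b₁ b₂ η (j₁, j₂, n₀, n)) (randomMap y b₁ b₂ η' (j₁, j₂, n₀, n)) ^ 2
      ≤ dist η η' ^ 2 * (56 * ((j₁⁻¹ + 2 * j₂⁻¹) * n₀ ^ 2) + 96 * A / b₁ * (1 + 2 * (j₁ * j₂⁻¹))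
        + 24 * ((j₁⁻¹ + 2 * j₂⁻¹) * ∑ i, n i ^ 2)) := by
  have h := dist_randomMap_sq_le y hp hr hb₁ hb₂ hj₁ hj₂ η η' n₀ n rfl rfl rfl rfl
  have hs0 := thetaScale_pos hb₁ hj₁ η
  have ht0 := errorScale_pos y hr hb₂ hj₂ η
  have hs0' := thetaScale_pos hb₁ hj₁ η'
  have ht0' := errorScale_pos y hr hb₂ hj₂ η'
  have hm := le_thetaScale (b₁ := b₁) hj₁ η
  have hm0 : 0 < √(b₁ / j₁) := by positivity
  have hmsq := Real.sq_sqrt (by positivity : 0 ≤ b₁ / j₁)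
  have hds := sq_thetaScale_sub_le hb₁ hj₁ η η'
  have hdt := sq_errorScale_sub_le y hp hr hb₂ hj₂ η η'
  have hN : 0 ≤ ∑ i, n i ^ 2 := Finset.sum_nonneg fun _ _ => sq_nonneg _
  have hB := sq_shrinkage_sub_le hm0 hm ht0 hs0' ht0'
  have hg := sq_geometric_sub_le hs0 ht0 hs0' ht0' (k := 1)
    ((div_le_one (by positivity)).2 (Real.le_sqrt_of_sq_le (by nlinarith)))
  rw [hmsq] at hB
  have hA0 := (betweenSq_nonneg y).trans hA
  refine h.trans ?_
  set s := thetaScale b₁ η j₁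
  set t := errorScale y b₂ η j₂
  set s' := thetaScale b₁ η' j₁
  set t' := errorScale y b₂ η' j₂
  set D := dist η η' ^ 2
  have hE : (s - s') ^ 2 + (t - t') ^ 2 ≤ D * (j₁⁻¹ + 2 * j₂⁻¹) := by
    calc _ ≤ D / j₁ + 2 * D / j₂ := add_le_add hds hdt
      _ = _ := by ring
  have hB' : (s ^ 2 / (s ^ 2 + t ^ 2) - s' ^ 2 / (s' ^ 2 + t' ^ 2)) ^ 2
      ≤ 32 * D / b₁ * (1 + 2 * (j₁ * j₂⁻¹)) := by
    refine hB.trans ?_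
    calc 32 * ((s - s') ^ 2 + (t - t') ^ 2) / (b₁ / j₁)
        ≤ 32 * (D * (j₁⁻¹ + 2 * j₂⁻¹)) / (b₁ / j₁) := by gcongr
      _ = _ := by field_simp
  have hg' : (s * t / √(s ^ 2 + t ^ 2) - s' * t' / √(s' ^ 2 + t' ^ 2)) ^ 2
      ≤ 8 * (D * (j₁⁻¹ + 2 * j₂⁻¹)) := by
    refine hg.trans ?_
    rw [one_pow, one_mul]
    gcongr
  calc _ ≤ 56 * (D * (j₁⁻¹ + 2 * j₂⁻¹)) * n₀ ^ 2
        + 3 * (32 * D / b₁ * (1 + 2 * (j₁ * j₂⁻¹)) * A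
          + 8 * (D * (j₁⁻¹ + 2 * j₂⁻¹)) * ∑ i, n i ^ 2) := by
        gcongr
        exact betweenSq_nonneg y
    _ = _ := by ring

/-- Here an upper bound `W/j₂` for `t²` and `t'²` is combined with the lower bound `b₁/j₁` for `s²`.
Every term, apart from the one with the single normal `n₀`, then carries a power of `j₂⁻¹`, and `j₂`
is of order `r p`. -/
lemma dist_randomMap_sq_le_local (hp : 0 < p) (hr : 0 < r) (hb₁ : 0 < b₁) (hb₂ : 0 < b₂)
    (hj₁ : 0 < j₁) (hj₂ : 0 < j₂) (η η' : State p) (n₀ : ℝ) (n : Fin p → ℝ)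
    (hA : betweenSq y ≤ A) (hW : errorScale y b₂ η j₂ ^ 2 ≤ W / j₂)
    (hW' : errorScale y b₂ η' j₂ ^ 2 ≤ W / j₂) :
    dist (randomMap y b₁ b₂ η (j₁, j₂, n₀, n)) (randomMap y b₁ b₂ η' (j₁, j₂, n₀, n)) ^ 2
      ≤ dist η η' ^ 2 * (56 * ((j₁⁻¹ + 2 * j₂⁻¹) * n₀ ^ 2)
        + 3 * A * (32 * W ^ 2 / b₁ ^ 3 + 16 * W / b₁ ^ 2) * (j₁ ^ 2 * j₂⁻¹ ^ 2)
        + 24 * (W / b₁ + 2) * (j₂⁻¹ * ∑ i, n i ^ 2)) := by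
  have h := dist_randomMap_sq_le y hp hr hb₁ hb₂ hj₁ hj₂ η η' n₀ n rfl rfl rfl rfl
  have hs0 := thetaScale_pos hb₁ hj₁ η
  have ht0 := errorScale_pos y hr hb₂ hj₂ η
  have hs0' := thetaScale_pos hb₁ hj₁ η'
  have ht0' := errorScale_pos y hr hb₂ hj₂ η'
  have hm := le_thetaScale (b₁ := b₁) hj₁ η
  have hm' := le_thetaScale (b₁ := b₁) hj₁ η'
  have hm0 : 0 < √(b₁ / j₁) := by positivity
  have hmsq := Real.sq_sqrt (by positivity : 0 ≤ b₁ / j₁)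
  have hds := sq_thetaScale_sub_le hb₁ hj₁ η η'
  have hdt := sq_errorScale_sub_le y hp hr hb₂ hj₂ η η'
  have hN : 0 ≤ ∑ i, n i ^ 2 := Finset.sum_nonneg fun _ _ => sq_nonneg _
  have hA0 := (betweenSq_nonneg y).trans hA
  refine h.trans ?_
  set s := thetaScale b₁ η j₁
  set t := errorScale y b₂ η j₂
  set s' := thetaScale b₁ η' j₁
  set t' := errorScale y b₂ η' j₂
  set D := dist η η' ^ 2
  have hB := sq_shrinkage_sub_le_of_scale hm0 hm ht0 hm' ht0'
  have hk : t / √(s ^ 2 + t ^ 2) ≤ t / √(b₁ / j₁) := by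
    exact div_le_div_of_nonneg_left ht0.le hm0
      (hm.trans (Real.le_sqrt_of_sq_le (le_add_of_nonneg_right (sq_nonneg t))))
  have hg := sq_geometric_sub_le hs0 ht0 hs0' ht0' hk
  have hW0 : 0 ≤ W := by
    have := mul_nonneg ((sq_nonneg _).trans hW) hj₂.le
    rwa [div_mul_cancel₀ _ hj₂.ne'] at this
  set m := √(b₁ / j₁)
  have hT : (t + t') ^ 2 ≤ 4 * (W / j₂) := by nlinarith [sq_nonneg (t - t')]
  have hE : (s - s') ^ 2 + (t - t') ^ 2 ≤ D * (j₁⁻¹ + 2 * j₂⁻¹) := by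
    calc _ ≤ D / j₁ + 2 * D / j₂ := add_le_add hds hdt
      _ = _ := by ring
  have hB' : (s ^ 2 / (s ^ 2 + t ^ 2) - s' ^ 2 / (s' ^ 2 + t' ^ 2)) ^ 2
      ≤ D * (32 * W ^ 2 / b₁ ^ 3 + 16 * W / b₁ ^ 2) * (j₁ ^ 2 * j₂⁻¹ ^ 2) := by
    refine hB.trans ?_
    have e6 : m ^ 6 = (b₁ / j₁) ^ 3 := by rw [← hmsq]; ring
    have e4 : m ^ 4 = (b₁ / j₁) ^ 2 := by rw [← hmsq]; ring
    have e : (t + t') ^ 4 = ((t + t') ^ 2) ^ 2 := by ring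
    rw [e6, e4, e]
    calc 2 * (s - s') ^ 2 * ((t + t') ^ 2) ^ 2 / (b₁ / j₁) ^ 3
          + 2 * (t - t') ^ 2 * (t + t') ^ 2 / (b₁ / j₁) ^ 2
        ≤ 2 * (D / j₁) * (4 * (W / j₂)) ^ 2 / (b₁ / j₁) ^ 3
          + 2 * (2 * D / j₂) * (4 * (W / j₂)) / (b₁ / j₁) ^ 2 := by gcongr
      _ = _ := by field_simp; ring
  have hg' : (s * t / √(s ^ 2 + t ^ 2) - s' * t' / √(s' ^ 2 + t' ^ 2)) ^ 2
      ≤ 8 * D * (W / b₁ + 2) * j₂⁻¹ := by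
    refine hg.trans ?_
    rw [div_pow, hmsq]
    calc 8 * (t ^ 2 / (b₁ / j₁) * (s - s') ^ 2 + (t - t') ^ 2)
        ≤ 8 * ((W / j₂) / (b₁ / j₁) * (D / j₁) + 2 * D / j₂) := by gcongr
      _ = _ := by field_simp
  calc _ ≤ 56 * (D * (j₁⁻¹ + 2 * j₂⁻¹)) * n₀ ^ 2
        + 3 * (D * (32 * W ^ 2 / b₁ ^ 3 + 16 * W / b₁ ^ 2) * (j₁ ^ 2 * j₂⁻¹ ^ 2) * A
          + 8 * D * (W / b₁ + 2) * j₂⁻¹ * ∑ i, n i ^ 2) := by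
        gcongr
        exact betweenSq_nonneg y
    _ = _ := by ring

/-- Relative to the centre, the large scale `s` multiplies only the single normal `n₀`; the `p`
normals of the effects are multiplied by at most `t`. Hence the old energy returns divided by a
quantity of order `p`. -/
lemma energy_randomMap_sq_le (hp : 0 < p) (hr : 0 < r) (hb₁ : 0 < b₁) (hb₂ : 0 < b₂)
    (hj₁ : 0 < j₁) (hj₂ : 0 < j₂) (η : State p) (n₀ : ℝ) (n : Fin p → ℝ)
    (hA : betweenSq y ≤ A) (hU : thetaScale b₁ η j₁ ^ 2 ≤ U / j₁)
    (hW : errorScale y b₂ η j₂ ^ 2 ≤ W / j₂) :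
    energy y (randomMap y b₁ b₂ η (j₁, j₂, n₀, n)) ^ 2
      ≤ 27 * A ^ 2 + 96 * ((U ^ 2 * j₁⁻¹ ^ 2 + W ^ 2 * j₂⁻¹ ^ 2) * n₀ ^ 4)
        + 27 * W ^ 2 * (j₂⁻¹ ^ 2 * (∑ i, n i ^ 2) ^ 2) := by
  rw [randomMap_eq y hp hr hb₁ hb₂ hj₁ hj₂ η n₀ n rfl rfl, energy]
  simp only [assemble_zero, assemble_succ]
  have hs0 := thetaScale_pos hb₁ hj₁ η
  have ht0 := errorScale_pos y hr hb₂ hj₂ η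
  have hN : 0 ≤ ∑ i, n i ^ 2 := Finset.sum_nonneg fun _ _ => sq_nonneg _
  have hA0 := (betweenSq_nonneg y).trans hA
  set s := thetaScale b₁ η j₁
  set t := errorScale y b₂ η j₂
  have hH : 0 < s ^ 2 + t ^ 2 := by positivity
  have hsq := Real.sq_sqrt hH.le
  have h1 := sum_sq_combination_le y hp (s ^ 2 / (s ^ 2 + t ^ 2) - 1)
    (s ^ 2 / √(s ^ 2 + t ^ 2)) (s * t / √(s ^ 2 + t ^ 2)) n₀ n
  have hB : (s ^ 2 / (s ^ 2 + t ^ 2) - 1) ^ 2 ≤ 1 := by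
    have e1 : 0 ≤ s ^ 2 / (s ^ 2 + t ^ 2) := by positivity
    have e2 : s ^ 2 / (s ^ 2 + t ^ 2) ≤ 1 := (div_le_one hH).2 (by nlinarith)
    nlinarith
  have hq : (s ^ 2 / √(s ^ 2 + t ^ 2)) ^ 2 ≤ s ^ 2 + t ^ 2 := by
    rw [div_pow, hsq, div_le_iff₀ hH]
    nlinarith [sq_nonneg t, sq_nonneg s, mul_nonneg (sq_nonneg s) (sq_nonneg t),
      sq_nonneg (t ^ 2)]
  have hg : (s * t / √(s ^ 2 + t ^ 2)) ^ 2 ≤ t ^ 2 := by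
    rw [div_pow, hsq, div_le_iff₀ hH]
    nlinarith [sq_nonneg (t ^ 2)]
  have e : ∀ i, (s ^ 2 / (s ^ 2 + t ^ 2) * (groupMean y i - grandMean y)
      - s ^ 2 / √(s ^ 2 + t ^ 2) * (n₀ / √(p : ℝ)) + s * t / √(s ^ 2 + t ^ 2) * n i
      + grandMean y - groupMean y i) ^ 2
      = ((s ^ 2 / (s ^ 2 + t ^ 2) - 1) * (groupMean y i - grandMean y)
      - s ^ 2 / √(s ^ 2 + t ^ 2) * (n₀ / √(p : ℝ)) + s * t / √(s ^ 2 + t ^ 2) * n i) ^ 2 :=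
    fun i => by ring
  have e' : (√(p : ℝ) * grandMean y + √(s ^ 2 + t ^ 2) * n₀ - √(p : ℝ) * grandMean y) ^ 2
      = (s ^ 2 + t ^ 2) * n₀ ^ 2 := by
    rw [add_sub_cancel_left, mul_pow, hsq]
  simp only [e, e']
  set Y := ∑ i, ((s ^ 2 / (s ^ 2 + t ^ 2) - 1) * (groupMean y i - grandMean y)
      - s ^ 2 / √(s ^ 2 + t ^ 2) * (n₀ / √(p : ℝ)) + s * t / √(s ^ 2 + t ^ 2) * n i) ^ 2
  have hY0 : 0 ≤ Y := Finset.sum_nonneg fun _ _ => sq_nonneg _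
  have h2 : Y + (s ^ 2 + t ^ 2) * n₀ ^ 2
      ≤ 3 * A + 4 * ((U / j₁ + W / j₂) * n₀ ^ 2) + 3 * (W / j₂ * ∑ i, n i ^ 2) := by
    calc Y + (s ^ 2 + t ^ 2) * n₀ ^ 2
        ≤ 3 * (1 * A + (s ^ 2 + t ^ 2) * n₀ ^ 2 + t ^ 2 * ∑ i, n i ^ 2)
          + (s ^ 2 + t ^ 2) * n₀ ^ 2 := by
          gcongr
          refine h1.trans ?_
          gcongr
          exact betweenSq_nonneg y
      _ = 3 * A + 4 * ((s ^ 2 + t ^ 2) * n₀ ^ 2) + 3 * (t ^ 2 * ∑ i, n i ^ 2) := by ring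
      _ ≤ _ := by gcongr
  have h3 : ∀ a b c : ℝ, (a + b + c) ^ 2 ≤ 3 * (a ^ 2 + b ^ 2 + c ^ 2) := fun a b c => by
    nlinarith [sq_nonneg (a - b), sq_nonneg (a - c), sq_nonneg (b - c)]
  have h4 : (U / j₁ + W / j₂) ^ 2 ≤ 2 * (U ^ 2 * j₁⁻¹ ^ 2 + W ^ 2 * j₂⁻¹ ^ 2) := by
    have := sq_nonneg (U / j₁ - W / j₂)
    calc (U / j₁ + W / j₂) ^ 2 ≤ 2 * ((U / j₁) ^ 2 + (W / j₂) ^ 2) := by nlinarith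
      _ = _ := by rw [div_eq_mul_inv, div_eq_mul_inv]; ring
  calc (Y + (s ^ 2 + t ^ 2) * n₀ ^ 2) ^ 2
      ≤ (3 * A + 4 * ((U / j₁ + W / j₂) * n₀ ^ 2) + 3 * (W / j₂ * ∑ i, n i ^ 2)) ^ 2 := by
        gcongr
    _ ≤ 3 * ((3 * A) ^ 2 + (4 * ((U / j₁ + W / j₂) * n₀ ^ 2)) ^ 2
        + (3 * (W / j₂ * ∑ i, n i ^ 2)) ^ 2) := h3 _ _ _
    _ = 27 * A ^ 2 + 48 * ((U / j₁ + W / j₂) ^ 2 * n₀ ^ 4)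
        + 27 * W ^ 2 * (j₂⁻¹ ^ 2 * (∑ i, n i ^ 2) ^ 2) := by
        rw [div_eq_mul_inv W]; ring
    _ ≤ 27 * A ^ 2 + 48 * ((2 * (U ^ 2 * j₁⁻¹ ^ 2 + W ^ 2 * j₂⁻¹ ^ 2)) * n₀ ^ 4)
        + 27 * W ^ 2 * (j₂⁻¹ ^ 2 * (∑ i, n i ^ 2) ^ 2) := by
        gcongr
    _ = _ := by ring

end Pointwise

end RandomEffects

/-! ### Averaging the one-step bounds over the noise -/

namespace RandomEffects

variable {p r : ℕ} {a₁ a₂ : ℝ}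

lemma meanLE_noiseLaw_mul {f₁ f₂ f₃ : ℝ → ℝ} {f₄ : (Fin p → ℝ) → ℝ} {c₁ c₂ c₃ c₄ : ℝ}
    (h₁ : MeanLE (gammaMeasure ((p : ℝ) / 2 + a₁) 1) f₁ c₁)
    (h₂ : MeanLE (gammaMeasure ((r : ℝ) * p / 2 + a₂) 1) f₂ c₂)
    (h₃ : MeanLE (gaussianReal 0 1) f₃ c₃)
    (h₄ : MeanLE (Measure.pi fun _ : Fin p => gaussianReal 0 1) f₄ c₄)
    (m₁ : Measurable f₁) (m₂ : Measurable f₂) (m₃ : Measurable f₃) (m₄ : Measurable f₄)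
    (n₁ : ∀ x, 0 < x → 0 ≤ f₁ x) (n₂ : ∀ x, 0 < x → 0 ≤ f₂ x) (n₃ : ∀ x, 0 ≤ f₃ x)
    (d₁ : 0 ≤ c₁) (d₂ : 0 ≤ c₂) (d₃ : 0 ≤ c₃) (ha₂ : 0 < a₂) :
    MeanLE (noiseLaw p r a₁ a₂)
      (fun ω => f₁ ω.1 * (f₂ ω.2.1 * (f₃ ω.2.2.1 * f₄ ω.2.2.2))) (c₁ * (c₂ * (c₃ * c₄))) := by
  have : IsProbabilityMeasure (gammaMeasure ((r : ℝ) * p / 2 + a₂) 1) :=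
    isProbabilityMeasure_gammaMeasure (by positivity) one_pos
  exact h₁.prod_mul (h₂.prod_mul (h₃.prod_mul h₄ m₃ m₄ (ae_of_all _ n₃) d₃) m₂ (by fun_prop)
    ((gammaMeasure_ae_pos _ _).mono n₂) d₂) m₁ (by fun_prop)
    ((gammaMeasure_ae_pos _ _).mono n₁) d₁

lemma noiseLaw_ae_pos (ha₂ : 0 < a₂) : ∀ᵐ ω ∂noiseLaw p r a₁ a₂, 0 < ω.1 ∧ 0 < ω.2.1 := by
  have : IsProbabilityMeasure (gammaMeasure ((r : ℝ) * p / 2 + a₂) 1) :=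
    isProbabilityMeasure_gammaMeasure (by positivity) one_pos
  have h1 : ∀ᵐ ω ∂noiseLaw p r a₁ a₂, 0 < ω.1 :=
    Measure.quasiMeasurePreserving_fst.ae (gammaMeasure_ae_pos _ _)
  have h2 : ∀ᵐ ω ∂noiseLaw p r a₁ a₂, 0 < ω.2.1 :=
    Measure.quasiMeasurePreserving_snd.ae
      (Measure.quasiMeasurePreserving_fst.ae (gammaMeasure_ae_pos _ _))
  exact h1.and h2

section Moments

variable (y : Fin p → Fin r → ℝ) {b₁ b₂ A U W : ℝ}

/-- Bounds for the moments of the two gamma variables. -/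
structure GammaBounds (p r : ℕ) (a₁ a₂ k₁ k₂ K : ℝ) : Prop where
  pos₁ : 0 ≤ k₁
  pos₂ : 0 ≤ k₂
  posK : 0 ≤ K
  inv₁ : MeanLE (gammaMeasure ((p : ℝ) / 2 + a₁) 1) (fun x => x⁻¹) k₁
  invSq₁ : MeanLE (gammaMeasure ((p : ℝ) / 2 + a₁) 1) (fun x => x⁻¹ ^ 2) (k₁ ^ 2)
  self₁ : MeanLE (gammaMeasure ((p : ℝ) / 2 + a₁) 1) (fun x => x) K
  sq₁ : MeanLE (gammaMeasure ((p : ℝ) / 2 + a₁) 1) (fun x => x ^ 2) (K ^ 2)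
  inv₂ : MeanLE (gammaMeasure ((r : ℝ) * p / 2 + a₂) 1) (fun x => x⁻¹) k₂
  invSq₂ : MeanLE (gammaMeasure ((r : ℝ) * p / 2 + a₂) 1) (fun x => x⁻¹ ^ 2) (k₂ ^ 2)

/-- The inverse second moment needs `p/4 ≤ p/2 + a₁ - 2`, which `p ≥ 8` ensures; likewise with `r p`
in place of `p`. -/
lemma gammaBounds (hp : 8 ≤ p) (hr : 0 < r) (ha₁ : 0 < a₁) (ha₂ : 0 < a₂) :
    GammaBounds p r a₁ a₂ (4 / p) (4 / (r * p)) ((1 + a₁) * p) := by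
  have hp' : (8 : ℝ) ≤ p := by exact_mod_cast hp
  have hr' : (1 : ℝ) ≤ r := by exact_mod_cast hr
  have hrp : (8 : ℝ) ≤ r * p := by nlinarith
  have e : ∀ x : ℝ, 4 / x = (x / 4)⁻¹ := fun x => by rw [inv_div]
  refine ⟨by positivity, by positivity, by positivity, ?_, ?_, ?_, ?_, ?_, ?_⟩
  · rw [e]; exact meanLE_gammaMeasure_inv (by positivity) (by linarith)
  · rw [e]; exact meanLE_gammaMeasure_inv_sq (by positivity) (by linarith)
  · exact (meanLE_gammaMeasure_self (by positivity)).mono (fun _ => le_rfl) (by nlinarith)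
  · exact (meanLE_gammaMeasure_sq (by positivity)).mono (fun _ => le_rfl) (by gcongr; nlinarith)
  · rw [e]; exact meanLE_gammaMeasure_inv (by positivity) (by linarith)
  · rw [e]; exact meanLE_gammaMeasure_inv_sq (by positivity) (by linarith)

variable {k₁ k₂ K : ℝ}

lemma meanLE_dist_global (hp : 0 < p) (hr : 0 < r) (ha₁ : 0 < a₁) (hb₁ : 0 < b₁) (ha₂ : 0 < a₂)
    (hb₂ : 0 < b₂) (hG : GammaBounds p r a₁ a₂ k₁ k₂ K) (hA : betweenSq y ≤ A)
    (η η' : State p) :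
    MeanLE (noiseLaw p r a₁ a₂)
      (fun ω => dist (randomMap y b₁ b₂ η ω) (randomMap y b₁ b₂ η' ω) ^ 2)
      (dist η η' ^ 2 * (56 * ((k₁ + 2 * k₂) * 101) + 96 * A / b₁ * (1 + 2 * (K * k₂))
        + 24 * ((k₁ + 2 * k₂) * (101 * p)))) := by
  have hA0 := (betweenSq_nonneg y).trans hA
  obtain ⟨g1, g2, gK, i1, q1, s1, r1, i2, q2⟩ := hG
  have hprob := isProbabilityMeasure_noiseLaw (p := p) (r := r) ha₁ ha₂
  have : IsProbabilityMeasure (gammaMeasure ((p : ℝ) / 2 + a₁) 1) :=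
    isProbabilityMeasure_gammaMeasure (by positivity) one_pos
  have : IsProbabilityMeasure (gammaMeasure ((r : ℝ) * p / 2 + a₂) 1) :=
    isProbabilityMeasure_gammaMeasure (by positivity) one_pos
  have inv0 : ∀ x : ℝ, 0 < x → 0 ≤ x⁻¹ := fun x hx => (inv_pos.2 hx).le
  have one0 : ∀ x : ℝ, 0 < x → (0 : ℝ) ≤ 1 := fun x _ => zero_le_one
  have t1 := meanLE_noiseLaw_mul (p := p) (r := r) (a₁ := a₁) (a₂ := a₂) i1 (.const 1)
    meanLE_gaussianReal_sq (.const 1) (by fun_prop) (by fun_prop) (by fun_prop) (by fun_prop)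
    inv0 one0 (fun x => sq_nonneg x) g1 zero_le_one (by norm_num) ha₂
  have t2 := meanLE_noiseLaw_mul (p := p) (r := r) (a₁ := a₁) (a₂ := a₂) (.const 1) i2
    meanLE_gaussianReal_sq (.const 1) (by fun_prop) (by fun_prop) (by fun_prop) (by fun_prop)
    one0 inv0 (fun x => sq_nonneg x) zero_le_one g2 (by norm_num) ha₂
  have t3 := meanLE_noiseLaw_mul (p := p) (r := r) (a₁ := a₁) (a₂ := a₂) s1 i2
    (.const 1) (.const 1) (by fun_prop) (by fun_prop) (by fun_prop) (by fun_prop)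
    (fun x hx => hx.le) inv0 (fun x => zero_le_one) gK g2 zero_le_one ha₂
  have t4 := meanLE_noiseLaw_mul (p := p) (r := r) (a₁ := a₁) (a₂ := a₂) i1 (.const 1)
    (.const 1) (meanLE_pi_sum_sq p) (by fun_prop) (by fun_prop) (by fun_prop) (by fun_prop)
    inv0 one0 (fun x => zero_le_one) g1 zero_le_one zero_le_one ha₂
  have t5 := meanLE_noiseLaw_mul (p := p) (r := r) (a₁ := a₁) (a₂ := a₂) (.const 1) i2
    (.const 1) (meanLE_pi_sum_sq p) (by fun_prop) (by fun_prop) (by fun_prop) (by fun_prop)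
    one0 inv0 (fun x => zero_le_one) zero_le_one g2 zero_le_one ha₂
  have h1 := (t1.add (t2.const_mul (k := 2) (by norm_num)) (by positivity) (by positivity)
    (by fun_prop)).const_mul (k := 56) (by norm_num)
  have h2 := ((MeanLE.const 1).add (t3.const_mul (k := 2) (by norm_num)) (by positivity)
    (by positivity) (by fun_prop)).const_mul (k := 96 * A / b₁) (by positivity)
  have h3 := (t4.add (t5.const_mul (k := 2) (by norm_num)) (by positivity) (by positivity)
    (by fun_prop)).const_mul (k := 24) (by norm_num)
  have h := (((h1.add h2 (by positivity) (by positivity) (by fun_prop)).add h3 (by positivity)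
    (by positivity) (by fun_prop)).const_mul (sq_nonneg (dist η η')))
  refine h.mono_ae ((noiseLaw_ae_pos ha₂).mono fun ω hω => ?_) (le_of_eq (by ring))
  obtain ⟨j₁, j₂, n₀, n⟩ := ω
  refine (dist_randomMap_sq_le_global y hp hr hb₁ hb₂ hω.1 hω.2 η η' n₀ n hA).trans_eq ?_
  simp only
  ring

lemma meanLE_dist_local (hp : 0 < p) (hr : 0 < r) (ha₁ : 0 < a₁) (hb₁ : 0 < b₁) (ha₂ : 0 < a₂)
    (hb₂ : 0 < b₂) (hG : GammaBounds p r a₁ a₂ k₁ k₂ K) (hA : betweenSq y ≤ A)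
    (η η' : State p) (hW0 : 0 ≤ W) (hW : ∀ j, 0 < j → errorScale y b₂ η j ^ 2 ≤ W / j)
    (hW' : ∀ j, 0 < j → errorScale y b₂ η' j ^ 2 ≤ W / j) :
    MeanLE (noiseLaw p r a₁ a₂)
      (fun ω => dist (randomMap y b₁ b₂ η ω) (randomMap y b₁ b₂ η' ω) ^ 2)
      (dist η η' ^ 2 * (56 * ((k₁ + 2 * k₂) * 101)
        + 3 * A * (32 * W ^ 2 / b₁ ^ 3 + 16 * W / b₁ ^ 2) * (K ^ 2 * k₂ ^ 2)
        + 24 * (W / b₁ + 2) * (k₂ * (101 * p)))) := by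
  have hA0 := (betweenSq_nonneg y).trans hA
  obtain ⟨g1, g2, gK, i1, q1, s1, r1, i2, q2⟩ := hG
  have hprob := isProbabilityMeasure_noiseLaw (p := p) (r := r) ha₁ ha₂
  have : IsProbabilityMeasure (gammaMeasure ((p : ℝ) / 2 + a₁) 1) :=
    isProbabilityMeasure_gammaMeasure (by positivity) one_pos
  have : IsProbabilityMeasure (gammaMeasure ((r : ℝ) * p / 2 + a₂) 1) :=
    isProbabilityMeasure_gammaMeasure (by positivity) one_pos
  have inv0 : ∀ x : ℝ, 0 < x → 0 ≤ x⁻¹ := fun x hx => (inv_pos.2 hx).le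
  have one0 : ∀ x : ℝ, 0 < x → (0 : ℝ) ≤ 1 := fun x _ => zero_le_one
  have t1 := meanLE_noiseLaw_mul (p := p) (r := r) (a₁ := a₁) (a₂ := a₂) i1 (.const 1)
    meanLE_gaussianReal_sq (.const 1) (by fun_prop) (by fun_prop) (by fun_prop) (by fun_prop)
    inv0 one0 (fun x => sq_nonneg x) g1 zero_le_one (by norm_num) ha₂
  have t2 := meanLE_noiseLaw_mul (p := p) (r := r) (a₁ := a₁) (a₂ := a₂) (.const 1) i2
    meanLE_gaussianReal_sq (.const 1) (by fun_prop) (by fun_prop) (by fun_prop) (by fun_prop)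
    one0 inv0 (fun x => sq_nonneg x) zero_le_one g2 (by norm_num) ha₂
  have t3 := meanLE_noiseLaw_mul (p := p) (r := r) (a₁ := a₁) (a₂ := a₂) r1 q2
    (.const 1) (.const 1) (by fun_prop) (by fun_prop) (by fun_prop) (by fun_prop)
    (fun x hx => sq_nonneg x) (fun x hx => sq_nonneg _) (fun x => zero_le_one) (sq_nonneg K)
    (sq_nonneg _) zero_le_one ha₂
  have t5 := meanLE_noiseLaw_mul (p := p) (r := r) (a₁ := a₁) (a₂ := a₂) (.const 1) i2
    (.const 1) (meanLE_pi_sum_sq p) (by fun_prop) (by fun_prop) (by fun_prop) (by fun_prop)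
    one0 inv0 (fun x => zero_le_one) zero_le_one g2 zero_le_one ha₂
  have h1 := (t1.add (t2.const_mul (k := 2) (by norm_num)) (by positivity) (by positivity)
    (by fun_prop)).const_mul (k := 56) (by norm_num)
  have h2 := t3.const_mul (k := 3 * A * (32 * W ^ 2 / b₁ ^ 3 + 16 * W / b₁ ^ 2)) (by positivity)
  have h3 := t5.const_mul (k := 24 * (W / b₁ + 2)) (by positivity)
  have h := (((h1.add h2 (by positivity) (by positivity) (by fun_prop)).add h3 (by positivity)
    (by positivity) (by fun_prop)).const_mul (sq_nonneg (dist η η')))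
  refine h.mono_ae ((noiseLaw_ae_pos ha₂).mono fun ω hω => ?_) (le_of_eq (by ring))
  obtain ⟨j₁, j₂, n₀, n⟩ := ω
  refine (dist_randomMap_sq_le_local y hp hr hb₁ hb₂ hω.1 hω.2 η η' n₀ n hA (hW _ hω.2)
    (hW' _ hω.2)).trans_eq ?_
  simp only
  ring

lemma meanLE_energy_sq (hp : 0 < p) (hr : 0 < r) (ha₁ : 0 < a₁) (hb₁ : 0 < b₁) (ha₂ : 0 < a₂)
    (hb₂ : 0 < b₂) (hG : GammaBounds p r a₁ a₂ k₁ k₂ K) (hA : betweenSq y ≤ A)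
    (η : State p) (hU : ∀ j, 0 < j → thetaScale b₁ η j ^ 2 ≤ U / j)
    (hW : ∀ j, 0 < j → errorScale y b₂ η j ^ 2 ≤ W / j) :
    MeanLE (noiseLaw p r a₁ a₂) (fun ω => energy y (randomMap y b₁ b₂ η ω) ^ 2)
      (27 * A ^ 2 + 96 * ((U ^ 2 * k₁ ^ 2 + W ^ 2 * k₂ ^ 2) * 100)
        + 27 * W ^ 2 * (k₂ ^ 2 * (100 * p ^ 2))) := by
  have hA0 := (betweenSq_nonneg y).trans hA
  obtain ⟨g1, g2, gK, i1, q1, s1, r1, i2, q2⟩ := hG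
  have hprob := isProbabilityMeasure_noiseLaw (p := p) (r := r) ha₁ ha₂
  have : IsProbabilityMeasure (gammaMeasure ((p : ℝ) / 2 + a₁) 1) :=
    isProbabilityMeasure_gammaMeasure (by positivity) one_pos
  have : IsProbabilityMeasure (gammaMeasure ((r : ℝ) * p / 2 + a₂) 1) :=
    isProbabilityMeasure_gammaMeasure (by positivity) one_pos
  have sq0 : ∀ x : ℝ, 0 < x → 0 ≤ x⁻¹ ^ 2 := fun x hx => sq_nonneg _
  have one0 : ∀ x : ℝ, 0 < x → (0 : ℝ) ≤ 1 := fun x _ => zero_le_one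
  have four0 : ∀ x : ℝ, 0 ≤ x ^ 4 := fun x => by positivity
  have t1 := meanLE_noiseLaw_mul (p := p) (r := r) (a₁ := a₁) (a₂ := a₂) q1 (.const 1)
    meanLE_gaussianReal_pow_four (.const 1) (by fun_prop) (by fun_prop) (by fun_prop)
    (by fun_prop) sq0 one0 four0 (sq_nonneg _) zero_le_one (by norm_num) ha₂
  have t2 := meanLE_noiseLaw_mul (p := p) (r := r) (a₁ := a₁) (a₂ := a₂) (.const 1) q2
    meanLE_gaussianReal_pow_four (.const 1) (by fun_prop) (by fun_prop) (by fun_prop)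
    (by fun_prop) one0 sq0 four0 zero_le_one (sq_nonneg _) (by norm_num) ha₂
  have t3 := meanLE_noiseLaw_mul (p := p) (r := r) (a₁ := a₁) (a₂ := a₂) (.const 1) q2
    (.const 1) (meanLE_pi_sum_sq_sq p) (by fun_prop) (by fun_prop) (by fun_prop) (by fun_prop)
    one0 sq0 (fun x => zero_le_one) zero_le_one (sq_nonneg _) zero_le_one ha₂
  have h1 := ((t1.const_mul (sq_nonneg U)).add (t2.const_mul (sq_nonneg W)) (by positivity)
    (by positivity) (by fun_prop)).const_mul (k := 96) (by norm_num)
  have h2 := t3.const_mul (k := 27 * W ^ 2) (by positivity)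
  have h := ((MeanLE.const (27 * A ^ 2)).add h1 (by positivity) (by positivity)
    (by fun_prop)).add h2 (by positivity) (by positivity) (by fun_prop)
  refine h.mono_ae ((noiseLaw_ae_pos ha₂).mono fun ω hω => ?_) (le_of_eq (by ring))
  obtain ⟨j₁, j₂, n₀, n⟩ := ω
  refine (energy_randomMap_sq_le y hp hr hb₁ hb₂ hω.1 hω.2 η n₀ n hA (hU _ hω.1)
    (hW _ hω.2)).trans_eq ?_
  simp only
  ring

end Moments

end RandomEffects

/-! ### Dependence of the constants on the numbers of groups and of replicates -/

namespace RandomEffects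

/-- The quantity which governs the local contraction of the chain. -/
noncomputable def smallness (p r : ℕ) : ℝ := 1 / p + p / r + (p : ℝ) ^ 3 / (r : ℝ) ^ 2

lemma smallness_nonneg (p r : ℕ) : 0 ≤ smallness p r := by unfold smallness; positivity

section Constants

variable {a₁ b₁ a₂ b₂ l₁ l₂ : ℝ}

/-- A constant for the second moment bounds below. -/
noncomputable def momentConst (a₁ b₁ b₂ l₁ l₂ : ℝ) : ℝ :=
  1 + (56 * 101 * 12 + 96 * l₁ / b₁ * (1 + 8 * (1 + a₁)) + 24 * 12 * 101)
    + (48 * l₁ * (1 + a₁) ^ 2 * (32 * (1 + b₂ + l₂) ^ 2 / b₁ ^ 3 + 16 * (1 + b₂ + l₂) / b₁ ^ 2)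
      + 24 * 404 * ((1 + b₂ + l₂) / b₁ + 2))
    + (27 * l₁ ^ 2 + 9600 * 16 * ((1 + b₁ + l₁) ^ 2 + (1 + b₂ + l₂) ^ 2)
      + 2700 * 16 * (1 + b₂ + l₂) ^ 2)

/-- The shrinkage term is of order `P`, through the between-group sum of squares `l₁ * P`; the two
noise terms stay bounded. -/
lemma global_const_le {P R : ℝ} (hP : 8 ≤ P) (hPR : P ≤ R) (ha₁ : 0 < a₁) (hb₁ : 0 < b₁)
    (hb₂ : 0 < b₂) (hl₁ : 0 < l₁) (hl₂ : 0 < l₂) :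
    56 * ((4 / P + 2 * (4 / (R * P))) * 101)
      + 96 * (l₁ * P) / b₁ * (1 + 2 * ((1 + a₁) * P * (4 / (R * P))))
      + 24 * ((4 / P + 2 * (4 / (R * P))) * (101 * P)) ≤ momentConst a₁ b₁ b₂ l₁ l₂ * P := by
  have hP0 : 0 < P := by linarith
  have hR0 : 0 < R := by linarith
  have h1 : 4 / P + 2 * (4 / (R * P)) ≤ 12 / P := by
    rw [show 12 / P = 4 / P + 2 * (4 / (1 * P)) by ring]
    gcongr; linarith
  have h2 : (1 + a₁) * P * (4 / (R * P)) ≤ 4 * (1 + a₁) := by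
    rw [show (1 + a₁) * P * (4 / (R * P)) = 4 * (1 + a₁) / R by field_simp]
    exact div_le_self (by positivity) (by linarith)
  calc _ ≤ 56 * (12 / P * 101) + 96 * (l₁ * P) / b₁ * (1 + 2 * (4 * (1 + a₁)))
        + 24 * (12 / P * (101 * P)) := by gcongr
    _ = 56 * 101 * 12 * (1 / P) + 96 * l₁ / b₁ * (1 + 8 * (1 + a₁)) * P + 24 * 12 * 101 * 1 := by
        field_simp; ring
    _ ≤ 56 * 101 * 12 * P + 96 * l₁ / b₁ * (1 + 8 * (1 + a₁)) * P + 24 * 12 * 101 * P := by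
        gcongr
        · rw [div_le_iff₀ hP0]; nlinarith
        · linarith
    _ = (56 * 101 * 12 + 96 * l₁ / b₁ * (1 + 8 * (1 + a₁)) + 24 * 12 * 101) * P := by ring
    _ ≤ _ := by
        unfold momentConst
        refine mul_le_mul_of_nonneg_right ?_ hP0.le
        have : 0 ≤ 48 * l₁ * (1 + a₁) ^ 2
          * (32 * (1 + b₂ + l₂) ^ 2 / b₁ ^ 3 + 16 * (1 + b₂ + l₂) / b₁ ^ 2)
          + 24 * 404 * ((1 + b₂ + l₂) / b₁ + 2) := by positivity
        have : 0 ≤ 27 * l₁ ^ 2 + 9600 * 16 * ((1 + b₁ + l₁) ^ 2 + (1 + b₂ + l₂) ^ 2)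
          + 2700 * 16 * (1 + b₂ + l₂) ^ 2 := by positivity
        linarith

/-- This is where the three terms of `smallness` arise: `1/P` from the intercept noise, `P³/R²` from
the shrinkage factor (`P` from the between-group sum of squares, `P² z²` from the squared bound on
`t²`, `1/R²` from the gamma moments), and `P/R` from the noise of the effects. -/
lemma local_const_le {P R z : ℝ} (hP : 8 ≤ P) (hPR : P ≤ R) (hz : 1 ≤ z) (ha₁ : 0 < a₁)
    (hb₁ : 0 < b₁) (hb₂ : 0 < b₂) (hl₁ : 0 < l₁) (hl₂ : 0 < l₂) :
    56 * ((4 / P + 2 * (4 / (R * P))) * 101)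
      + 3 * (l₁ * P) * (32 * ((1 + b₂ + l₂) * (P * z)) ^ 2 / b₁ ^ 3
        + 16 * ((1 + b₂ + l₂) * (P * z)) / b₁ ^ 2) * (((1 + a₁) * P) ^ 2 * (4 / (R * P)) ^ 2)
      + 24 * ((1 + b₂ + l₂) * (P * z) / b₁ + 2) * (4 / (R * P) * (101 * P))
      ≤ momentConst a₁ b₁ b₂ l₁ l₂ * (z ^ 2 * (1 / P + P / R + P ^ 3 / R ^ 2)) := by
  have hP0 : 0 < P := by linarith
  have hR0 : 0 < R := by linarith
  have hz0 : 0 < z := by linarith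
  have h1 : 4 / P + 2 * (4 / (R * P)) ≤ 12 / P := by
    rw [show 12 / P = 4 / P + 2 * (4 / (1 * P)) by ring]
    gcongr; linarith
  have hPz : 1 ≤ P * z := by nlinarith
  have hz2 : 1 ≤ z ^ 2 := by nlinarith
  have hzz : z ≤ z ^ 2 := by nlinarith
  set c := 1 + b₂ + l₂ with hc
  have hc0 : 0 < c := by positivity
  have e1 : 56 * ((4 / P + 2 * (4 / (R * P))) * 101) ≤ 56 * 101 * 12 * (z ^ 2 * (1 / P)) := by
    calc _ ≤ 56 * (12 / P * 101) := by gcongr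
      _ = 56 * 101 * 12 * (1 * (1 / P)) := by ring
      _ ≤ _ := by gcongr
  have e2 : 3 * (l₁ * P) * (32 * (c * (P * z)) ^ 2 / b₁ ^ 3 + 16 * (c * (P * z)) / b₁ ^ 2)
      * (((1 + a₁) * P) ^ 2 * (4 / (R * P)) ^ 2)
      ≤ 48 * l₁ * (1 + a₁) ^ 2 * (32 * c ^ 2 / b₁ ^ 3 + 16 * c / b₁ ^ 2)
        * (z ^ 2 * (P ^ 3 / R ^ 2)) := by
    calc _ ≤ 3 * (l₁ * P) * (32 * (c * (P * z)) ^ 2 / b₁ ^ 3 + 16 * (c * (P * z) ^ 2) / b₁ ^ 2)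
          * (((1 + a₁) * P) ^ 2 * (4 / (R * P)) ^ 2) := by
          gcongr
          nlinarith
      _ = _ := by field_simp; ring
  have e3 : 24 * (c * (P * z) / b₁ + 2) * (4 / (R * P) * (101 * P))
      ≤ 24 * 404 * (c / b₁ + 2) * (z ^ 2 * (P / R)) := by
    calc _ = 24 * (c * (P * z) / b₁ + 2 * 1) * (404 / R) := by field_simp; norm_num
      _ ≤ 24 * (c * (P * z ^ 2) / b₁ + 2 * (P * z ^ 2)) * (404 / R) := by gcongr; nlinarith
      _ = _ := by field_simp
  have f1 : 0 ≤ z ^ 2 * (1 / P) := by positivity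
  have f2 : 0 ≤ z ^ 2 * (P ^ 3 / R ^ 2) := by positivity
  have f3 : 0 ≤ z ^ 2 * (P / R) := by positivity
  have g1 : 0 ≤ 96 * l₁ / b₁ * (1 + 8 * (1 + a₁)) := by positivity
  have g2 : 0 ≤ 48 * l₁ * (1 + a₁) ^ 2 * (32 * c ^ 2 / b₁ ^ 3 + 16 * c / b₁ ^ 2) := by positivity
  have g3 : 0 ≤ 24 * 404 * (c / b₁ + 2) := by positivity
  have g4 : 0 ≤ 27 * l₁ ^ 2 + 9600 * 16 * ((1 + b₁ + l₁) ^ 2 + c ^ 2)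
          + 2700 * 16 * c ^ 2 := by positivity
  unfold momentConst
  rw [← hc]
  set G2 := 48 * l₁ * (1 + a₁) ^ 2 * (32 * c ^ 2 / b₁ ^ 3 + 16 * c / b₁ ^ 2)
  set G3 := 24 * 404 * (c / b₁ + 2)
  set G1 := 96 * l₁ / b₁ * (1 + 8 * (1 + a₁))
  set G4 := 27 * l₁ ^ 2 + 9600 * 16 * ((1 + b₁ + l₁) ^ 2 + c ^ 2) + 2700 * 16 * c ^ 2
  calc _ ≤ 56 * 101 * 12 * (z ^ 2 * (1 / P)) + G2 * (z ^ 2 * (P ^ 3 / R ^ 2))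
        + G3 * (z ^ 2 * (P / R)) := add_le_add (add_le_add e1 e2) e3
    _ ≤ (1 + (56 * 101 * 12 + G1 + 24 * 12 * 101) + (G2 + G3) + G4) * (z ^ 2 * (1 / P))
        + (1 + (56 * 101 * 12 + G1 + 24 * 12 * 101) + (G2 + G3) + G4) * (z ^ 2 * (P ^ 3 / R ^ 2))
        + (1 + (56 * 101 * 12 + G1 + 24 * 12 * 101) + (G2 + G3) + G4) * (z ^ 2 * (P / R)) := by
        gcongr <;> linarith
    _ = _ := by ring

/-- `Y` stands for `p + V`. The noise of the `P` effects enters with weight `P * 4/(R P) = 4/R`, and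
`P ≤ R` turns this into the same gain `1/P` as for the intercept. -/
lemma energy_const_le {P R Y : ℝ} (hP : 8 ≤ P) (hPR : P ≤ R) (hY : 0 ≤ Y) (ha₁ : 0 < a₁)
    (hb₁ : 0 < b₁) (hb₂ : 0 < b₂) (hl₁ : 0 < l₁) (hl₂ : 0 < l₂) :
    27 * (l₁ * P) ^ 2 + 96 * ((((1 + b₁ + l₁) * Y) ^ 2 * (4 / P) ^ 2
      + ((1 + b₂ + l₂) * Y) ^ 2 * (4 / (R * P)) ^ 2) * 100)
      + 27 * ((1 + b₂ + l₂) * Y) ^ 2 * ((4 / (R * P)) ^ 2 * (100 * P ^ 2))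
      ≤ momentConst a₁ b₁ b₂ l₁ l₂ * (P + Y / P) ^ 2 := by
  have hP0 : 0 < P := by linarith
  have hR0 : 0 < R := by linarith
  set c := 1 + b₂ + l₂ with hc
  have hc0 : 0 < c := by positivity
  set c' := 1 + b₁ + l₁ with hc'
  have h1 : 4 / (R * P) ≤ 4 / P := by
    rw [show 4 / P = 4 / (1 * P) by ring]
    gcongr; linarith
  have h2 : 4 / (R * P) ≤ 4 / (P * P) := by gcongr
  have h3 : P ^ 2 ≤ (P + Y / P) ^ 2 := by gcongr; exact le_add_of_nonneg_right (by positivity)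
  have h4 : (Y / P) ^ 2 ≤ (P + Y / P) ^ 2 := by gcongr; exact le_add_of_nonneg_left (by positivity)
  calc _ ≤ 27 * (l₁ * P) ^ 2 + 96 * (((c' * Y) ^ 2 * (4 / P) ^ 2
      + (c * Y) ^ 2 * (4 / P) ^ 2) * 100)
      + 27 * (c * Y) ^ 2 * ((4 / (P * P)) ^ 2 * (100 * P ^ 2)) := by gcongr
    _ = 27 * l₁ ^ 2 * P ^ 2 + 9600 * 16 * (c' ^ 2 + c ^ 2) * (Y / P) ^ 2
        + 2700 * 16 * c ^ 2 * (Y / P) ^ 2 := by field_simp; ring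
    _ ≤ 27 * l₁ ^ 2 * (P + Y / P) ^ 2 + 9600 * 16 * (c' ^ 2 + c ^ 2) * (P + Y / P) ^ 2
        + 2700 * 16 * c ^ 2 * (P + Y / P) ^ 2 := by gcongr
    _ = (27 * l₁ ^ 2 + 9600 * 16 * (c' ^ 2 + c ^ 2) + 2700 * 16 * c ^ 2) * (P + Y / P) ^ 2 := by
        ring
    _ ≤ _ := by
        unfold momentConst
        rw [← hc, ← hc']
        refine mul_le_mul_of_nonneg_right ?_ (sq_nonneg _)
        have : 0 ≤ 96 * l₁ / b₁ * (1 + 8 * (1 + a₁)) := by positivity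
        have : 0 ≤ 48 * l₁ * (1 + a₁) ^ 2 * (32 * c ^ 2 / b₁ ^ 3 + 16 * c / b₁ ^ 2)
          + 24 * 404 * (c / b₁ + 2) := by positivity
        linarith

lemma one_le_momentConst (ha₁ : 0 < a₁) (hb₁ : 0 < b₁) (hb₂ : 0 < b₂) (hl₁ : 0 < l₁)
    (hl₂ : 0 < l₂) : 1 ≤ momentConst a₁ b₁ b₂ l₁ l₂ := by
  unfold momentConst
  simp only [add_assoc]
  exact le_add_of_nonneg_right (by positivity)

end Constants

/-! ### Contraction of the weighted, truncated distance -/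

section Contraction

variable {p r : ℕ} (y : Fin p → Fin r → ℝ) {a₁ b₁ a₂ b₂ l₁ l₂ : ℝ}

/-- The weight `1 + (V(η) + V(η')) / p`. -/
noncomputable def pairWeight (η η' : State p) : ℝ := 1 + (energy y η + energy y η') / p

/-- The cost function contracted by the chain: the minimum of a weighted distance and of
`p + V(η) + V(η')`. -/
noncomputable def cost (η η' : State p) : ℝ :=
  min (dist η η' * pairWeight y η η') (p * pairWeight y η η')

lemma one_le_pairWeight (η η' : State p) : 1 ≤ pairWeight y η η' :=
  le_add_of_nonneg_right
    (div_nonneg (add_nonneg (energy_nonneg y η) (energy_nonneg y η')) p.cast_nonneg)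

lemma mul_pairWeight (hp : 0 < p) (η η' : State p) :
    p * pairWeight y η η' = p + energy y η + energy y η' := by
  have hp' : (0 : ℝ) < p := by positivity
  unfold pairWeight
  field_simp
  ring

lemma measurable_pairWeight {Ω : Type*} [MeasurableSpace Ω] {f g : Ω → State p}
    (hf : Measurable f) (hg : Measurable g) : Measurable fun ω => pairWeight y (f ω) (g ω) := by
  have h1 : Measurable fun ω => energy y (f ω) := (measurable_energy y).comp hf
  have h2 : Measurable fun ω => energy y (g ω) := (measurable_energy y).comp hg
  unfold pairWeight
  fun_prop

lemma cost_le_dist_mul (η η' : State p) : cost y η η' ≤ dist η η' * pairWeight y η η' :=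
  min_le_left _ _

lemma cost_le_mul (η η' : State p) : cost y η η' ≤ p * pairWeight y η η' :=
  min_le_right _ _

lemma measurable_cost : Measurable fun z : State p × State p => cost y z.1 z.2 := by
  have h := measurable_pairWeight y (measurable_fst (α := State p) (β := State p)) measurable_snd
  unfold cost
  exact (measurable_dist.mul h).min (h.const_mul _)

/-- Distant pairs have large energy: `dist² ≤ 2 (V + V') ≤ (p + V + V')²` as soon as `p ≥ 2`, so the
truncation never falls below the distance. -/
lemma dist_le_cost (hp : 2 ≤ p) (η η' : State p) : dist η η' ≤ cost y η η' := by
  have hp' : (2 : ℝ) ≤ p := by exact_mod_cast hp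
  have hz := one_le_pairWeight y η η'
  refine le_min (le_mul_of_one_le_right dist_nonneg hz) ?_
  have h := dist_sq_le_energy y η η'
  have e := mul_pairWeight y (by omega) η η'
  refine abs_le_of_sq_le_sq' ?_ (by positivity) |>.2
  nlinarith [energy_nonneg y η, energy_nonneg y η']

variable (hp : 8 ≤ p) (hpr : p ≤ r) (ha₁ : 0 < a₁) (hb₁ : 0 < b₁) (ha₂ : 0 < a₂)
  (hb₂ : 0 < b₂) (hl₁ : 0 < l₁) (hl₂ : 0 < l₂) (hA : betweenSq y ≤ l₁ * p)
  (hW : withinSq y ≤ l₂ * (r * p))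
include hp hpr ha₁ hb₁ ha₂ hb₂ hl₁ hl₂ hA hW

lemma energy_moment (η : State p) :
    MeanLE (noiseLaw p r a₁ a₂) (fun ω => energy y (randomMap y b₁ b₂ η ω) ^ 2)
      ((√(momentConst a₁ b₁ b₂ l₁ l₂) * (p + (p + energy y η) / p)) ^ 2) := by
  have hP : (8 : ℝ) ≤ p := by exact_mod_cast hp
  have hPR : (p : ℝ) ≤ r := by exact_mod_cast hpr
  have hc := one_le_momentConst ha₁ hb₁ hb₂ hl₁ hl₂
  refine (meanLE_energy_sq y (by omega) (by omega) ha₁ hb₁ ha₂ hb₂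
    (gammaBounds hp (by omega) ha₁ ha₂) hA η
    (fun j hj => sq_thetaScale_le y (by omega) hA hb₁ hj hl₁ η)
    (fun j hj => sq_errorScale_le y (by omega) (by omega) hW hb₂ hj hl₂ η)).mono
    (fun _ => le_rfl) ?_
  rw [mul_pow √(momentConst a₁ b₁ b₂ l₁ l₂), Real.sq_sqrt (by linarith)]
  exact energy_const_le hP hPR (by have := energy_nonneg y η; positivity) ha₁ hb₁ hb₂ hl₁ hl₂

lemma energy_drift (η : State p) :
    MeanLE (noiseLaw p r a₁ a₂) (fun ω => energy y (randomMap y b₁ b₂ η ω))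
      (√(momentConst a₁ b₁ b₂ l₁ l₂) * (p + (p + energy y η) / p)) := by
  have hprob := isProbabilityMeasure_noiseLaw (p := p) (r := r) ha₁ ha₂
  have hm : Measurable fun ω => energy y (randomMap y b₁ b₂ η ω) :=
    (measurable_energy y).comp ((measurable_randomMap y b₁ b₂).comp measurable_prodMk_left)
  have h := (energy_moment y hp hpr ha₁ hb₁ ha₂ hb₂ hl₁ hl₂ hA hW η).cauchy
    (g := fun _ => 1) (b := 1) (by simpa using MeanLE.const 1) hm measurable_const
    (fun _ => energy_nonneg y _) (fun _ => zero_le_one)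
    (by have := energy_nonneg y η; positivity) zero_le_one
  simpa using h

omit hW in
lemma dist_moment_global (η η' : State p) :
    MeanLE (noiseLaw p r a₁ a₂)
      (fun ω => dist (randomMap y b₁ b₂ η ω) (randomMap y b₁ b₂ η' ω) ^ 2)
      ((√(momentConst a₁ b₁ b₂ l₁ l₂) * (dist η η' * √(p : ℝ))) ^ 2) := by
  have hP : (8 : ℝ) ≤ p := by exact_mod_cast hp
  have hPR : (p : ℝ) ≤ r := by exact_mod_cast hpr
  have hc := one_le_momentConst ha₁ hb₁ hb₂ hl₁ hl₂
  refine (meanLE_dist_global y (by omega) (by omega) ha₁ hb₁ ha₂ hb₂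
    (gammaBounds hp (by omega) ha₁ ha₂) hA η η').mono (fun _ => le_rfl) ?_
  have e : (√(momentConst a₁ b₁ b₂ l₁ l₂) * (dist η η' * √(p : ℝ))) ^ 2
      = dist η η' ^ 2 * (momentConst a₁ b₁ b₂ l₁ l₂ * p) := by
    rw [mul_pow, Real.sq_sqrt (by linarith), mul_pow, Real.sq_sqrt (by linarith)]
    ring
  rw [e]
  refine mul_le_mul_of_nonneg_left ?_ (sq_nonneg _)
  exact global_const_le hP hPR ha₁ hb₁ hb₂ hl₁ hl₂

lemma dist_moment_local (η η' : State p) :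
    MeanLE (noiseLaw p r a₁ a₂)
      (fun ω => dist (randomMap y b₁ b₂ η ω) (randomMap y b₁ b₂ η' ω) ^ 2)
      ((√(momentConst a₁ b₁ b₂ l₁ l₂)
        * (dist η η' * (pairWeight y η η' * √(smallness p r)))) ^ 2) := by
  have hP : (8 : ℝ) ≤ p := by exact_mod_cast hp
  have hPR : (p : ℝ) ≤ r := by exact_mod_cast hpr
  have hc := one_le_momentConst ha₁ hb₁ hb₂ hl₁ hl₂
  have hz := one_le_pairWeight y η η'
  have e := mul_pairWeight y (by omega) η η'
  have hV := energy_nonneg y η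
  have hV' := energy_nonneg y η'
  refine (meanLE_dist_local y (W := (1 + b₂ + l₂) * (p * pairWeight y η η'))
    (by omega) (by omega) ha₁ hb₁ ha₂ hb₂
    (gammaBounds hp (by omega) ha₁ ha₂) hA η η' (by positivity)
    (fun j hj => (sq_errorScale_le y (by omega) (by omega) hW hb₂ hj hl₂ η).trans ?_)
    (fun j hj => (sq_errorScale_le y (by omega) (by omega) hW hb₂ hj hl₂ η').trans ?_)).mono
    (fun _ => le_rfl) ?_
  · gcongr; linarith
  · gcongr; linarith
  have e1 : (√(momentConst a₁ b₁ b₂ l₁ l₂)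
      * (dist η η' * (pairWeight y η η' * √(smallness p r)))) ^ 2
      = dist η η' ^ 2 * (momentConst a₁ b₁ b₂ l₁ l₂
        * (pairWeight y η η' ^ 2 * smallness p r)) := by
    rw [mul_pow, Real.sq_sqrt (by linarith), mul_pow, mul_pow,
      Real.sq_sqrt (smallness_nonneg p r)]
    ring
  rw [e1]
  refine mul_le_mul_of_nonneg_left ?_ (sq_nonneg _)
  exact local_const_le hP hPR hz ha₁ hb₁ hb₂ hl₁ hl₂

/-- With `u`, `v` the two new energies over `p`, `(1 + u + v)² ≤ 3 (1 + u² + v²)`. Each of `u²` and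
`v²` has mean at most `x²` for `x = √C (1 + z/p) ≥ 1`, and `3 (1 + 2x²) ≤ 9x²`. -/
lemma pairWeight_moment (η η' : State p) :
    MeanLE (noiseLaw p r a₁ a₂)
      (fun ω => pairWeight y (randomMap y b₁ b₂ η ω) (randomMap y b₁ b₂ η' ω) ^ 2)
      ((3 * √(momentConst a₁ b₁ b₂ l₁ l₂) * (1 + pairWeight y η η' / p)) ^ 2) := by
  have hP : (8 : ℝ) ≤ p := by exact_mod_cast hp
  have hc := one_le_momentConst ha₁ hb₁ hb₂ hl₁ hl₂
  have hz := one_le_pairWeight y η η'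
  have e := mul_pairWeight y (by omega) η η'
  have hV := energy_nonneg y η
  have hV' := energy_nonneg y η'
  have hprob := isProbabilityMeasure_noiseLaw (p := p) (r := r) ha₁ ha₂
  have hm : ∀ η, Measurable fun ω => energy y (randomMap y b₁ b₂ η ω) := fun η =>
    (measurable_energy y).comp ((measurable_randomMap y b₁ b₂).comp measurable_prodMk_left)
  have hC : 1 ≤ √(momentConst a₁ b₁ b₂ l₁ l₂) := Real.one_le_sqrt.2 hc
  have h1 := energy_moment y hp hpr ha₁ hb₁ ha₂ hb₂ hl₁ hl₂ hA hW η
  have h2 := energy_moment y hp hpr ha₁ hb₁ ha₂ hb₂ hl₁ hl₂ hA hW η'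
  set c := √(momentConst a₁ b₁ b₂ l₁ l₂)
  set z := pairWeight y η η'
  have hb : ∀ v : ℝ, 0 ≤ v → p + v ≤ p * z →
      (c * (p + (p + v) / p)) ^ 2 ≤ (c * (p * (1 + z / p))) ^ 2 := by
    intro v hv hvz
    have : (p + v) / p ≤ z := by rw [div_le_iff₀ (by positivity)]; linarith
    have e : (p : ℝ) * (1 + z / p) = p + z := by field_simp
    rw [e]
    gcongr
  have h := ((MeanLE.const (μ := noiseLaw p r a₁ a₂) 1).add
    (((h1.mono (fun _ => le_rfl) (hb _ hV (by linarith))).add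
      (h2.mono (fun _ => le_rfl) (hb _ hV' (by linarith))) (by positivity) (by positivity)
        ((hm η).pow_const 2)).const_mul (k := ((p : ℝ) ^ 2)⁻¹) (by positivity)) (by positivity)
        (by positivity) (by fun_prop)).const_mul (k := 3) (by norm_num)
  refine h.mono (fun ω => ?_) ?_
  · unfold pairWeight
    set v := energy y (randomMap y b₁ b₂ η ω)
    set v' := energy y (randomMap y b₁ b₂ η' ω)
    have e1 : ((p : ℝ) ^ 2)⁻¹ * (v ^ 2 + v' ^ 2) = (v / p) ^ 2 + (v' / p) ^ 2 := by
      field_simp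
    rw [e1, add_div]
    nlinarith [sq_nonneg (1 - v / p), sq_nonneg (1 - v' / p), sq_nonneg (v / p - v' / p)]
  · have e1 : ((p : ℝ) ^ 2)⁻¹ * ((c * (p * (1 + z / p))) ^ 2 + (c * (p * (1 + z / p))) ^ 2)
        = 2 * (c * (1 + z / p)) ^ 2 := by field_simp; ring
    rw [e1, mul_assoc, mul_pow]
    have h3 : 1 ≤ c * (1 + z / p) := by
      have : 0 ≤ z / p := by positivity
      nlinarith
    nlinarith

lemma cost_moment_le_dist (η η' : State p) :
    MeanLE (noiseLaw p r a₁ a₂)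
      (fun ω => cost y (randomMap y b₁ b₂ η ω) (randomMap y b₁ b₂ η' ω))
      (12 * momentConst a₁ b₁ b₂ l₁ l₂ * (√(smallness p r) + 1 / √(p : ℝ))
        * (dist η η' * pairWeight y η η')) := by
  have hP : (8 : ℝ) ≤ p := by exact_mod_cast hp
  have hc := one_le_momentConst ha₁ hb₁ hb₂ hl₁ hl₂
  have hz := one_le_pairWeight y η η'
  have hprob := isProbabilityMeasure_noiseLaw (p := p) (r := r) ha₁ ha₂
  have hF : ∀ η, Measurable (randomMap y b₁ b₂ η) := fun η =>
    (measurable_randomMap y b₁ b₂).comp measurable_prodMk_left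
  have hmd : Measurable fun ω => dist (randomMap y b₁ b₂ η ω) (randomMap y b₁ b₂ η' ω) :=
    (hF η).dist (hF η')
  have hmz : Measurable fun ω =>
      pairWeight y (randomMap y b₁ b₂ η ω) (randomMap y b₁ b₂ η' ω) :=
    measurable_pairWeight y (hF η) (hF η')
  have hCsq := Real.sq_sqrt (by linarith : 0 ≤ momentConst a₁ b₁ b₂ l₁ l₂)
  have hzm := pairWeight_moment y hp hpr ha₁ hb₁ ha₂ hb₂ hl₁ hl₂ hA hW η η'
  have hg := dist_moment_global y hp hpr ha₁ hb₁ ha₂ hb₂ hl₁ hl₂ hA η η'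
  have hl := dist_moment_local y hp hpr ha₁ hb₁ ha₂ hb₂ hl₁ hl₂ hA hW η η'
  have hz0 : ∀ ω, 0 ≤ pairWeight y (randomMap y b₁ b₂ η ω) (randomMap y b₁ b₂ η' ω) :=
    fun ω => zero_le_one.trans (one_le_pairWeight y _ _)
  have hg' := hg.cauchy hzm hmd hmz (fun _ => dist_nonneg) hz0 (by positivity) (by positivity)
  have hl' := hl.cauchy hzm hmd hmz (fun _ => dist_nonneg) hz0 (by positivity) (by positivity)
  clear hg hl hzm
  have hsp : 0 < √(p : ℝ) := by positivity
  have hspsq := Real.sq_sqrt (by positivity : (0 : ℝ) ≤ p)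
  have hs := Real.sqrt_nonneg (smallness p r)
  have hC0 : 0 ≤ momentConst a₁ b₁ b₂ l₁ l₂ := by linarith
  have hD0 : 0 ≤ dist η η' := dist_nonneg
  -- For `z ≤ p` the new weight is bounded in mean square and the local bound gives `√κ`. For `z ≥
  -- p` the local bound is useless, but the weight drops to order `z/p`, and this beats the loss
  -- `√p` of the global bound, leaving `1/√p`.
  rcases le_total (pairWeight y η η') p with hzp | hzp
  · refine hl'.mono (fun ω => cost_le_dist_mul y _ _) ?_
    clear hg' hl' hmd hmz hz0 hF hA hW
    have h1 : 1 + pairWeight y η η' / p ≤ 2 := by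
      have := (div_le_one (by positivity : (0 : ℝ) < p)).2 hzp
      linarith
    generalize dist η η' = D, pairWeight y η η' = z, momentConst a₁ b₁ b₂ l₁ l₂ = C at *
    calc √C * (D * (z * √(smallness p r))) * (3 * √C * (1 + z / p))
        ≤ √C * (D * (z * √(smallness p r))) * (3 * √C * 2) := by gcongr
      _ = 6 * √C ^ 2 * √(smallness p r) * (D * z) := by ring
      _ ≤ 12 * C * (√(smallness p r) + 1 / √(p : ℝ)) * (D * z) := by
          rw [hCsq]
          gcongr
          · norm_num
          · exact le_add_of_nonneg_right (by positivity)
  · refine hg'.mono (fun ω => cost_le_dist_mul y _ _) ?_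
    clear hg' hl' hmd hmz hz0 hF hA hW
    have h1 : 1 + pairWeight y η η' / p ≤ 2 * (pairWeight y η η' / p) := by
      have := (one_le_div (by positivity : (0 : ℝ) < p)).2 hzp
      linarith
    generalize dist η η' = D, pairWeight y η η' = z, momentConst a₁ b₁ b₂ l₁ l₂ = C at *
    have e : √(p : ℝ) / p = 1 / √(p : ℝ) := by
      rw [div_eq_div_iff (by positivity) hsp.ne']; linarith
    calc √C * (D * √(p : ℝ)) * (3 * √C * (1 + z / p))
        ≤ √C * (D * √(p : ℝ)) * (3 * √C * (2 * (z / p))) := by gcongr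
      _ = 6 * √C ^ 2 * (√(p : ℝ) / p) * (D * z) := by ring
      _ ≤ 12 * C * (√(smallness p r) + 1 / √(p : ℝ)) * (D * z) := by
          rw [hCsq, e]
          gcongr
          · norm_num
          · exact le_add_of_nonneg_left hs

lemma cost_moment_le_weight (η η' : State p) :
    MeanLE (noiseLaw p r a₁ a₂)
      (fun ω => cost y (randomMap y b₁ b₂ η ω) (randomMap y b₁ b₂ η' ω))
      (3 * √(momentConst a₁ b₁ b₂ l₁ l₂) * (p + pairWeight y η η')) := by
  have hP : (8 : ℝ) ≤ p := by exact_mod_cast hp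
  have hz := one_le_pairWeight y η η'
  have hprob := isProbabilityMeasure_noiseLaw (p := p) (r := r) ha₁ ha₂
  have hF : ∀ η, Measurable (randomMap y b₁ b₂ η) := fun η =>
    (measurable_randomMap y b₁ b₂).comp measurable_prodMk_left
  have hmz : Measurable fun ω =>
      pairWeight y (randomMap y b₁ b₂ η ω) (randomMap y b₁ b₂ η' ω) :=
    measurable_pairWeight y (hF η) (hF η')
  have hz0 : ∀ ω, 0 ≤ pairWeight y (randomMap y b₁ b₂ η ω) (randomMap y b₁ b₂ η' ω) :=
    fun ω => zero_le_one.trans (one_le_pairWeight y _ _)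
  have hzm := pairWeight_moment y hp hpr ha₁ hb₁ ha₂ hb₂ hl₁ hl₂ hA hW η η'
  have hw := ((hzm.cauchy (g := fun _ => 1) (b := 1) (by simpa using MeanLE.const 1) hmz
    measurable_const hz0 (fun _ => zero_le_one) (by positivity) zero_le_one)).const_mul
    (k := (p : ℝ)) (by positivity)
  refine hw.mono (fun ω => ?_) (le_of_eq ?_)
  · rw [mul_one]; exact cost_le_mul y _ _
  · field_simp

/-- One step of the chain contracts the cost in mean. -/
theorem cost_contraction (η η' : State p) :
    MeanLE (noiseLaw p r a₁ a₂)
      (fun ω => cost y (randomMap y b₁ b₂ η ω) (randomMap y b₁ b₂ η' ω))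
      (12 * momentConst a₁ b₁ b₂ l₁ l₂ * (√(smallness p r) + 1 / √(p : ℝ)) * cost y η η') := by
  have h1 := cost_moment_le_dist y hp hpr ha₁ hb₁ ha₂ hb₂ hl₁ hl₂ hA hW η η'
  have h2 := cost_moment_le_weight y hp hpr ha₁ hb₁ ha₂ hb₂ hl₁ hl₂ hA hW η η'
  have hP : (8 : ℝ) ≤ p := by exact_mod_cast hp
  have hc := one_le_momentConst ha₁ hb₁ hb₂ hl₁ hl₂
  have hz := one_le_pairWeight y η η'
  have e := mul_pairWeight y (by omega) η η'
  have hV := energy_nonneg y η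
  have hV' := energy_nonneg y η'
  have hdist := dist_sq_le_energy y η η'
  have hd0 := dist_nonneg (x := η) (y := η')
  -- In the second case the distance is at least `p`, so contraction of the weight alone suffices.
  rcases le_total (dist η η' * pairWeight y η η') (p * pairWeight y η η') with hmin | hmin
  · have hcost : cost y η η' = dist η η' * pairWeight y η η' := min_eq_left hmin
    rw [hcost]
    exact h1
  · have hcost : cost y η η' = p * pairWeight y η η' := min_eq_right hmin
    rw [hcost]
    refine h2.mono (fun _ => le_rfl) ?_
    clear h1 h2 hcost hA hW
    have hC : 1 ≤ √(momentConst a₁ b₁ b₂ l₁ l₂) := Real.one_le_sqrt.2 hc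
    have hCsq := Real.sq_sqrt (by linarith : 0 ≤ momentConst a₁ b₁ b₂ l₁ l₂)
    have hs := Real.sqrt_nonneg (smallness p r)
    have hρ1 : 1 / (p : ℝ) ≤ √(smallness p r) + 1 / √(p : ℝ) := by
      have h1 : √(p : ℝ) ≤ p := by
        rw [Real.sqrt_le_left (by positivity)]; nlinarith
      have : 1 / (p : ℝ) ≤ 1 / √(p : ℝ) := by gcongr
      linarith
    have h0 : (p : ℝ) ≤ dist η η' := le_of_mul_le_mul_right hmin (by linarith)
    generalize dist η η' = D, pairWeight y η η' = z, momentConst a₁ b₁ b₂ l₁ l₂ = C at *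
    -- `p² ≤ dist² ≤ 2 (V + V') = 2 p (z - 1)`. Thus the additive `p` in the weight bound is itself
    -- dominated by `z`, and a factor `1/p` is gained relative to `p z`.
    have h1 : (p : ℝ) ≤ 2 * z := by nlinarith
    calc 3 * √C * (p + z) ≤ 3 * √C * (2 * z + z) := by gcongr
      _ = 9 * √C * z := by ring
      _ ≤ 12 * C * z := by
          gcongr
          · norm_num
          · nlinarith
      _ = 12 * C * (1 / p) * (p * z) := by field_simp
      _ ≤ _ := by gcongr

end Contraction

end RandomEffects

/-! ### Density formulas for product normal and gamma laws -/

section Densities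

lemma measurePreserving_finCons (n : ℕ) :
    MeasurePreserving (fun q : ℝ × (Fin n → ℝ) => (Fin.cons q.1 q.2 : Fin (n + 1) → ℝ)) := by
  have h := (volume_preserving_piFinSuccAbove (fun _ : Fin (n + 1) => ℝ) 0).symm
  have e : (⇑(MeasurableEquiv.piFinSuccAbove (fun _ : Fin (n + 1) => ℝ) 0).symm)
      = fun q : ℝ × (Fin n → ℝ) => (Fin.cons q.1 q.2 : Fin (n + 1) → ℝ) := by
    funext q
    simp [MeasurableEquiv.piFinSuccAbove_symm_apply, Fin.insertNthEquiv]
  rwa [e] at h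

lemma lintegral_pi_prod {n : ℕ} {f : Fin n → ℝ → ℝ≥0∞} (hf : ∀ i, Measurable (f i)) :
    ∫⁻ x : Fin n → ℝ, ∏ i, f i (x i) = ∏ i, ∫⁻ t, f i t := by
  induction n with
  | zero =>
    simp only [Finset.univ_eq_empty, Finset.prod_empty, lintegral_const, one_mul]
    rw [volume_pi, Measure.pi_of_empty _ 0]
    simp
  | succ n ih =>
    have hm : ∀ g : Fin n → ℝ → ℝ≥0∞, (∀ i, Measurable (g i)) →
        Measurable fun x : Fin n → ℝ => ∏ i, g i (x i) := fun g hg =>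
      Finset.measurable_prod _ fun i _ => (hg i).comp (measurable_pi_apply i)
    have hm' : Measurable fun x : Fin (n + 1) → ℝ => ∏ i, f i (x i) :=
      Finset.measurable_prod _ fun i _ => (hf i).comp (measurable_pi_apply i)
    rw [← (measurePreserving_finCons n).lintegral_comp hm', Fin.prod_univ_succ,
      ← ih fun i => hf i.succ]
    simp only [Fin.prod_univ_succ, Fin.cons_zero, Fin.cons_succ]
    exact lintegral_prod_mul (hf 0).aemeasurable
      (hm (fun i => f i.succ) fun i => hf i.succ).aemeasurable

lemma pi_gaussianReal_eq_withDensity {n : ℕ} (m : Fin n → ℝ) {v : ℝ≥0} (hv : v ≠ 0) :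
    Measure.pi (fun i => gaussianReal (m i) v)
      = volume.withDensity fun x => ∏ i, gaussianPDF (m i) v (x i) := by
  refine Measure.pi_eq fun s hs => ?_
  rw [withDensity_apply _ (MeasurableSet.univ_pi hs),
    ← lintegral_indicator (MeasurableSet.univ_pi hs)]
  have e : ∀ x : Fin n → ℝ, (Set.univ.pi s).indicator
      (fun x => ∏ i, gaussianPDF (m i) v (x i)) x
      = ∏ i, (s i).indicator (gaussianPDF (m i) v) (x i) := by
    intro x
    by_cases hx : x ∈ Set.univ.pi s
    · rw [Set.indicator_of_mem hx]
      exact Finset.prod_congr rfl fun i _ =>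
        (Set.indicator_of_mem (hx i (Set.mem_univ i)) _).symm
    · rw [Set.indicator_of_notMem hx]
      simp only [Set.mem_univ_pi, not_forall] at hx
      obtain ⟨i, hi⟩ := hx
      exact (Finset.prod_eq_zero (Finset.mem_univ i) (Set.indicator_of_notMem hi _)).symm
  rw [lintegral_congr e, lintegral_pi_prod fun i => (measurable_gaussianPDF _ _).indicator (hs i)]
  refine Finset.prod_congr rfl fun i _ => ?_
  rw [lintegral_indicator (hs i), gaussianReal_apply _ hv]

lemma lintegral_gammaMeasure (a b : ℝ) {f : ℝ → ℝ≥0∞} (hf : Measurable f) :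
    ∫⁻ x, f x ∂gammaMeasure a b = ∫⁻ x in Set.Ioi 0, gammaPDF a b x * f x := by
  rw [gammaMeasure, lintegral_withDensity_eq_lintegral_mul _ (by unfold gammaPDF; fun_prop) hf]
  simp only [Pi.mul_apply]
  have h : ∀ᵐ x : ℝ, gammaPDF a b x * f x
      = (Set.Ioi 0).indicator (fun x => gammaPDF a b x * f x) x := by
    filter_upwards [Measure.ae_ne volume (0 : ℝ)] with x hx
    rcases lt_or_gt_of_ne hx with h | h
    · rw [gammaPDF_of_neg h, zero_mul, Set.indicator_of_notMem (by simpa using h.le)]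
    · rw [Set.indicator_of_mem (by simpa using h)]
  rw [lintegral_congr_ae h, lintegral_indicator measurableSet_Ioi]

lemma lintegral_rpow_mul_exp_lt_top {s b : ℝ} (hs : 0 < s) (hb : 0 < b) :
    ∫⁻ x in Set.Ioi 0, ENNReal.ofReal (x ^ (s - 1) * Real.exp (-b * x)) < ∞ := by
  have hprob := isProbabilityMeasure_gammaMeasure hs hb
  have hg := Real.Gamma_pos_of_pos hs
  have h1 := lintegral_gammaMeasure s b (f := fun _ => 1) measurable_const
  rw [lintegral_const, measure_univ, one_mul] at h1
  have e : ∀ x ∈ Set.Ioi (0 : ℝ), ENNReal.ofReal (x ^ (s - 1) * Real.exp (-b * x))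
      = ENNReal.ofReal (Real.Gamma s / b ^ s) * (gammaPDF s b x * 1) := by
    intro x hx
    have hx' : 0 < x := hx
    rw [mul_one, gammaPDF_of_nonneg hx'.le, ← ENNReal.ofReal_mul (by positivity)]
    congr 1
    rw [neg_mul]
    have : 0 < b ^ s := by positivity
    field_simp
  rw [setLIntegral_congr_fun measurableSet_Ioi e, lintegral_const_mul' _ _ ENNReal.ofReal_ne_top,
    ← h1, mul_one]
  exact ENNReal.ofReal_lt_top

end Densities

/-! ### Conditional law of the state given the precisions -/

namespace RandomEffects

variable {p r : ℕ} (y : Fin p → Fin r → ℝ) {a₁ b₁ a₂ b₂ : ℝ}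

lemma measurePreserving_assemble :
    MeasurePreserving (assemble (p := p)) (volume.prod volume) volume :=
  (PiLp.volume_preserving_toLp (Fin (p + 1))).comp (measurePreserving_finCons p)

lemma lintegral_drawState_eq_density {lθ le : ℝ} (hr : 0 < r) (hθ : 0 < lθ) (he : 0 < le)
    {f : State p → ℝ≥0∞} (hf : Measurable f) :
    ∫⁻ w, f w ∂drawState y (lθ, le) = ∫⁻ x, ∫⁻ n : Fin p → ℝ,
      gaussianPDF (√(p : ℝ) * grandMean y) ((lθ + r * le) / (r * le * lθ)).toNNReal x
        * (∏ i, gaussianPDF (r * le * (groupMean y i - x / √(p : ℝ)) / (lθ + r * le))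
            (1 / (lθ + r * le)).toNNReal (n i))
        * f (assemble (x, n)) := by
  have hr' : (0 : ℝ) < r := by positivity
  have hv : ((lθ + r * le) / (r * le * lθ)).toNNReal ≠ 0 := by
    rw [Ne, Real.toNNReal_eq_zero, not_le]; positivity
  have hw : (1 / (lθ + r * le)).toNNReal ≠ 0 := by
    rw [Ne, Real.toNNReal_eq_zero, not_le]; positivity
  have hfa : Measurable fun z : ℝ × (Fin p → ℝ) => f (assemble z) := hf.comp measurable_assemble
  have hmeas : ∀ x, Measurable fun n : Fin p → ℝ =>
      ∏ i, gaussianPDF (r * le * (groupMean y i - x / √(p : ℝ)) / (lθ + r * le))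
        (1 / (lθ + r * le)).toNNReal (n i) := fun x =>
    Finset.measurable_prod _ fun i _ => (measurable_gaussianPDF _ _).comp (measurable_pi_apply i)
  have hE : ∀ x, drawEffects y ((lθ, le), x) = volume.withDensity fun n : Fin p → ℝ =>
      ∏ i, gaussianPDF (r * le * (groupMean y i - x / √(p : ℝ)) / (lθ + r * le))
        (1 / (lθ + r * le)).toNNReal (n i) := fun x => pi_gaussianReal_eq_withDensity _ hw
  have hI : drawIntercept y (lθ, le) = volume.withDensity
      (gaussianPDF (√(p : ℝ) * grandMean y) ((lθ + r * le) / (r * le * lθ)).toNNReal) :=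
    gaussianReal_of_var_ne_zero _ hv
  have hin : Measurable fun x : ℝ =>
      ∫⁻ n, f (assemble (x, n)) ∂drawEffects y ((lθ, le), x) := by
    have := Measurable.lintegral_kernel_prod_right (κ := drawEffects y)
      (f := fun (q : (ℝ × ℝ) × ℝ) e => f (assemble (q.2, e))) (by
        exact hfa.comp (by fun_prop : Measurable fun z : ((ℝ × ℝ) × ℝ) × (Fin p → ℝ) =>
          (z.1.2, z.2)))
    exact this.comp measurable_prodMk_left
  rw [drawState, Kernel.map_apply _ measurable_assemble, lintegral_map hf measurable_assemble,
    Kernel.lintegral_compProd _ _ _ hfa, hI,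
    lintegral_withDensity_eq_lintegral_mul _ (measurable_gaussianPDF _ _) hin]
  refine lintegral_congr fun x => ?_
  have hfx : Measurable fun n : Fin p → ℝ => f (assemble (x, n)) :=
    hfa.comp measurable_prodMk_left
  rw [Pi.mul_apply, hE, lintegral_withDensity_eq_lintegral_mul _ (hmeas x) hfx]
  rw [← lintegral_const_mul _ ((hmeas x).mul hfx)]
  refine lintegral_congr fun n => ?_
  exact (mul_assoc _ _ _).symm

/-- The integral of the posterior density of `(η, λ_θ, λ_e)` over `η`. -/
noncomputable def precisionDensity (a₁ b₁ a₂ b₂ lθ le : ℝ) : ℝ :=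
  le ^ ((r : ℝ) * p / 2) * lθ ^ ((p : ℝ) / 2) * (lθ ^ (a₁ - 1) * Real.exp (-b₁ * lθ))
    * (le ^ (a₂ - 1) * Real.exp (-b₂ * le))
    * Real.exp (-(le * withinSq y + r * le * lθ / (lθ + r * le) * betweenSq y) / 2)
    * √(2 * Real.pi * ((lθ + r * le) / (r * le * lθ)))
    * √(2 * Real.pi * (1 / (lθ + r * le))) ^ p

/-- Complete the square in each effect, then in the intercept. The second step uses `∑ (ȳ_i - ȳ) =
0`, which separates the between-group sum of squares from the intercept. -/
lemma exponent_eq (hp : 0 < p) (hr : 0 < r) {lθ le : ℝ} (hθ : 0 < lθ) (he : 0 < le)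
    (x : ℝ) (n : Fin p → ℝ) :
    le * residualSq y (assemble (x, n)) + lθ * effectSq (assemble (x, n))
      = (le * withinSq y + r * le * lθ / (lθ + r * le) * betweenSq y)
        + (x - √(p : ℝ) * grandMean y) ^ 2 / ((lθ + r * le) / (r * le * lθ))
        + ∑ i, (n i - r * le * (groupMean y i - x / √(p : ℝ)) / (lθ + r * le)) ^ 2
            / (1 / (lθ + r * le)) := by
  have hr' : (0 : ℝ) < r := by positivity
  have hp' : (0 : ℝ) < p := by positivity
  have hsp : 0 < √(p : ℝ) := by positivity
  have hspsq := Real.sq_sqrt hp'.le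
  have hs : 0 < lθ + r * le := by positivity
  have hmean : ∑ i, (groupMean y i - grandMean y) = 0 := by
    rw [Finset.sum_sub_distrib, Finset.sum_const, Finset.card_univ, Fintype.card_fin,
      nsmul_eq_mul]
    simp only [groupMean, grandMean, ← Finset.sum_div]
    field_simp
    ring
  have hb : ∑ i, (groupMean y i - x / √(p : ℝ)) ^ 2
      = betweenSq y + (x - √(p : ℝ) * grandMean y) ^ 2 := by
    have e : ∀ i, (groupMean y i - x / √(p : ℝ)) ^ 2 = (groupMean y i - grandMean y) ^ 2
        + 2 * (grandMean y - x / √(p : ℝ)) * (groupMean y i - grandMean y)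
        + (grandMean y - x / √(p : ℝ)) ^ 2 := fun i => by ring
    simp only [e, Finset.sum_add_distrib, ← Finset.mul_sum, hmean, Finset.sum_const,
      Finset.card_univ, Fintype.card_fin, nsmul_eq_mul, mul_zero, add_zero, betweenSq]
    congr 1
    have e2 : x - √(p : ℝ) * grandMean y = -(√(p : ℝ) * (grandMean y - x / √(p : ℝ))) := by
      field_simp; ring
    rw [e2, neg_sq, mul_pow, hspsq]
  have hi : ∀ i, r * le * (groupMean y i - x / √(p : ℝ) - n i) ^ 2 + lθ * n i ^ 2
      = r * le * lθ / (lθ + r * le) * (groupMean y i - x / √(p : ℝ)) ^ 2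
        + (n i - r * le * (groupMean y i - x / √(p : ℝ)) / (lθ + r * le)) ^ 2
            / (1 / (lθ + r * le)) := by
    intro i
    generalize groupMean y i - x / √(p : ℝ) = k
    field_simp
    ring
  rw [residualSq_eq y hr, effectSq]
  simp only [assemble_zero, assemble_succ]
  have h1 : le * (r * ∑ i, (groupMean y i - x / √(p : ℝ) - n i) ^ 2) + lθ * ∑ i, n i ^ 2
      = r * le * lθ / (lθ + r * le) * (betweenSq y + (x - √(p : ℝ) * grandMean y) ^ 2)
        + ∑ i, (n i - r * le * (groupMean y i - x / √(p : ℝ)) / (lθ + r * le)) ^ 2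
            / (1 / (lθ + r * le)) := by
    rw [← hb, Finset.mul_sum (s := Finset.univ)
      (f := fun i => (groupMean y i - x / √(p : ℝ)) ^ 2), ← Finset.sum_add_distrib,
      ← Finset.sum_congr rfl fun i _ => hi i, Finset.sum_add_distrib, Finset.mul_sum,
      Finset.mul_sum, Finset.mul_sum]
    congr 1
    exact Finset.sum_congr rfl fun i _ => by ring
  have h2 : (x - √(p : ℝ) * grandMean y) ^ 2 / ((lθ + r * le) / (r * le * lθ))
      = r * le * lθ / (lθ + r * le) * (x - √(p : ℝ) * grandMean y) ^ 2 := by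
    rw [div_div_eq_mul_div]; ring
  rw [h2, mul_add]
  linarith

/-- First factorisation of the joint density: a function of the precisions times the normal
densities from which the chain draws the new state. -/
lemma posteriorDensity_assemble (hp : 0 < p) (hr : 0 < r) {lθ le : ℝ} (hθ : 0 < lθ)
    (he : 0 < le) (x : ℝ) (n : Fin p → ℝ) :
    ENNReal.ofReal (posteriorDensity y a₁ b₁ a₂ b₂ (assemble (x, n)) lθ le)
      = ENNReal.ofReal (precisionDensity y a₁ b₁ a₂ b₂ lθ le)
        * (gaussianPDF (√(p : ℝ) * grandMean y) ((lθ + r * le) / (r * le * lθ)).toNNReal x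
        * ∏ i, gaussianPDF (r * le * (groupMean y i - x / √(p : ℝ)) / (lθ + r * le))
            (1 / (lθ + r * le)).toNNReal (n i)) := by
  have hr' : (0 : ℝ) < r := by positivity
  have hs : 0 < lθ + r * le := by positivity
  have hv : 0 < (lθ + r * le) / (r * le * lθ) := by positivity
  have hw : 0 < 1 / (lθ + r * le) := by positivity
  simp only [gaussianPDF]
  rw [← ENNReal.ofReal_prod_of_nonneg fun i _ => gaussianPDFReal_nonneg _ _ _,
    ← ENNReal.ofReal_mul (gaussianPDFReal_nonneg _ _ _),
    ← ENNReal.ofReal_mul (by unfold precisionDensity; positivity)]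
  congr 1
  simp only [gaussianPDFReal, Real.coe_toNNReal _ hv.le, Real.coe_toNNReal _ hw.le,
    Finset.prod_mul_distrib, Finset.prod_const, Finset.card_univ, Fintype.card_fin,
    ← Real.exp_sum]
  have hE := exponent_eq y hp hr hθ he x n
  have hexp : Real.exp (-(le / 2) * residualSq y (assemble (x, n)))
        * Real.exp (-(lθ / 2) * effectSq (assemble (x, n)))
      = Real.exp (-(le * withinSq y + r * le * lθ / (lθ + r * le) * betweenSq y) / 2)
        * (Real.exp (-(x - √(p : ℝ) * grandMean y) ^ 2 / (2 * ((lθ + r * le) / (r * le * lθ))))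
        * Real.exp (∑ i, -(n i - r * le * (groupMean y i - x / √(p : ℝ)) / (lθ + r * le)) ^ 2
            / (2 * (1 / (lθ + r * le))))) := by
    rw [← Real.exp_add, ← Real.exp_add, ← Real.exp_add]
    congr 1
    have e1 : ∀ t u : ℝ, -t / (2 * u) = -(1 / 2) * (t / u) := fun t u => by
      rw [neg_div, mul_comm 2 u, ← div_div]; ring
    simp only [e1, ← Finset.mul_sum]
    linarith
  have h1 : √(2 * Real.pi * ((lθ + r * le) / (r * le * lθ))) ≠ 0 := by positivity
  have h2 : √(2 * Real.pi * (1 / (lθ + r * le))) ^ p ≠ 0 := by positivity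
  unfold posteriorDensity precisionDensity
  rw [inv_pow]
  generalize √(2 * Real.pi * ((lθ + r * le) / (r * le * lθ))) = s1 at *
  generalize √(2 * Real.pi * (1 / (lθ + r * le))) ^ p = s2 at *
  calc _ = le ^ ((r : ℝ) * p / 2) * lθ ^ ((p : ℝ) / 2) * (lθ ^ (a₁ - 1) * Real.exp (-b₁ * lθ))
    * (le ^ (a₂ - 1) * Real.exp (-b₂ * le)) * (Real.exp (-(le / 2) * residualSq y (assemble (x, n)))
        * Real.exp (-(lθ / 2) * effectSq (assemble (x, n)))) := by ring
    _ = _ := by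
      rw [hexp]
      field_simp

end RandomEffects

/-! ### The posterior is a proper invariant distribution -/

namespace RandomEffects

variable {p r : ℕ} (y : Fin p → Fin r → ℝ) {a₁ b₁ a₂ b₂ : ℝ}

lemma measurable_posteriorDensity (a₁ b₁ a₂ b₂ : ℝ) :
    Measurable fun z : State p × (ℝ × ℝ) => posteriorDensity y a₁ b₁ a₂ b₂ z.1 z.2.1 z.2.2 := by
  have h1 : Measurable fun z : State p × (ℝ × ℝ) => effectSq z.1 :=
    measurable_effectSq.comp measurable_fst
  have h2 : Measurable fun z : State p × (ℝ × ℝ) => residualSq y z.1 :=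
    (measurable_residualSq y).comp measurable_fst
  unfold posteriorDensity
  fun_prop

/-- Lebesgue measure on pairs of positive precisions. -/
noncomputable def precisionMeasure : Measure (ℝ × ℝ) :=
  (volume.restrict (Set.Ioi 0)).prod (volume.restrict (Set.Ioi 0))

instance : SFinite precisionMeasure := by unfold precisionMeasure; infer_instance

lemma precisionMeasure_ae_pos : ∀ᵐ l ∂precisionMeasure, 0 < l.1 ∧ 0 < l.2 := by
  have h : ∀ᵐ x : ℝ ∂volume.restrict (Set.Ioi 0), 0 < x := ae_restrict_mem measurableSet_Ioi
  exact (Measure.quasiMeasurePreserving_fst.ae h).and (Measure.quasiMeasurePreserving_snd.ae h)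

lemma lintegral_precisionMeasure {f : ℝ × ℝ → ℝ≥0∞} (hf : Measurable f) :
    ∫⁻ l, f l ∂precisionMeasure
      = ∫⁻ le in Set.Ioi (0 : ℝ), ∫⁻ lθ in Set.Ioi (0 : ℝ), f (lθ, le) :=
  lintegral_prod_symm _ hf.aemeasurable

/-- The unnormalised posterior density of `η`. -/
noncomputable def etaDensity (a₁ b₁ a₂ b₂ : ℝ) (η : State p) : ℝ≥0∞ :=
  ∫⁻ le in Set.Ioi (0 : ℝ), ∫⁻ lθ in Set.Ioi (0 : ℝ),
    ENNReal.ofReal (posteriorDensity y a₁ b₁ a₂ b₂ η lθ le)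

lemma etaDensity_eq (η : State p) : etaDensity y a₁ b₁ a₂ b₂ η
    = ∫⁻ l, ENNReal.ofReal (posteriorDensity y a₁ b₁ a₂ b₂ η l.1 l.2) ∂precisionMeasure :=
  (lintegral_precisionMeasure (f := fun l =>
    ENNReal.ofReal (posteriorDensity y a₁ b₁ a₂ b₂ η l.1 l.2))
    ((measurable_posteriorDensity y a₁ b₁ a₂ b₂).comp measurable_prodMk_left).ennreal_ofReal).symm

lemma measurable_etaDensity : Measurable (etaDensity y a₁ b₁ a₂ b₂) := by
  have h : Measurable fun η => ∫⁻ l,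
      ENNReal.ofReal (posteriorDensity y a₁ b₁ a₂ b₂ η l.1 l.2) ∂precisionMeasure :=
    (measurable_posteriorDensity y a₁ b₁ a₂ b₂).ennreal_ofReal.lintegral_prod_right'
  simpa only [← etaDensity_eq] using h

/-- The normalising constant of the conditional density of the precisions given `η`. -/
noncomputable def precisionNorm (a₁ b₁ a₂ b₂ : ℝ) (η : State p) : ℝ :=
  Real.Gamma ((p : ℝ) / 2 + a₁) / (b₁ + effectSq η / 2) ^ ((p : ℝ) / 2 + a₁)
    * (Real.Gamma ((r : ℝ) * p / 2 + a₂)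
      / (b₂ + residualSq y η / 2) ^ ((r : ℝ) * p / 2 + a₂))

lemma precisionNorm_pos (ha₁ : 0 < a₁) (hb₁ : 0 < b₁) (ha₂ : 0 < a₂) (hb₂ : 0 < b₂)
    (η : State p) : 0 < precisionNorm y a₁ b₁ a₂ b₂ η := by
  have h1 := effectSq_nonneg η
  have h2 := residualSq_nonneg y η
  have h3 := Real.Gamma_pos_of_pos (by positivity : 0 < (p : ℝ) / 2 + a₁)
  have h4 := Real.Gamma_pos_of_pos (by positivity : 0 < (r : ℝ) * p / 2 + a₂)
  unfold precisionNorm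
  positivity

/-- Second factorisation of the joint density: a function of the state times the gamma densities
from which the chain draws the precisions. -/
lemma posteriorDensity_eq_gamma (ha₁ : 0 < a₁) (hb₁ : 0 < b₁) (ha₂ : 0 < a₂) (hb₂ : 0 < b₂)
    (η : State p) {lθ le : ℝ} (hθ : 0 < lθ) (he : 0 < le) :
    ENNReal.ofReal (posteriorDensity y a₁ b₁ a₂ b₂ η lθ le)
      = ENNReal.ofReal (precisionNorm y a₁ b₁ a₂ b₂ η)
        * (gammaPDF ((p : ℝ) / 2 + a₁) (b₁ + effectSq η / 2) lθ
          * gammaPDF ((r : ℝ) * p / 2 + a₂) (b₂ + residualSq y η / 2) le) := by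
  have h1 := effectSq_nonneg η
  have h2 := residualSq_nonneg y η
  have h3 := Real.Gamma_pos_of_pos (by positivity : 0 < (p : ℝ) / 2 + a₁)
  have h4 := Real.Gamma_pos_of_pos (by positivity : 0 < (r : ℝ) * p / 2 + a₂)
  have h5 := precisionNorm_pos y ha₁ hb₁ ha₂ hb₂ η
  rw [gammaPDF_of_nonneg hθ.le, gammaPDF_of_nonneg he.le, ← ENNReal.ofReal_mul (by positivity),
    ← ENNReal.ofReal_mul h5.le]
  congr 1
  have e1 : Real.exp (-((b₁ + effectSq η / 2) * lθ))
      = Real.exp (-(lθ / 2) * effectSq η) * Real.exp (-b₁ * lθ) := by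
    rw [← Real.exp_add]; ring_nf
  have e2 : Real.exp (-((b₂ + residualSq y η / 2) * le))
      = Real.exp (-(le / 2) * residualSq y η) * Real.exp (-b₂ * le) := by
    rw [← Real.exp_add]; ring_nf
  have e3 : lθ ^ ((p : ℝ) / 2 + a₁ - 1) = lθ ^ ((p : ℝ) / 2) * lθ ^ (a₁ - 1) := by
    rw [← Real.rpow_add hθ]; ring_nf
  have e4 : le ^ ((r : ℝ) * p / 2 + a₂ - 1) = le ^ ((r : ℝ) * p / 2) * le ^ (a₂ - 1) := by
    rw [← Real.rpow_add he]; ring_nf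
  rw [e1, e2, e3, e4]
  unfold precisionNorm posteriorDensity
  have h6 : 0 < (b₁ + effectSq η / 2) ^ ((p : ℝ) / 2 + a₁) := by positivity
  have h7 : 0 < (b₂ + residualSq y η / 2) ^ ((r : ℝ) * p / 2 + a₂) := by positivity
  generalize (b₁ + effectSq η / 2) ^ ((p : ℝ) / 2 + a₁) = c1 at *
  generalize (b₂ + residualSq y η / 2) ^ ((r : ℝ) * p / 2 + a₂) = c2 at *
  field_simp

lemma lintegral_posteriorDensity_mul (ha₁ : 0 < a₁) (hb₁ : 0 < b₁) (ha₂ : 0 < a₂) (hb₂ : 0 < b₂)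
    (η : State p) {g : ℝ × ℝ → ℝ≥0∞} (hg : Measurable g) :
    ∫⁻ l, ENNReal.ofReal (posteriorDensity y a₁ b₁ a₂ b₂ η l.1 l.2) * g l ∂precisionMeasure
      = ENNReal.ofReal (precisionNorm y a₁ b₁ a₂ b₂ η)
        * ∫⁻ l, g l ∂(drawTheta p a₁ b₁ ×ₖ drawError y a₂ b₂) η := by
  have h₁ : IsMarkovKernel (drawTheta p a₁ b₁) := ⟨fun η =>
    isProbabilityMeasure_gammaMeasure (by positivity)
      (by have := effectSq_nonneg η; positivity)⟩
  have h₂ : IsMarkovKernel (drawError y a₂ b₂) := ⟨fun η =>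
    isProbabilityMeasure_gammaMeasure (by positivity)
      (by have := residualSq_nonneg y η; positivity)⟩
  have hpdf : ∀ a b, Measurable (gammaPDF a b) := fun a b => by unfold gammaPDF; fun_prop
  have e : ∀ᵐ l ∂precisionMeasure,
      ENNReal.ofReal (posteriorDensity y a₁ b₁ a₂ b₂ η l.1 l.2) * g l
      = ENNReal.ofReal (precisionNorm y a₁ b₁ a₂ b₂ η)
        * (gammaPDF ((p : ℝ) / 2 + a₁) (b₁ + effectSq η / 2) l.1
          * (gammaPDF ((r : ℝ) * p / 2 + a₂) (b₂ + residualSq y η / 2) l.2 * g l)) := by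
    filter_upwards [precisionMeasure_ae_pos] with l hl
    rw [posteriorDensity_eq_gamma y ha₁ hb₁ ha₂ hb₂ η hl.1 hl.2]
    ring
  have hm2 : Measurable fun l : ℝ × ℝ =>
      gammaPDF ((r : ℝ) * p / 2 + a₂) (b₂ + residualSq y η / 2) l.2 * g l :=
    ((hpdf _ _).comp measurable_snd).mul hg
  have hm1 : Measurable fun l : ℝ × ℝ => gammaPDF ((p : ℝ) / 2 + a₁) (b₁ + effectSq η / 2) l.1
      * (gammaPDF ((r : ℝ) * p / 2 + a₂) (b₂ + residualSq y η / 2) l.2 * g l) :=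
    ((hpdf _ _).comp measurable_fst).mul hm2
  rw [lintegral_congr_ae e, lintegral_const_mul _ hm1, Kernel.prod_apply,
    lintegral_prod _ hg.aemeasurable, precisionMeasure, lintegral_prod _ hm1.aemeasurable]
  congr 1
  have hin : Measurable fun x => ∫⁻ z, g (x, z) ∂drawError y a₂ b₂ η := hg.lintegral_prod_right'
  change _ = ∫⁻ x, _ ∂gammaMeasure _ _
  rw [lintegral_gammaMeasure _ _ hin]
  refine lintegral_congr fun x => ?_
  have hm3 : Measurable fun z =>
      gammaPDF ((r : ℝ) * p / 2 + a₂) (b₂ + residualSq y η / 2) z * g (x, z) :=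
    hm2.comp (measurable_prodMk_left (x := x))
  change ∫⁻ z in Set.Ioi 0, gammaPDF _ _ x * (gammaPDF _ _ z * g (x, z)) = _
  rw [lintegral_const_mul _ hm3]
  congr 1
  exact (lintegral_gammaMeasure _ _ (hg.comp measurable_prodMk_left)).symm

lemma etaDensity_eq_precisionNorm (ha₁ : 0 < a₁) (hb₁ : 0 < b₁) (ha₂ : 0 < a₂) (hb₂ : 0 < b₂)
    (η : State p) :
    etaDensity y a₁ b₁ a₂ b₂ η = ENNReal.ofReal (precisionNorm y a₁ b₁ a₂ b₂ η) := by
  have h₁ : IsMarkovKernel (drawTheta p a₁ b₁) := ⟨fun η =>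
    isProbabilityMeasure_gammaMeasure (by positivity)
      (by have := effectSq_nonneg η; positivity)⟩
  have h₂ : IsMarkovKernel (drawError y a₂ b₂) := ⟨fun η =>
    isProbabilityMeasure_gammaMeasure (by positivity)
      (by have := residualSq_nonneg y η; positivity)⟩
  have h := lintegral_posteriorDensity_mul y ha₁ hb₁ ha₂ hb₂ η (g := fun _ => 1) measurable_const
  simp only [mul_one, lintegral_const, measure_univ] at h
  rw [etaDensity_eq, h]

lemma lintegral_state_posteriorDensity_mul (hp : 0 < p) (hr : 0 < r) {lθ le : ℝ} (hθ : 0 < lθ)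
    (he : 0 < le) {f : State p → ℝ≥0∞} (hf : Measurable f) :
    ∫⁻ η, ENNReal.ofReal (posteriorDensity y a₁ b₁ a₂ b₂ η lθ le) * f η
      = ENNReal.ofReal (precisionDensity y a₁ b₁ a₂ b₂ lθ le)
        * ∫⁻ w, f w ∂drawState y (lθ, le) := by
  have hm : Measurable fun η =>
      ENNReal.ofReal (posteriorDensity y a₁ b₁ a₂ b₂ η lθ le) * f η :=
    ((measurable_posteriorDensity y a₁ b₁ a₂ b₂).comp
      (measurable_prodMk_right (y := (lθ, le)))).ennreal_ofReal.mul hf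
  have hm' : Measurable fun q : ℝ × (Fin p → ℝ) =>
      ENNReal.ofReal (posteriorDensity y a₁ b₁ a₂ b₂ (assemble q) lθ le) * f (assemble q) :=
    hm.comp measurable_assemble
  rw [← measurePreserving_assemble.lintegral_comp hm, lintegral_prod _ hm'.aemeasurable,
    lintegral_drawState_eq_density y hr hθ he hf, ← lintegral_const_mul' _ _ ENNReal.ofReal_ne_top]
  refine lintegral_congr fun x => ?_
  rw [← lintegral_const_mul' _ _ ENNReal.ofReal_ne_top]
  refine lintegral_congr fun n => ?_
  rw [posteriorDensity_assemble y hp hr hθ he, mul_assoc]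

/-- Two-block Gibbs argument. Drawing the precisions from an `η` with the posterior density
reproduces the joint law; by Tonelli the state may then be integrated first, and resampling it from
its conditional law given the precisions changes nothing. Finite total mass plays no role. -/
theorem invariant_unnormalizedPosterior (hp : 0 < p) (hr : 0 < r) (ha₁ : 0 < a₁) (hb₁ : 0 < b₁)
    (ha₂ : 0 < a₂) (hb₂ : 0 < b₂) :
    (gibbsKernel y a₁ b₁ a₂ b₂).Invariant (unnormalizedPosterior y a₁ b₁ a₂ b₂) := by
  have hd := measurable_posteriorDensity y a₁ b₁ a₂ b₂
  have hdet := measurable_etaDensity y (a₁ := a₁) (b₁ := b₁) (a₂ := a₂) (b₂ := b₂)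
  have hswap : ∀ g : State p × (ℝ × ℝ) → ℝ≥0∞, Measurable g →
      ∫⁻ η, ∫⁻ l, g (η, l) ∂precisionMeasure = ∫⁻ l, (∫⁻ η, g (η, l)) ∂precisionMeasure :=
    fun g hg => lintegral_lintegral_swap (f := fun η l => g (η, l)) hg.aemeasurable
  change (volume.withDensity (etaDensity y a₁ b₁ a₂ b₂)).bind _
    = volume.withDensity (etaDensity y a₁ b₁ a₂ b₂)
  refine Measure.ext_of_lintegral _ fun f hf => ?_
  have hQ : Measurable fun l => ∫⁻ w, f w ∂drawState y l := hf.lintegral_kernel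
  rw [Measure.lintegral_bind (Kernel.aemeasurable _) hf.aemeasurable,
    lintegral_withDensity_eq_lintegral_mul _ hdet hf.lintegral_kernel,
    lintegral_withDensity_eq_lintegral_mul _ hdet hf]
  have h1 : ∀ η, (etaDensity y a₁ b₁ a₂ b₂ * fun η => ∫⁻ w, f w ∂gibbsKernel y a₁ b₁ a₂ b₂ η) η
      = ∫⁻ l, ENNReal.ofReal (posteriorDensity y a₁ b₁ a₂ b₂ η l.1 l.2)
        * ∫⁻ w, f w ∂drawState y l ∂precisionMeasure := by
    intro η
    rw [Pi.mul_apply, etaDensity_eq_precisionNorm y ha₁ hb₁ ha₂ hb₂,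
      lintegral_posteriorDensity_mul y ha₁ hb₁ ha₂ hb₂ η hQ]
    congr 1
    exact Kernel.lintegral_comp (drawState y) (drawTheta p a₁ b₁ ×ₖ drawError y a₂ b₂) η hf
  have h2 : ∀ η, (etaDensity y a₁ b₁ a₂ b₂ * f) η
      = ∫⁻ l, ENNReal.ofReal (posteriorDensity y a₁ b₁ a₂ b₂ η l.1 l.2) * f η
        ∂precisionMeasure := by
    intro η
    have hm : Measurable fun l : ℝ × ℝ =>
        ENNReal.ofReal (posteriorDensity y a₁ b₁ a₂ b₂ η l.1 l.2) :=
      (hd.comp (measurable_prodMk_left (x := η))).ennreal_ofReal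
    rw [Pi.mul_apply, etaDensity_eq, lintegral_mul_const _ hm]
  rw [lintegral_congr h1, lintegral_congr h2,
    hswap (fun z => ENNReal.ofReal (posteriorDensity y a₁ b₁ a₂ b₂ z.1 z.2.1 z.2.2)
      * ∫⁻ w, f w ∂drawState y z.2) (hd.ennreal_ofReal.mul (hQ.comp measurable_snd)),
    hswap (fun z => ENNReal.ofReal (posteriorDensity y a₁ b₁ a₂ b₂ z.1 z.2.1 z.2.2) * f z.1)
      (hd.ennreal_ofReal.mul (hf.comp measurable_fst))]
  refine lintegral_congr_ae ?_
  filter_upwards [precisionMeasure_ae_pos] with l hl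
  have h3 := lintegral_state_posteriorDensity_mul y (a₁ := a₁) (b₁ := b₁) (a₂ := a₂) (b₂ := b₂)
    hp hr hl.1 hl.2 hf
  have h4 := lintegral_state_posteriorDensity_mul y (a₁ := a₁) (b₁ := b₁) (a₂ := a₂) (b₂ := b₂)
    hp hr hl.1 hl.2 (f := fun _ => ∫⁻ w, f w ∂drawState y l) measurable_const
  have hmk : IsMarkovKernel (drawState y) := by
    unfold drawState
    exact Kernel.IsMarkovKernel.map _ measurable_assemble
  rw [lintegral_const, measure_univ, mul_one] at h4
  rw [h3, h4]

/-- The exponential of the data is at most `1`, the `p` effect deviations give `le^(-p/2)`, and `√x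
≤ 1 + x` bounds the intercept deviation by a multiple of `1 + le⁻¹ + lθ⁻¹`. This yields three
products of unnormalised gamma densities. -/
lemma precisionDensity_le (hp : 2 ≤ p) (hr : 2 ≤ r) {lθ le : ℝ} (hθ : 0 < lθ) (he : 0 < le) :
    precisionDensity y a₁ b₁ a₂ b₂ lθ le ≤ (2 * Real.pi) ^ ((p : ℝ) / 2) * (1 + 2 * Real.pi)
      * (le ^ ((r - 1 : ℝ) * p / 2 + a₂ - 1) * Real.exp (-b₂ * le)
          * (lθ ^ ((p : ℝ) / 2 + a₁ - 1) * Real.exp (-b₁ * lθ))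
        + le ^ ((r - 1 : ℝ) * p / 2 - 1 + a₂ - 1) * Real.exp (-b₂ * le)
          * (lθ ^ ((p : ℝ) / 2 + a₁ - 1) * Real.exp (-b₁ * lθ))
        + le ^ ((r - 1 : ℝ) * p / 2 + a₂ - 1) * Real.exp (-b₂ * le)
          * (lθ ^ ((p : ℝ) / 2 - 1 + a₁ - 1) * Real.exp (-b₁ * lθ))) := by
  have hr' : (2 : ℝ) ≤ r := by exact_mod_cast hr
  have hs : 0 < lθ + r * le := by positivity
  have hpi := Real.pi_pos
  have e1 : Real.exp (-(le * withinSq y + r * le * lθ / (lθ + r * le) * betweenSq y) / 2) ≤ 1 := by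
    have h1 := withinSq_nonneg y
    have h2 := betweenSq_nonneg y
    have h3 : 0 ≤ le * withinSq y + r * le * lθ / (lθ + r * le) * betweenSq y := by positivity
    rw [Real.exp_le_one_iff]
    linarith
  have e2 : √(2 * Real.pi * ((lθ + r * le) / (r * le * lθ)))
      ≤ (1 + 2 * Real.pi) * (1 + le⁻¹ + lθ⁻¹) := by
    have h1 : (lθ + r * le) / (r * le * lθ) ≤ le⁻¹ + lθ⁻¹ := by
      have e : (lθ + r * le) / (r * le * lθ) = (r * le)⁻¹ + lθ⁻¹ := by field_simp
      rw [e]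
      gcongr
      nlinarith
    have h2 : ∀ x : ℝ, 0 ≤ x → √x ≤ 1 + x := fun x hx => by
      rw [Real.sqrt_le_left (by positivity)]; nlinarith
    have h3 : 0 ≤ le⁻¹ + lθ⁻¹ := by positivity
    calc _ ≤ 1 + 2 * Real.pi * ((lθ + r * le) / (r * le * lθ)) := h2 _ (by positivity)
      _ ≤ 1 + 2 * Real.pi * (le⁻¹ + lθ⁻¹) := by gcongr
      _ ≤ _ := by nlinarith
  have e3 : √(2 * Real.pi * (1 / (lθ + r * le))) ^ p
      ≤ (2 * Real.pi) ^ ((p : ℝ) / 2) * le ^ (-((p : ℝ) / 2)) := by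
    have h1 : √(2 * Real.pi * (1 / (lθ + r * le))) ^ p
        = (2 * Real.pi * (1 / (lθ + r * le))) ^ ((p : ℝ) / 2) := by
      rw [Real.sqrt_eq_rpow, ← Real.rpow_natCast, ← Real.rpow_mul (by positivity)]
      ring_nf
    rw [h1, Real.rpow_neg he.le, ← Real.inv_rpow he.le, ← Real.mul_rpow (by positivity)
      (by positivity)]
    refine Real.rpow_le_rpow (by positivity) ?_ (by positivity)
    rw [one_div]
    gcongr
    nlinarith
  have hle : ∀ s : ℝ, le ^ (s - 1) = le ^ s * le⁻¹ := fun s => by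
    rw [Real.rpow_sub_one he.ne', div_eq_mul_inv]
  have hlθ : ∀ s : ℝ, lθ ^ (s - 1) = lθ ^ s * lθ⁻¹ := fun s => by
    rw [Real.rpow_sub_one hθ.ne', div_eq_mul_inv]
  have f1 : le ^ ((r - 1 : ℝ) * p / 2 + a₂ - 1)
      = le ^ ((r : ℝ) * p / 2) * le ^ (a₂ - 1) * le ^ (-((p : ℝ) / 2)) := by
    rw [← Real.rpow_add he, ← Real.rpow_add he]; ring_nf
  have f2 : le ^ ((r - 1 : ℝ) * p / 2 - 1 + a₂ - 1)
      = le ^ ((r : ℝ) * p / 2) * le ^ (a₂ - 1) * le ^ (-((p : ℝ) / 2)) * le⁻¹ := by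
    rw [← f1, ← hle]; ring_nf
  have f3 : lθ ^ ((p : ℝ) / 2 + a₁ - 1) = lθ ^ ((p : ℝ) / 2) * lθ ^ (a₁ - 1) := by
    rw [← Real.rpow_add hθ]; ring_nf
  have f4 : lθ ^ ((p : ℝ) / 2 - 1 + a₁ - 1) = lθ ^ ((p : ℝ) / 2) * lθ ^ (a₁ - 1) * lθ⁻¹ := by
    rw [← f3, ← hlθ]; ring_nf
  rw [f1, f2, f3, f4]
  unfold precisionDensity
  calc _ ≤ le ^ ((r : ℝ) * p / 2) * lθ ^ ((p : ℝ) / 2) * (lθ ^ (a₁ - 1) * Real.exp (-b₁ * lθ))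
        * (le ^ (a₂ - 1) * Real.exp (-b₂ * le)) * 1 * ((1 + 2 * Real.pi) * (1 + le⁻¹ + lθ⁻¹))
        * ((2 * Real.pi) ^ ((p : ℝ) / 2) * le ^ (-((p : ℝ) / 2))) := by gcongr
    _ = _ := by ring

lemma unnormalizedPosterior_univ : unnormalizedPosterior y a₁ b₁ a₂ b₂ Set.univ
    = ∫⁻ η, etaDensity y a₁ b₁ a₂ b₂ η := by
  rw [unnormalizedPosterior, withDensity_apply _ MeasurableSet.univ, Measure.restrict_univ]
  rfl

lemma unnormalizedPosterior_univ_ne_zero (ha₁ : 0 < a₁) (hb₁ : 0 < b₁) (ha₂ : 0 < a₂)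
    (hb₂ : 0 < b₂) : unnormalizedPosterior y a₁ b₁ a₂ b₂ Set.univ ≠ 0 := by
  rw [unnormalizedPosterior_univ, Ne, lintegral_eq_zero_iff (measurable_etaDensity y)]
  intro h
  have h1 : ∀ᵐ _ : State p, False := by
    filter_upwards [h] with η hη
    rw [etaDensity_eq_precisionNorm y ha₁ hb₁ ha₂ hb₂, Pi.zero_apply,
      ENNReal.ofReal_eq_zero] at hη
    exact absurd (precisionNorm_pos y ha₁ hb₁ ha₂ hb₂ η) (not_lt.2 hη)
  rw [ae_iff] at h1
  simp at h1

/-- The flat prior on the intercept is improper, so finiteness has to be proved. With `p, r ≥ 2`,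
every gamma shape left after integrating out `η` is positive, even after the loss of one unit. -/
lemma unnormalizedPosterior_univ_lt_top (hp : 2 ≤ p) (hr : 2 ≤ r) (ha₁ : 0 < a₁) (hb₁ : 0 < b₁)
    (ha₂ : 0 < a₂) (hb₂ : 0 < b₂) : unnormalizedPosterior y a₁ b₁ a₂ b₂ Set.univ < ∞ := by
  have hp' : (2 : ℝ) ≤ p := by exact_mod_cast hp
  have hr' : (2 : ℝ) ≤ r := by exact_mod_cast hr
  have hd := measurable_posteriorDensity y a₁ b₁ a₂ b₂
  rw [unnormalizedPosterior_univ, lintegral_congr (etaDensity_eq y),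
    lintegral_lintegral_swap hd.ennreal_ofReal.aemeasurable]
  have hmk : IsMarkovKernel (drawState y) := by
    unfold drawState
    exact Kernel.IsMarkovKernel.map _ measurable_assemble
  have e : ∀ᵐ l ∂precisionMeasure,
      ∫⁻ η, ENNReal.ofReal (posteriorDensity y a₁ b₁ a₂ b₂ η l.1 l.2)
      ≤ ENNReal.ofReal ((2 * Real.pi) ^ ((p : ℝ) / 2) * (1 + 2 * Real.pi))
        * (ENNReal.ofReal (l.1 ^ ((p : ℝ) / 2 + a₁ - 1) * Real.exp (-b₁ * l.1))
            * ENNReal.ofReal (l.2 ^ ((r - 1 : ℝ) * p / 2 + a₂ - 1) * Real.exp (-b₂ * l.2))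
          + ENNReal.ofReal (l.1 ^ ((p : ℝ) / 2 + a₁ - 1) * Real.exp (-b₁ * l.1))
            * ENNReal.ofReal (l.2 ^ ((r - 1 : ℝ) * p / 2 - 1 + a₂ - 1) * Real.exp (-b₂ * l.2))
          + ENNReal.ofReal (l.1 ^ ((p : ℝ) / 2 - 1 + a₁ - 1) * Real.exp (-b₁ * l.1))
            * ENNReal.ofReal (l.2 ^ ((r - 1 : ℝ) * p / 2 + a₂ - 1) * Real.exp (-b₂ * l.2))) := by
    filter_upwards [precisionMeasure_ae_pos] with l hl
    obtain ⟨h1, h2⟩ := hl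
    have h3 := lintegral_state_posteriorDensity_mul y (a₁ := a₁) (b₁ := b₁) (a₂ := a₂)
      (b₂ := b₂) (by omega) (by omega) h1 h2 (f := fun _ => 1) measurable_const
    simp only [mul_one, lintegral_const, measure_univ] at h3
    rw [h3, ← ENNReal.ofReal_mul (by positivity), ← ENNReal.ofReal_mul (by positivity),
      ← ENNReal.ofReal_mul (by positivity), ← ENNReal.ofReal_add (by positivity) (by positivity),
      ← ENNReal.ofReal_add (by positivity) (by positivity), ← ENNReal.ofReal_mul (by positivity)]
    refine ENNReal.ofReal_le_ofReal ((precisionDensity_le y hp hr h1 h2).trans_eq ?_)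
    ring
  have hm : ∀ s b : ℝ, Measurable fun x : ℝ =>
      ENNReal.ofReal (x ^ (s - 1) * Real.exp (-b * x)) := fun s b => by fun_prop
  have hprod : ∀ s t : ℝ, 0 < s → 0 < t →
      ∫⁻ l, ENNReal.ofReal (l.1 ^ (s - 1) * Real.exp (-b₁ * l.1))
        * ENNReal.ofReal (l.2 ^ (t - 1) * Real.exp (-b₂ * l.2)) ∂precisionMeasure < ∞ := by
    intro s t hs ht
    rw [precisionMeasure, lintegral_prod_mul (hm _ _).aemeasurable (hm _ _).aemeasurable]
    exact ENNReal.mul_lt_top (lintegral_rpow_mul_exp_lt_top hs hb₁)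
      (lintegral_rpow_mul_exp_lt_top ht hb₂)
  have hP : 1 ≤ (p : ℝ) / 2 := by linarith
  have hR : 1 ≤ (r - 1 : ℝ) * p / 2 := by nlinarith
  refine (lintegral_mono_ae e).trans_lt ?_
  rw [lintegral_const_mul _ (by fun_prop), lintegral_add_left (by fun_prop),
    lintegral_add_left (by fun_prop)]
  refine ENNReal.mul_lt_top ENNReal.ofReal_lt_top (ENNReal.add_lt_top.2
    ⟨ENNReal.add_lt_top.2 ⟨hprod _ _ ?_ ?_, hprod _ _ ?_ ?_⟩, hprod _ _ ?_ ?_⟩) <;> linarith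

lemma isProbabilityMeasure_posterior (hp : 2 ≤ p) (hr : 2 ≤ r) (ha₁ : 0 < a₁) (hb₁ : 0 < b₁)
    (ha₂ : 0 < a₂) (hb₂ : 0 < b₂) : IsProbabilityMeasure (posterior y a₁ b₁ a₂ b₂) := by
  refine ⟨?_⟩
  rw [posterior, Measure.smul_apply, smul_eq_mul]
  exact ENNReal.inv_mul_cancel (unnormalizedPosterior_univ_ne_zero y ha₁ hb₁ ha₂ hb₂)
    (unnormalizedPosterior_univ_lt_top y hp hr ha₁ hb₁ ha₂ hb₂).ne

lemma invariant_posterior (hp : 0 < p) (hr : 0 < r) (ha₁ : 0 < a₁) (hb₁ : 0 < b₁)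
    (ha₂ : 0 < a₂) (hb₂ : 0 < b₂) :
    (gibbsKernel y a₁ b₁ a₂ b₂).Invariant (posterior y a₁ b₁ a₂ b₂) := by
  have h := (invariant_unnormalizedPosterior y hp hr ha₁ hb₁ ha₂ hb₂).def
  rw [Kernel.Invariant, posterior, Measure.bind_smul, h]

end RandomEffects

/-! ### Lipschitz continuity of the kernel in total variation -/

section Minorization

variable {Ω : Type*} [MeasurableSpace Ω] {μ ν : Measure Ω} [IsProbabilityMeasure ν]
  {q : ℝ≥0∞} {f : Ω → ℝ≥0∞}

/-- If `μ` contains the portion `q` of `ν`, the two differ by at most `1 - q` on functions bounded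
by `1`. This lemma and the next are the two directions. -/
lemma lintegral_minorizing_le (hq : q ≤ 1) (h : q • ν ≤ μ) (hf : ∀ x, f x ≤ 1) :
    ∫⁻ x, f x ∂ν ≤ ∫⁻ x, f x ∂μ + (1 - q) := by
  have h1 : ∫⁻ x, f x ∂ν ≤ 1 := (lintegral_mono hf).trans (by simp)
  calc ∫⁻ x, f x ∂ν = q * ∫⁻ x, f x ∂ν + (1 - q) * ∫⁻ x, f x ∂ν := by
        rw [← add_mul, add_tsub_cancel_of_le hq, one_mul]
    _ ≤ ∫⁻ x, f x ∂μ + (1 - q) := by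
        refine add_le_add ?_ (mul_le_of_le_one_right' h1)
        rw [← smul_eq_mul, ← lintegral_smul_measure]
        exact lintegral_mono' h le_rfl

lemma lintegral_minorized_le [IsProbabilityMeasure μ] (hq : q ≤ 1) (h : q • ν ≤ μ) (hf : ∀ x, f x ≤ 1) :
    ∫⁻ x, f x ∂μ ≤ ∫⁻ x, f x ∂ν + (1 - q) := by
  have hq' : q ≠ ∞ := ne_top_of_le_ne_top ENNReal.one_ne_top hq
  have hfin : IsFiniteMeasure (q • ν) := isFiniteMeasure_of_le μ h
  have hmass : (μ - q • ν) Set.univ = 1 - q := by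
    rw [Measure.sub_apply MeasurableSet.univ h, Measure.smul_apply, measure_univ, measure_univ,
      smul_eq_mul, mul_one]
  calc ∫⁻ x, f x ∂μ = ∫⁻ x, f x ∂(μ - q • ν) + q * ∫⁻ x, f x ∂ν := by
        conv_lhs => rw [← Measure.sub_add_cancel_of_le h]
        rw [lintegral_add_measure, lintegral_smul_measure, smul_eq_mul]
    _ ≤ (1 - q) + ∫⁻ x, f x ∂ν := by
        refine add_le_add ?_ (mul_le_of_le_one_left' hq)
        refine (lintegral_mono hf).trans ?_
        rw [lintegral_one, hmass]
    _ = _ := add_comm _ _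

end Minorization

/-- The normalising constants differ by `(u/u')^a`, and the smaller rate has the larger exponential.
-/
lemma smul_gammaMeasure_le {a u u' : ℝ} (ha : 0 < a) (hu : 0 < u) (h : u ≤ u') :
    ENNReal.ofReal ((u / u') ^ a) • gammaMeasure a u' ≤ gammaMeasure a u := by
  have hu' : 0 < u' := hu.trans_le h
  have hΓ := Real.Gamma_pos_of_pos ha
  unfold gammaMeasure
  rw [← withDensity_smul _ (by unfold gammaPDF; fun_prop)]
  refine withDensity_mono (Eventually.of_forall fun x => ?_)
  rw [Pi.smul_apply, smul_eq_mul]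
  rcases lt_or_ge x 0 with hx | hx
  · rw [gammaPDF_of_neg hx, mul_zero]
    exact zero_le
  · rw [gammaPDF_of_nonneg hx, gammaPDF_of_nonneg hx, ← ENNReal.ofReal_mul (by positivity)]
    refine ENNReal.ofReal_le_ofReal ?_
    have e : (u / u') ^ a * (u' ^ a / Real.Gamma a * x ^ (a - 1) * Real.exp (-(u' * x)))
        = u ^ a / Real.Gamma a * x ^ (a - 1) * Real.exp (-(u' * x)) := by
      rw [Real.div_rpow hu.le hu'.le]
      have : 0 < u' ^ a := by positivity
      field_simp
    rw [e]
    gcongr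

/-- From `1 - e^(-x) ≤ x` and `log x ≤ x - 1`. The bound is phrased with square roots of the rates
because these are Lipschitz in the state. -/
lemma one_sub_div_rpow_le {a b u u' : ℝ} (ha : 0 < a) (hb : 0 < b) (hu : b ≤ u) (h : u ≤ u') :
    1 - (u / u') ^ a ≤ 2 * a / √b * |√u - √u'| := by
  have hu0 : 0 < u := hb.trans_le hu
  have hu' : 0 < u' := hu0.trans_le h
  have h1 : u / u' = (√u / √u') ^ (2 : ℕ) := by
    rw [div_pow, Real.sq_sqrt hu0.le, Real.sq_sqrt hu'.le]
  have hs : 0 < √u := Real.sqrt_pos.2 hu0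
  have hs' : 0 < √u' := Real.sqrt_pos.2 hu'
  have hsb : 0 < √b := Real.sqrt_pos.2 hb
  have ht : 0 < u / u' := by positivity
  have h2 : Real.log (√u' / √u) ≤ √u' / √u - 1 := Real.log_le_sub_one_of_pos (by positivity)
  have h3 : Real.log (u / u') = -(2 * Real.log (√u' / √u)) := by
    rw [h1, Real.log_pow, ← inv_div, Real.log_inv]
    push_cast
    ring
  have h4 : √u ≤ √u' := Real.sqrt_le_sqrt h
  have h5 : √u' / √u - 1 ≤ |√u - √u'| / √b := by
    rw [abs_sub_comm, abs_of_nonneg (sub_nonneg.2 h4), div_sub_one hs.ne']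
    have := sub_nonneg.2 h4
    gcongr
  have h6 := Real.add_one_le_exp (Real.log (u / u') * a)
  rw [Real.rpow_def_of_pos ht]
  calc 1 - Real.exp (Real.log (u / u') * a) ≤ 2 * a * Real.log (√u' / √u) := by
        rw [h3] at h6 ⊢; linarith
    _ ≤ 2 * a * (|√u - √u'| / √b) := by gcongr; exact h2.trans h5
    _ = _ := by ring

lemma lintegral_gammaMeasure_le {a b u u' : ℝ} (ha : 0 < a) (hb : 0 < b) (hu : b ≤ u)
    (hu' : b ≤ u') {f : ℝ → ℝ≥0∞} (hf : ∀ x, f x ≤ 1) :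
    ∫⁻ x, f x ∂gammaMeasure a u
      ≤ ∫⁻ x, f x ∂gammaMeasure a u' + ENNReal.ofReal (2 * a / √b * |√u - √u'|) := by
  have h0 : 0 < u := hb.trans_le hu
  have h0' : 0 < u' := hb.trans_le hu'
  have := isProbabilityMeasure_gammaMeasure ha h0
  have := isProbabilityMeasure_gammaMeasure ha h0'
  have hq : ∀ {v v' : ℝ}, 0 < v → v ≤ v' → ENNReal.ofReal ((v / v') ^ a) ≤ 1 := fun hv h => by
    rw [ENNReal.ofReal_le_one]
    have hv' := hv.trans_le h
    exact Real.rpow_le_one (by positivity) ((div_le_one hv').2 h) ha.le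
  have hsub : ∀ {v v' : ℝ}, b ≤ v → v ≤ v' →
      1 - ENNReal.ofReal ((v / v') ^ a) ≤ ENNReal.ofReal (2 * a / √b * |√v - √v'|) :=
    fun hv h => by
      have hv0 := hb.trans_le hv
      have hv' := hv0.trans_le h
      rw [← ENNReal.ofReal_one, ← ENNReal.ofReal_sub _ (by positivity)]
      exact ENNReal.ofReal_le_ofReal (one_sub_div_rpow_le ha hb hv h)
  rcases le_total u u' with h | h
  · exact (lintegral_minorized_le (hq h0 h) (smul_gammaMeasure_le ha h0 h) hf).trans
      (add_le_add_right (hsub hu h) _)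
  · rw [abs_sub_comm]
    exact (lintegral_minorizing_le (hq h0' h) (smul_gammaMeasure_le ha h0' h) hf).trans
      (add_le_add_right (hsub hu' h) _)

namespace RandomEffects

variable {p r : ℕ} (y : Fin p → Fin r → ℝ) {a₁ b₁ a₂ b₂ : ℝ}

lemma gibbsKernel_apply (ha₁ : 0 < a₁) (hb₁ : 0 < b₁) (ha₂ : 0 < a₂) (hb₂ : 0 < b₂)
    (η : State p) {A : Set (State p)} (hA : MeasurableSet A) :
    gibbsKernel y a₁ b₁ a₂ b₂ η A = ∫⁻ lθ, ∫⁻ le, drawState y (lθ, le) A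
      ∂gammaMeasure ((r : ℝ) * p / 2 + a₂) (b₂ + residualSq y η / 2)
      ∂gammaMeasure ((p : ℝ) / 2 + a₁) (b₁ + effectSq η / 2) := by
  have h₁ : IsMarkovKernel (drawTheta p a₁ b₁) := ⟨fun η =>
    isProbabilityMeasure_gammaMeasure (by positivity)
      (by have := effectSq_nonneg η; positivity)⟩
  have h₂ : IsMarkovKernel (drawError y a₂ b₂) := ⟨fun η =>
    isProbabilityMeasure_gammaMeasure (by positivity)
      (by have := residualSq_nonneg y η; positivity)⟩
  have hm : Measurable fun l => drawState y l A := Kernel.measurable_coe _ hA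
  change (drawState y ∘ₖ (drawTheta p a₁ b₁ ×ₖ drawError y a₂ b₂)) η A = _
  rw [Kernel.comp_apply' _ _ _ hA, Kernel.prod_apply, lintegral_prod _ hm.aemeasurable]
  rfl

/-- A Lipschitz constant of the transition kernel with respect to total variation. -/
noncomputable def kernelLipschitz (p r : ℕ) (a₁ b₁ a₂ b₂ : ℝ) : ℝ :=
  2 * ((p : ℝ) / 2 + a₁) / √b₁ + 2 * ((r : ℝ) * p / 2 + a₂) / √b₂ * √(2 * r)

lemma kernelLipschitz_pos (ha₁ : 0 < a₁) (hb₁ : 0 < b₁) (ha₂ : 0 < a₂) (hb₂ : 0 < b₂) :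
    0 < kernelLipschitz p r a₁ b₁ a₂ b₂ := by
  unfold kernelLipschitz; positivity

lemma gibbsKernel_apply_le (hp : 0 < p) (ha₁ : 0 < a₁) (hb₁ : 0 < b₁) (ha₂ : 0 < a₂)
    (hb₂ : 0 < b₂) (η η' : State p) {A : Set (State p)} (hA : MeasurableSet A) :
    gibbsKernel y a₁ b₁ a₂ b₂ η A ≤ gibbsKernel y a₁ b₁ a₂ b₂ η' A
      + ENNReal.ofReal (kernelLipschitz p r a₁ b₁ a₂ b₂ * dist η η') := by
  have hmk : IsMarkovKernel (drawState y) := by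
    unfold drawState
    exact Kernel.IsMarkovKernel.map _ measurable_assemble
  have hm : Measurable fun l => drawState y l A := Kernel.measurable_coe _ hA
  have hu : ∀ η : State p, b₁ ≤ b₁ + effectSq η / 2 := fun η => by
    linarith [effectSq_nonneg η]
  have hv : ∀ η : State p, b₂ ≤ b₂ + residualSq y η / 2 := fun η => by
    linarith [residualSq_nonneg y η]
  have hα : 0 < (p : ℝ) / 2 + a₁ := by positivity
  have hβ : 0 < (r : ℝ) * p / 2 + a₂ := by positivity
  have := isProbabilityMeasure_gammaMeasure hα (hb₁.trans_le (hu η))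
  have := isProbabilityMeasure_gammaMeasure hα (hb₁.trans_le (hu η'))
  have := isProbabilityMeasure_gammaMeasure hβ (hb₂.trans_le (hv η'))
  have d1 : |√(b₁ + effectSq η / 2) - √(b₁ + effectSq η' / 2)| ≤ dist η η' :=
    abs_le_of_sq_le_sq (sq_sqrt_effect_sub_le hb₁ η η') dist_nonneg
  have d2 : |√(b₂ + residualSq y η / 2) - √(b₂ + residualSq y η' / 2)|
      ≤ √(2 * r) * dist η η' := by
    refine abs_le_of_sq_le_sq ((sq_sqrt_residual_sub_le y hp hb₂ η η').trans_eq ?_)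
      (by positivity)
    rw [mul_pow, Real.sq_sqrt (by positivity)]
  rw [gibbsKernel_apply y ha₁ hb₁ ha₂ hb₂ η hA, gibbsKernel_apply y ha₁ hb₁ ha₂ hb₂ η' hA]
  have s1 : ∀ lθ, ∫⁻ le, drawState y (lθ, le) A
        ∂gammaMeasure ((r : ℝ) * p / 2 + a₂) (b₂ + residualSq y η' / 2) ≤ 1 := fun lθ =>
    (lintegral_mono fun _ => prob_le_one).trans (by simp)
  refine (lintegral_mono fun lθ => lintegral_gammaMeasure_le hβ hb₂ (hv η) (hv η')
    fun le => prob_le_one).trans ?_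
  rw [lintegral_add_right _ measurable_const, lintegral_const, measure_univ, mul_one]
  refine (add_le_add_left (lintegral_gammaMeasure_le hα hb₁ (hu η) (hu η') s1) _).trans ?_
  rw [add_assoc, ← ENNReal.ofReal_add (by positivity) (by positivity)]
  refine add_le_add_right (ENNReal.ofReal_le_ofReal ?_) _
  unfold kernelLipschitz
  rw [add_mul, mul_assoc (_ / √b₂)]
  gcongr

lemma gibbsKernel_lipschitz (hp : 0 < p) (ha₁ : 0 < a₁) (hb₁ : 0 < b₁) (ha₂ : 0 < a₂)
    (hb₂ : 0 < b₂) (η η' : State p) {A : Set (State p)} (hA : MeasurableSet A) :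
    ENNReal.ofReal |(gibbsKernel y a₁ b₁ a₂ b₂ η).real A - (gibbsKernel y a₁ b₁ a₂ b₂ η').real A|
      ≤ (kernelLipschitz p r a₁ b₁ a₂ b₂).toNNReal * edist η η' := by
  have hK := isMarkovKernel_gibbsKernel y ha₁ hb₁ ha₂ hb₂
  have hL := (kernelLipschitz_pos (p := p) (r := r) ha₁ hb₁ ha₂ hb₂).le
  have key : ∀ η η' : State p, (gibbsKernel y a₁ b₁ a₂ b₂ η).real A
      ≤ (gibbsKernel y a₁ b₁ a₂ b₂ η').real A + kernelLipschitz p r a₁ b₁ a₂ b₂ * dist η η' := by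
    intro η η'
    have h := gibbsKernel_apply_le y hp ha₁ hb₁ ha₂ hb₂ η η' hA
    have h' := ENNReal.toReal_mono (by finiteness) h
    rwa [ENNReal.toReal_add (by finiteness) (by finiteness),
      ENNReal.toReal_ofReal (by positivity)] at h'
  rw [edist_dist, ← ENNReal.ofReal, ← ENNReal.ofReal_mul hL]
  refine ENNReal.ofReal_le_ofReal (abs_le.2 ⟨?_, ?_⟩)
  · have := key η' η
    rw [dist_comm] at this
    linarith
  · linarith [key η η']

end RandomEffects

/-- A chain whose kernel is Lipschitz in total variation converges in total variation at least as
fast as in the Wasserstein distance. -/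
lemma convergenceRate_totalVariationDist_le {X : Type*} [PseudoEMetricSpace X] [MeasurableSpace X]
    {K : Kernel X X} [IsMarkovKernel K] {Q : Measure X} [IsProbabilityMeasure Q]
    (hQ : K.Invariant Q) {c : ℝ≥0} (hc : c ≠ 0)
    (hLip : ∀ (x x' : X) (A : Set X), MeasurableSet A →
      ENNReal.ofReal |(K x).real A - (K x').real A| ≤ c * edist x x')
    {ρ : ℝ} (h0 : 0 < ρ) (h1 : ρ ≤ 1) (M : X → ℝ≥0)
    (hM : ∀ (x : X) (m : ℕ), wassersteinDist ((K ^ m) x) Q ≤ M x * ENNReal.ofReal ρ ^ m) :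
    convergenceRate totalVariationDist K Q ≤ ρ := by
  -- The `1` covers `m = 0`, where no smoothing step is available. For `m + 1` steps the last one is
  -- spent on passing to total variation, which costs the factor `1/ρ`.
  refine convergenceRate_le h0.le h1 (fun x => 1 + c * M x / ρ.toNNReal) fun x m => ?_
  have hρ : ρ.toNNReal ≠ 0 := by simpa using h0
  have hρ' : (ρ.toNNReal : ℝ≥0∞) ≠ 0 := by exact_mod_cast hρ
  change _ ≤ _ * (ρ.toNNReal : ℝ≥0∞) ^ m
  cases m with
  | zero =>
    have := isMarkovKernel_pow K 0
    refine (totalVariationDist_le_one _ _).trans ?_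
    rw [pow_zero, mul_one]
    exact_mod_cast (le_self_add : (1 : ℝ≥0) ≤ 1 + c * M x / ρ.toNNReal)
  | succ m =>
    have e : (K ^ (m + 1)) x = ((K ^ m) x).bind K := by
      rw [pow_succ']
      exact Kernel.comp_apply K (K ^ m) x
    calc totalVariationDist ((K ^ (m + 1)) x) Q
        = totalVariationDist (((K ^ m) x).bind K) (Q.bind K) := by rw [e, hQ.def]
      _ ≤ c * wassersteinDist ((K ^ m) x) Q := totalVariationDist_bind_le hc hLip _ _
      _ ≤ c * (M x * (ρ.toNNReal : ℝ≥0∞) ^ m) := by gcongr; exact hM x m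
      _ = ((c * M x / ρ.toNNReal : ℝ≥0) : ℝ≥0∞) * (ρ.toNNReal : ℝ≥0∞) ^ (m + 1) := by
        have h : (c * M x / ρ.toNNReal) * ρ.toNNReal = c * M x := div_mul_cancel₀ _ hρ
        rw [pow_succ', ← mul_assoc, ← mul_assoc]
        norm_cast
        rw [h]
      _ ≤ _ := by
        gcongr
        exact le_add_self

/-! ### Geometric convergence for a fixed number of groups -/

namespace RandomEffects

/-- The contraction factor of the chain. -/
noncomputable def contractionRate (a₁ b₁ b₂ l₁ l₂ : ℝ) (p r : ℕ) : ℝ :=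
  12 * momentConst a₁ b₁ b₂ l₁ l₂ * (√(smallness p r) + 1 / √(p : ℝ))

section Convergence

variable {p r : ℕ} (y : Fin p → Fin r → ℝ) {a₁ b₁ a₂ b₂ l₁ l₂ : ℝ}

lemma contractionRate_pos (hp : 0 < p) (ha₁ : 0 < a₁) (hb₁ : 0 < b₁) (hb₂ : 0 < b₂)
    (hl₁ : 0 < l₁) (hl₂ : 0 < l₂) : 0 < contractionRate a₁ b₁ b₂ l₁ l₂ p r := by
  have hc := one_le_momentConst ha₁ hb₁ hb₂ hl₁ hl₂
  have hp' : (0 : ℝ) < p := by exact_mod_cast hp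
  unfold contractionRate
  positivity

variable (hp : 8 ≤ p) (hpr : p ≤ r) (ha₁ : 0 < a₁) (hb₁ : 0 < b₁) (ha₂ : 0 < a₂) (hb₂ : 0 < b₂)
  (hl₁ : 0 < l₁) (hl₂ : 0 < l₂) (hA : betweenSq y ≤ l₁ * p) (hW : withinSq y ≤ l₂ * (r * p))
  (hpc : 2 * √(momentConst a₁ b₁ b₂ l₁ l₂) ≤ p)

include hp hpr ha₁ hb₁ ha₂ hb₂ hl₁ hl₂ hA hW hpc in
-- The drift coefficient `√C/p` is at most `1/2` by `hpc`, and the constant term `√C (p + 1)` is at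
-- most `2 √C p`. The fixed point of `v ↦ v/2 + 2 √C p` is `4 √C p`.
lemma lintegral_energy_posterior_le :
    ∫⁻ η, ENNReal.ofReal (energy y η) ∂posterior y a₁ b₁ a₂ b₂
      ≤ ENNReal.ofReal (4 * √(momentConst a₁ b₁ b₂ l₁ l₂) * p) := by
  have hK := isMarkovKernel_gibbsKernel y ha₁ hb₁ ha₂ hb₂
  have hQ := isProbabilityMeasure_posterior y (by omega) (by omega) ha₁ hb₁ ha₂ hb₂
  have hP : (8 : ℝ) ≤ p := by exact_mod_cast hp
  have hc : 1 ≤ √(momentConst a₁ b₁ b₂ l₁ l₂) := by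
    rw [Real.one_le_sqrt]; exact one_le_momentConst ha₁ hb₁ hb₂ hl₁ hl₂
  set c := √(momentConst a₁ b₁ b₂ l₁ l₂)
  refine lintegral_invariant_le_of_drift (l := ENNReal.ofReal (1 / 2))
    (L := ENNReal.ofReal (2 * c * p))
    (invariant_posterior y (by omega) (by omega) ha₁ hb₁ ha₂ hb₂)
    (measurable_energy y).ennreal_ofReal (fun _ => ENNReal.ofReal_ne_top) ?_ ?_ fun η => ?_
  · rw [← ENNReal.ofReal_one]
    exact (ENNReal.ofReal_lt_ofReal_iff one_pos).2 (by norm_num)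
  · rw [← ENNReal.ofReal_mul (by norm_num), ← ENNReal.ofReal_add (by positivity) (by positivity)]
    refine ENNReal.ofReal_le_ofReal (le_of_eq ?_)
    ring
  · have hV := energy_nonneg y η
    have hF : Measurable (randomMap y b₁ b₂ η) :=
      (measurable_randomMap y b₁ b₂).comp measurable_prodMk_left
    rw [gibbsKernel_eq_map y ha₁ hb₁ ha₂ hb₂ η, lintegral_map (measurable_energy y).ennreal_ofReal
      hF, ← ENNReal.ofReal_mul (by norm_num), ← ENNReal.ofReal_add (by positivity) (by positivity)]
    refine (energy_drift y hp hpr ha₁ hb₁ ha₂ hb₂ hl₁ hl₂ hA hW η).trans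
      (ENNReal.ofReal_le_ofReal ?_)
    change c * _ ≤ _
    have e : c * (p + (p + energy y η) / p) = c * p + c + c / p * energy y η := by
      field_simp
      ring
    have h1 : c / p ≤ 1 / 2 := by
      rw [div_le_iff₀ (by positivity)]; linarith
    have h2 := mul_le_mul_of_nonneg_right h1 hV
    rw [e]
    nlinarith

include hp hpr ha₁ hb₁ ha₂ hb₂ hl₁ hl₂ hA hW hpc in
theorem wassersteinDist_gibbsKernel_pow_le (η : State p) (m : ℕ) :
    wassersteinDist ((gibbsKernel y a₁ b₁ a₂ b₂ ^ m) η) (posterior y a₁ b₁ a₂ b₂)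
      ≤ ENNReal.ofReal (energy y η + (1 + 4 * √(momentConst a₁ b₁ b₂ l₁ l₂)) * p)
        * ENNReal.ofReal (contractionRate a₁ b₁ b₂ l₁ l₂ p r) ^ m := by
  have hprob := isProbabilityMeasure_noiseLaw (p := p) (r := r) ha₁ ha₂
  have hQ := isProbabilityMeasure_posterior y (by omega) (by omega) ha₁ hb₁ ha₂ hb₂
  have hρ : 0 < contractionRate a₁ b₁ b₂ l₁ l₂ p r :=
    contractionRate_pos (by omega) ha₁ hb₁ hb₂ hl₁ hl₂
  have hV := energy_nonneg y η
  have h := wassersteinDist_pow_le (noiseLaw p r a₁ a₂) (measurable_randomMap y b₁ b₂)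
    (gibbsKernel_eq_map y ha₁ hb₁ ha₂ hb₂)
    (invariant_posterior y (by omega) (by omega) ha₁ hb₁ ha₂ hb₂)
    (d := fun z => ENNReal.ofReal (cost y z.1 z.2)) (measurable_cost y).ennreal_ofReal
    (fun η η' => by
      rw [edist_dist]
      exact ENNReal.ofReal_le_ofReal (dist_le_cost y (by omega) η η'))
    (ρ := ENNReal.ofReal (contractionRate a₁ b₁ b₂ l₁ l₂ p r))
    (fun η η' => by
      rw [← ENNReal.ofReal_mul hρ.le]
      exact cost_contraction y hp hpr ha₁ hb₁ ha₂ hb₂ hl₁ hl₂ hA hW η η') η m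
  refine h.trans ?_
  rw [mul_comm]
  gcongr
  calc ∫⁻ η', ENNReal.ofReal (cost y η η') ∂posterior y a₁ b₁ a₂ b₂
      ≤ ∫⁻ η', (ENNReal.ofReal (p + energy y η) + ENNReal.ofReal (energy y η'))
          ∂posterior y a₁ b₁ a₂ b₂ := by
        refine lintegral_mono fun η' => ?_
        rw [← ENNReal.ofReal_add (by positivity) (energy_nonneg y η')]
        refine ENNReal.ofReal_le_ofReal ((cost_le_mul y η η').trans_eq ?_)
        exact mul_pairWeight y (by omega) η η'
    _ = ENNReal.ofReal (p + energy y η)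
          + ∫⁻ η', ENNReal.ofReal (energy y η') ∂posterior y a₁ b₁ a₂ b₂ := by
        rw [lintegral_add_left measurable_const, lintegral_const, measure_univ, mul_one]
    _ ≤ ENNReal.ofReal (p + energy y η)
          + ENNReal.ofReal (4 * √(momentConst a₁ b₁ b₂ l₁ l₂) * p) := by
        gcongr
        exact lintegral_energy_posterior_le y hp hpr ha₁ hb₁ ha₂ hb₂ hl₁ hl₂ hA hW hpc
    _ = _ := by
        rw [← ENNReal.ofReal_add (by positivity) (by positivity)]
        ring_nf

include hp hpr ha₁ hb₁ ha₂ hb₂ hl₁ hl₂ hA hW hpc in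
lemma convergenceRate_wassersteinDist_le (hρ : contractionRate a₁ b₁ b₂ l₁ l₂ p r ≤ 1) :
    convergenceRate wassersteinDist (gibbsKernel y a₁ b₁ a₂ b₂) (posterior y a₁ b₁ a₂ b₂)
      ≤ contractionRate a₁ b₁ b₂ l₁ l₂ p r :=
  convergenceRate_le (contractionRate_pos (by omega) ha₁ hb₁ hb₂ hl₁ hl₂).le hρ _
    (wassersteinDist_gibbsKernel_pow_le y hp hpr ha₁ hb₁ ha₂ hb₂ hl₁ hl₂ hA hW hpc)

include hp hpr ha₁ hb₁ ha₂ hb₂ hl₁ hl₂ hA hW hpc in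
lemma convergenceRate_gibbsKernel_totalVariationDist_le
    (hρ : contractionRate a₁ b₁ b₂ l₁ l₂ p r ≤ 1) :
    convergenceRate totalVariationDist (gibbsKernel y a₁ b₁ a₂ b₂) (posterior y a₁ b₁ a₂ b₂)
      ≤ contractionRate a₁ b₁ b₂ l₁ l₂ p r := by
  have hK := isMarkovKernel_gibbsKernel y ha₁ hb₁ ha₂ hb₂
  have hQ := isProbabilityMeasure_posterior y (by omega) (by omega) ha₁ hb₁ ha₂ hb₂
  have hc : (kernelLipschitz p r a₁ b₁ a₂ b₂).toNNReal ≠ 0 := by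
    rw [Ne, Real.toNNReal_eq_zero, not_le]
    exact kernelLipschitz_pos ha₁ hb₁ ha₂ hb₂
  exact convergenceRate_totalVariationDist_le
    (invariant_posterior y (by omega) (by omega) ha₁ hb₁ ha₂ hb₂) hc
    (fun η η' A hA => gibbsKernel_lipschitz y (by omega) ha₁ hb₁ ha₂ hb₂ η η' hA)
    (contractionRate_pos (by omega) ha₁ hb₁ hb₂ hl₁ hl₂) hρ _
    (wassersteinDist_gibbsKernel_pow_le y hp hpr ha₁ hb₁ ha₂ hb₂ hl₁ hl₂ hA hW hpc)

end Convergence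

/-! ### The contraction factor tends to zero -/

section Asymptotics

variable {r : ℕ → ℕ} {δ : ℝ}

lemma tendsto_cube_div_sq (hδ : 0 < δ)
    (h : Tendsto (fun p : ℕ => (r p : ℝ) ^ 2 / (p : ℝ) ^ (3 + δ)) atTop atTop) :
    Tendsto (fun p : ℕ => (p : ℝ) ^ 3 / (r p : ℝ) ^ 2) atTop (𝓝 0) := by
  refine squeeze_zero' (Eventually.of_forall fun p => by positivity) ?_ h.inv_tendsto_atTop
  filter_upwards [eventually_ge_atTop 1] with p hp
  have hp' : (1 : ℝ) ≤ p := by exact_mod_cast hp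
  rw [Pi.inv_apply, inv_div]
  gcongr
  rw [← Real.rpow_natCast]
  exact Real.rpow_le_rpow_of_exponent_le hp' (by push_cast; linarith)

/-- For `p ≥ 1`, `(p/r)² ≤ p³/r²`. -/
lemma tendsto_div_of_tendsto_cube_div_sq
    (h : Tendsto (fun p : ℕ => (p : ℝ) ^ 3 / (r p : ℝ) ^ 2) atTop (𝓝 0)) :
    Tendsto (fun p : ℕ => (p : ℝ) / (r p : ℝ)) atTop (𝓝 0) := by
  have hs := h.sqrt
  rw [Real.sqrt_zero] at hs
  refine squeeze_zero' (Eventually.of_forall fun p => by positivity) ?_ hs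
  filter_upwards [eventually_ge_atTop 1] with p hp
  have hp' : (1 : ℝ) ≤ p := by exact_mod_cast hp
  refine Real.le_sqrt_of_sq_le ?_
  rw [div_pow]
  gcongr
  norm_num

lemma tendsto_smallness
    (h : Tendsto (fun p : ℕ => (p : ℝ) ^ 3 / (r p : ℝ) ^ 2) atTop (𝓝 0)) :
    Tendsto (fun p => smallness p (r p)) atTop (𝓝 0) := by
  have := (tendsto_one_div_atTop_nhds_zero_nat (𝕜 := ℝ)).add
    (tendsto_div_of_tendsto_cube_div_sq h) |>.add h
  simpa [smallness] using this

lemma tendsto_contractionRate (a₁ b₁ b₂ l₁ l₂ : ℝ)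
    (h : Tendsto (fun p : ℕ => (p : ℝ) ^ 3 / (r p : ℝ) ^ 2) atTop (𝓝 0)) :
    Tendsto (fun p => contractionRate a₁ b₁ b₂ l₁ l₂ p (r p)) atTop (𝓝 0) := by
  have h1 := (tendsto_smallness h).sqrt
  have h2 := (tendsto_one_div_atTop_nhds_zero_nat (𝕜 := ℝ)).sqrt
  rw [Real.sqrt_zero] at h1 h2
  have h3 := (h1.add h2).const_mul (12 * momentConst a₁ b₁ b₂ l₁ l₂)
  simpa [contractionRate] using h3

end Asymptotics

end RandomEffects

/-! ### The main theorem -/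

theorem proposition10
    (a₁ b₁ a₂ b₂ : ℝ) (ha₁ : 0 < a₁) (hb₁ : 0 < b₁) (ha₂ : 0 < a₂) (hb₂ : 0 < b₂)
    (r : ℕ → ℕ) (y : (p : ℕ) → Fin p → Fin (r p) → ℝ)
    (δ : ℝ) (hδ : 0 < δ)
    (hE1 : Tendsto (fun p : ℕ => (r p : ℝ) ^ 2 / (p : ℝ) ^ (3 + δ)) atTop atTop)
    (l₁ l₂ : ℝ) (hl₁ : 0 < l₁) (hl₂ : 0 < l₂)
    (hE2 : ∀ᶠ p : ℕ in atTop,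
      1 / (p : ℝ) * ∑ i, (RandomEffects.groupMean (y p) i - RandomEffects.grandMean (y p)) ^ 2
        < l₁ ∧
      1 / ((r p : ℝ) * p) * ∑ i, ∑ j, (y p i j - RandomEffects.groupMean (y p) i) ^ 2 < l₂) :
    (∃ L₀ : ℝ, 0 < L₀ ∧ ∃ ρ : ℕ → ℝ,
      (∀ᶠ p : ℕ in atTop, 0 ≤ ρ p ∧ ρ p < 1 ∧
        ∀ (η : RandomEffects.State p) (m : ℕ),
          wassersteinDist ((RandomEffects.gibbsKernel (y p) a₁ b₁ a₂ b₂ ^ m) η)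
              (RandomEffects.posterior (y p) a₁ b₁ a₂ b₂)
            ≤ ENNReal.ofReal (4 *
                (∑ i : Fin p, (η i.succ + RandomEffects.grandMean (y p)
                      - RandomEffects.groupMean (y p) i) ^ 2
                  + (η 0 - √(p : ℝ) * RandomEffects.grandMean (y p)) ^ 2 + L₀ * p) * ρ p ^ m)) ∧
      Tendsto ρ atTop (𝓝 0)) ∧
    Tendsto (fun p : ℕ => convergenceRate wassersteinDist
      (RandomEffects.gibbsKernel (y p) a₁ b₁ a₂ b₂)
      (RandomEffects.posterior (y p) a₁ b₁ a₂ b₂)) atTop (𝓝 0) ∧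
    Tendsto (fun p : ℕ => convergenceRate totalVariationDist
      (RandomEffects.gibbsKernel (y p) a₁ b₁ a₂ b₂)
      (RandomEffects.posterior (y p) a₁ b₁ a₂ b₂)) atTop (𝓝 0) := by
  open RandomEffects in
  have hcube := tendsto_cube_div_sq hδ hE1
  have hρ := tendsto_contractionRate a₁ b₁ b₂ l₁ l₂ hcube
  have hev : ∀ᶠ p : ℕ in atTop, 8 ≤ p ∧ p ≤ r p ∧ betweenSq (y p) ≤ l₁ * p ∧
      withinSq (y p) ≤ l₂ * (r p * p) ∧ 2 * √(momentConst a₁ b₁ b₂ l₁ l₂) ≤ p ∧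
      contractionRate a₁ b₁ b₂ l₁ l₂ p (r p) < 1 := by
    filter_upwards [eventually_ge_atTop 8, hE2, hE1.eventually_gt_atTop 0,
      (tendsto_div_of_tendsto_cube_div_sq hcube).eventually_lt_const one_pos,
      tendsto_natCast_atTop_atTop.eventually_ge_atTop (2 * √(momentConst a₁ b₁ b₂ l₁ l₂)),
      hρ.eventually_lt_const one_pos] with p h8 ⟨hA, hW⟩ hr hpr hc h1
    have hp : (0 : ℝ) < p := by positivity
    -- Positivity of `r p` is extracted from (E1): with `r p = 0` the ratio there would be `0`, yet
    -- it is eventually positive.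
    have hr0 : (0 : ℝ) < r p := by
      rcases Nat.eq_zero_or_pos (r p) with h | h
      · simp [h] at hr
      · exact_mod_cast h
    refine ⟨h8, ?_, ?_, ?_, hc, h1⟩
    · rw [div_lt_one hr0] at hpr
      exact_mod_cast hpr.le
    · rw [one_div_mul_eq_div, div_lt_iff₀ hp] at hA
      exact hA.le
    · rw [one_div_mul_eq_div, div_lt_iff₀ (by positivity)] at hW
      exact hW.le
  -- In `L₀`, the `1` comes from the summand `p` of the truncated cost, and the rest from the
  -- posterior mean of the energy.
  refine ⟨⟨1 + 4 * √(momentConst a₁ b₁ b₂ l₁ l₂), by positivity,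
    fun p => contractionRate a₁ b₁ b₂ l₁ l₂ p (r p), ?_, hρ⟩, ?_, ?_⟩
  · filter_upwards [hev] with p ⟨h8, hpr, hA, hW, hc, h1⟩
    have hpos : 0 < contractionRate a₁ b₁ b₂ l₁ l₂ p (r p) :=
      contractionRate_pos (by omega) ha₁ hb₁ hb₂ hl₁ hl₂
    refine ⟨hpos.le, h1, fun η m => ?_⟩
    refine (wassersteinDist_gibbsKernel_pow_le (y p) h8 hpr ha₁ hb₁ ha₂ hb₂ hl₁ hl₂ hA hW hc
      η m).trans ?_
    have hV := energy_nonneg (y p) η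
    rw [← ENNReal.ofReal_pow hpos.le, ← ENNReal.ofReal_mul (by positivity)]
    refine ENNReal.ofReal_le_ofReal (mul_le_mul_of_nonneg_right ?_ (by positivity))
    change _ ≤ 4 * (energy (y p) η + _)
    -- The bound already holds with `1` in place of the factor `4`.
    exact le_mul_of_one_le_left (by positivity) (by norm_num)
  · refine squeeze_zero' (Eventually.of_forall fun p => convergenceRate_nonneg _ _ _) ?_ hρ
    filter_upwards [hev] with p ⟨h8, hpr, hA, hW, hc, h1⟩
    exact convergenceRate_wassersteinDist_le (y p) h8 hpr ha₁ hb₁ ha₂ hb₂ hl₁ hl₂ hA hW hc h1.le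
  · refine squeeze_zero' (Eventually.of_forall fun p => convergenceRate_nonneg _ _ _) ?_ hρ
    filter_upwards [hev] with p ⟨h8, hpr, hA, hW, hc, h1⟩
    exact convergenceRate_gibbsKernel_totalVariationDist_le (y p) h8 hpr ha₁ hb₁ ha₂ hb₂ hl₁ hl₂
      hA hW hc h1.le
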